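/- **Setting.** Let $R$ be a finite irreducible (reduced, crystallographic) root system in a finite dimensional real vector space $V$, with positive roots $R^+$, coroots $\alpha^\vee\in V^*$ and coweight lattice $X^\vee=\{v\in V^*\mid\langle\alpha,v\rangle\in\mathbb Z\ \forall\alpha\in R\}$. Put $H_{\alpha,n}=\{\mu\in V\mid\langle\mu,\alpha^\vee\rangle=n\}$, $H_{\alpha,n}^-=\{\mu\in V\mid\langle\mu,\alpha^\vee\rangle<n\}$ and $s_{\alpha,n}(\mu)=\mu-(\langle\mu,\alpha^\vee\rangle-n)\alpha$, let $t_\gamma$ be the translation by $\gamma$, and let $\widehat{\mathcal W}$ be the affine Weyl group generated by all $s_{\alpha,n}$ ($\alpha\in R^+$, $n\in\mathbb Z$). Let $\mathcal A$ be the set of alcoves, i.e. of connected components of $V\setminus\bigcup_{\alpha\in R^+,n\in\mathbb Z} H_{\alpha,n}$, and let $A_e$ be the alcove in the dominant chamber with $0$ in its closure. As $w\mapsto w(A_e)$ is a bijection $\widehat{\mathcal W}\to\mathcal A$, there is a right action $w(A_e)\cdot v:=wv(A_e)$. Let $\mathcal V=\mathcal A/\mathbb ZR$ be the set of orbits under translation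 by $\mathbb ZR$, with its induced left and right actions. Let $\widehat{\mathcal S}$ be the set of reflections at those hyperplanes $H_{\alpha,n}$ whose intersection with the closure of $A_e$ has codimension $1$ in $V$. Let $k$ be a field of characteristic $\neq2$ such that $\alpha^\vee\notin k\beta^\vee$ in $X^\vee\otimes_{\mathbb Z}k$ for all $\alpha\ne\beta$ in $R^+$, and let $S$ be the symmetric algebra of $X^\vee\otimes_{\mathbb Z} k$. Let $T$ be a base ring: a commutative unital $S$-algebra, flat over $S$, with $I_T=R_T^+$, where $I_T$ is the set of $\alpha\in R^+$ such that $\alpha^\vee$ is not invertible in $T$, and $R^+_T$ is the set of $\alpha\in R^+$ such that some $s_{\alpha,m}$ lies in the group generated by all $t_\gamma$ ($\gamma\in\mathbb ZR$) and all $s_{\beta,n}$ ($\beta\in I_T$, $n\in\mathbb Z$). Let $\preceq_T$ be the order on $\mathcal A$ generated by $A\preceq_Tt_\gamma(A)$ for $\gamma\in\mathbb Z_{\ge0}R^+$ and $A\preceq_Ts_{\alpha,n}(A)$ for $\alpha\in R_T^+$, $n\in\mathbb Z$ and $A\subset H_{\alpha,n}^-$. Let $\mathcal A_T$ be $\mathcal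 A$ with the topology whose open sets are the lower sets for $\preceq_T$. For $\mathcal T\subset\mathcal A$ let $\mathcal T_\preceq$ be the smallest open set containing $\mathcal T$. Let $\mathcal Z_S=\{(z_x)\in\bigoplus_{x\in\mathcal V}S\mid z_x\equiv z_{s_{\alpha,0}x}\bmod\alpha^\vee\ \forall x\in\mathcal V,\alpha\in R^+\}$ and $\mathcal Z=\mathcal Z_S\otimes_ST\subset\bigoplus_{x\in\mathcal V}T$. For $s\in\widehat{\mathcal S}$ let $\mathcal Z^s=\{z\in\mathcal Z\mid z_x=z_{xs}\ \forall x\in\mathcal V\}$. A $\mathcal Z$-module is root torsion free if every $\alpha^\vee$ ($\alpha\in R^+$) acts injectively on it. Let $T^\emptyset$ be the localization of $T$ at all $\alpha^\vee$ ($\alpha\in R^+$). For $x\in\mathcal V$ and a $\mathcal Z$-module $M$, let the stalk $M^x$ be the image of $M$ in $T^\emptyset\otimes_{\mathcal Z}M$, where $\mathcal Z$ acts on $T^\emptyset$ through $z\mapsto z_x$. Let $\mathbf P=\mathbf P_T$ be the full subcategory of the category of presheaves of $\mathcal Z$-modules on $\mathcal A_T$ consisting of those $\mathscr M$ that satisfy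 the following. * $\mathscr M$ is flabby: all restriction homomorphisms are surjective. * $\mathscr M$ is finitary: $\mathscr M(\emptyset)=0$, and there is a finite set $\mathcal T\subset\mathcal A$ such that $\mathscr M(\mathcal J)\to\mathscr M((\mathcal J\cap\mathcal T)_\preceq)$ is an isomorphism for every open $\mathcal J$. * $\mathscr M$ is root torsion free: all $\mathscr M(\mathcal J)$ are root torsion free. * $\mathscr M$ satisfies the support condition: $\mathscr M(\mathcal J)^x\to\mathscr M((\mathcal J\cap x)_\preceq)^x$ is an isomorphism for every open $\mathcal J$ and every $x\in\mathcal V$. For a presheaf $\mathscr N$ let $\mathscr N^+$ be the image presheaf of $\mathscr N\to\bigl(\mathcal J\mapsto\bigoplus_{x\in\mathcal V}\mathscr N((\mathcal J\cap x)_\preceq)^x\bigr)$, with the canonical morphism $\mathscr N\to\mathscr N^+$. **Theorem.** Let $s\in\widehat{\mathcal S}$. For every open $\mathcal J\subset\mathcal A_T$ the set $\mathcal J^\sharp=\mathcal J\cup\mathcal Js$ is open. For $\mathscr M$ in $\mathbf P$ define the presheaf $\epsilon_s\mathscr M$ by $(\epsilon_s\mathscr M)(\mathcal J)=\mathcal Z\otimes_{\mathcal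 Z^s}\mathscr M(\mathcal J^\sharp)$. Then $\vartheta_s\mathscr M:=(\epsilon_s\mathscr M)^+$ is an object of $\mathbf P$, so that $\vartheta_s$ is a functor $\mathbf P\to\mathbf P$ with a natural transformation $\rho_s\colon\epsilon_s\to\vartheta_s$ (the canonical morphism to $(\cdot)^+$). It has the following properties. 1. For every $\mathscr M$ in $\mathbf P$ and every open $\mathcal J$ with $\mathcal J=\mathcal Js$, the homomorphism $\rho_s^{\mathscr M}(\mathcal J)\colon\epsilon_s\mathscr M(\mathcal J)\to\vartheta_s\mathscr M(\mathcal J)$ is an isomorphism of $\mathcal Z$-modules. 2. If $F\colon\mathbf P\to\mathbf P$ is a functor and $\sigma\colon\epsilon_s\to F$ is a natural transformation such that $\sigma^{\mathscr M}(\mathcal J)$ is an isomorphism for all $\mathscr M$ in $\mathbf P$ and all open $\mathcal J=\mathcal Js$, then there is a unique isomorphism of functors $e\colon\vartheta_s\to F$ with $e\circ\rho_s=\sigma$. In particular, $\vartheta_s$ is up to isomorphism the unique functor that admits such a natural transformation. -/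

import Mathlib

open CategoryTheory TopologicalSpace Opposite
open scoped TensorProduct

universe u

noncomputable section

namespace AlcoveSheaves

/-! ### Alcove geometry -/

section Geometry

variable {ι V N : Type*} [AddCommGroup V] [Module ℝ V] [AddCommGroup N] [Module ℝ N]
  {P : RootPairing ι ℝ V N} (b : P.Base)

/-- The (indices of the) positive roots determined by the base `b`. -/
def posRoots : Set ι := {i | b.IsPos i}

/-- The root lattice `ℤR`. -/
def rootLattice (P : RootPairing ι ℝ V N) : AddSubgroup V := AddSubgroup.closure (Set.range P.root)

/-- The monoid `ℤ_{≥ 0} R⁺`. -/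
def posCone : AddSubmonoid V := AddSubmonoid.closure (P.root '' posRoots b)

/-- The affine hyperplane `H_{α,n} = {μ | ⟨μ, α^∨⟩ = n}`. -/
def hyperplane (P : RootPairing ι ℝ V N) (i : ι) (n : ℤ) : Set V := {v | P.coroot' i v = n}

/-- The negative half space `H_{α,n}^- = {μ | ⟨μ, α^∨⟩ < n}`. -/
def negHalfSpace (P : RootPairing ι ℝ V N) (i : ι) (n : ℤ) : Set V := {v | P.coroot' i v < n}

/-- The complement of all the affine hyperplanes `H_{α,n}`, `α ∈ R⁺`, `n ∈ ℤ`. -/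
def regularSet : Set V := {v | ∀ i ∈ posRoots b, ∀ n : ℤ, v ∉ hyperplane P i n}

/-- The affine reflection `s_{α,n} : μ ↦ μ - (⟨μ, α^∨⟩ - n) α`. -/
def affineReflection (P : RootPairing ι ℝ V N) (i : ι) (n : ℤ) : V ≃ᵃ[ℝ] V :=
  (P.reflection i).toAffineEquiv.trans (AffineEquiv.constVAdd ℝ V ((n : ℝ) • P.root i))

theorem affineReflection_apply (i : ι) (n : ℤ) (v : V) :
    affineReflection P i n v = v - (P.coroot' i v - n) • P.root i := by
  simp [affineReflection, RootPairing.reflection_apply, sub_smul]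
  abel

/-- The translation `t_γ`. -/
abbrev translation (γ : V) : V ≃ᵃ[ℝ] V := AffineEquiv.constVAdd ℝ V γ

/-- The affine Weyl group, generated by the `s_{α,n}`, `α ∈ R⁺`, `n ∈ ℤ`. -/
def affineWeylGroup : Subgroup (V ≃ᵃ[ℝ] V) :=
  Subgroup.closure {w | ∃ i ∈ posRoots b, ∃ n : ℤ, w = affineReflection P i n}

variable [TopologicalSpace V]

/-- Alcoves: the connected components of the complement of the affine hyperplanes. -/
def Alcove : Type _ :=
  {A : Set V // ∃ v ∈ regularSet b, A = connectedComponentIn (regularSet b) v}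

instance : CoeOut (Alcove b) (Set V) := ⟨Subtype.val⟩

/-- The fundamental alcove `A_e`: the alcove in the dominant chamber with `0` in its closure. -/
def fundamentalAlcove : Set V :=
  {v | ∀ i ∈ posRoots b, 0 < P.coroot' i v ∧ P.coroot' i v < 1}

/-- The simple affine reflections: the reflections at those hyperplanes `H = H_{α,n}` for which
the intersection of `H` with the closure of `A_e` has codimension one in `V`, i.e. affinely
spans `H`. -/
def IsSimpleAffineReflection (s : V ≃ᵃ[ℝ] V) : Prop :=
  ∃ i ∈ posRoots b, ∃ n : ℤ, s = affineReflection P i n ∧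
    hyperplane P i n ⊆ affineSpan ℝ (closure (fundamentalAlcove b) ∩ hyperplane P i n)

/-- The graph of the right action `A ↦ A s` on alcoves: if `A = w(A_e)` with `w` in the affine
Weyl group, then `A s = (w s)(A_e)`. -/
def IsRightMul (s : V ≃ᵃ[ℝ] V) (A B : Alcove b) : Prop :=
  ∃ w ∈ affineWeylGroup b, (A : Set V) = w '' fundamentalAlcove b ∧
    (B : Set V) = (w * s) '' fundamentalAlcove b

/-- The set `𝒯 s = {A s | A ∈ 𝒯}`. -/
def rightMulSet (s : V ≃ᵃ[ℝ] V) (𝒯 : Set (Alcove b)) : Set (Alcove b) :=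
  {B | ∃ A ∈ 𝒯, IsRightMul b s A B}

/-- Two alcoves are equivalent if they lie in the same `ℤR`-orbit. -/
def orbitSetoid : Setoid (Alcove b) where
  r A B := ∃ γ ∈ rootLattice P, (B : Set V) = translation γ '' (A : Set V)
  iseqv :=
    { refl := fun A => ⟨0, zero_mem _, by ext; simp⟩
      symm := by
        rintro A B ⟨γ, hγ, h⟩
        refine ⟨-γ, neg_mem hγ, ?_⟩
        rw [h, Set.image_image]
        simp
      trans := by
        rintro A B C ⟨γ, hγ, h⟩ ⟨δ, hδ, h'⟩
        refine ⟨δ + γ, add_mem hδ hγ, ?_⟩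
        rw [h', h, Set.image_image]
        simp }

/-- The set `𝒱 = 𝒜 / ℤR` of `ℤR`-orbits of alcoves. -/
def Orbit : Type _ := Quotient (orbitSetoid b)

/-- The orbit map `π : 𝒜 → 𝒱`. -/
def orbitMap (A : Alcove b) : Orbit b := Quotient.mk (orbitSetoid b) A

end Geometry

/-! ### The symmetric algebra and base rings -/

section BaseRing

variable {ι V N : Type*} [AddCommGroup V] [Module ℝ V] [AddCommGroup N] [Module ℝ N]

/-- The coweight lattice `X^∨`. -/
def coweightLattice (P : RootPairing ι ℝ V N) : AddSubgroup N where
  carrier := {v | ∀ i, ∃ n : ℤ, P.root' i v = n}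
  zero_mem' i := ⟨0, by simp⟩
  add_mem' := by
    intro v w hv hw i
    obtain ⟨m, hm⟩ := hv i
    obtain ⟨n, hn⟩ := hw i
    exact ⟨m + n, by simp only [map_add, hm, hn, Int.cast_add]⟩
  neg_mem' := by
    intro v hv i
    obtain ⟨m, hm⟩ := hv i
    exact ⟨-m, by simp only [map_neg, hm, Int.cast_neg]⟩

/-- The coroot `α^∨` as an element of the coweight lattice. -/
def corootInLattice (P : RootPairing ι ℝ V N) [P.IsCrystallographic] (i : ι) :
    coweightLattice P :=
  ⟨P.coroot i, fun j => by
    obtain ⟨n, hn⟩ := P.exists_value (S := ℤ) j i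
    exact ⟨n, by simpa using hn.symm⟩⟩

/-- `X^∨_k = X^∨ ⊗_ℤ k`. -/
abbrev CoweightSpace (P : RootPairing ι ℝ V N) (k : Type*) [Field k] : Type _ :=
  k ⊗[ℤ] coweightLattice P

/-- The canonical image of `α^∨` in `X^∨_k`. -/
def corootK (P : RootPairing ι ℝ V N) [P.IsCrystallographic] (k : Type*) [Field k] (i : ι) :
    CoweightSpace P k := 1 ⊗ₜ corootInLattice P i

/-- The algebra `S = S(X^∨_k)`. -/
abbrev SymAlg (P : RootPairing ι ℝ V N) (k : Type*) [Field k] : Type _ :=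
  SymmetricAlgebra k (CoweightSpace P k)

/-- The canonical image of `α^∨` in `S`. -/
def corootS (P : RootPairing ι ℝ V N) [P.IsCrystallographic] (k : Type*) [Field k] (i : ι) :
    SymAlg P k := SymmetricAlgebra.ι k _ (corootK P k i)

/-- The GKM condition: the characteristic of `k` is not `2`, and `α^∨ ∉ k β^∨` in `X^∨_k` for
distinct positive roots `α`, `β`. -/
def GKM {P : RootPairing ι ℝ V N} [P.IsCrystallographic] (b : P.Base) (k : Type*) [Field k] :
    Prop :=
  ringChar k ≠ 2 ∧ ∀ i ∈ posRoots b, ∀ j ∈ posRoots b, i ≠ j →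
    corootK P k i ∉ Submodule.span k {corootK P k j}

variable {P : RootPairing ι ℝ V N} [P.IsCrystallographic] (b : P.Base)
  (k T : Type*) [Field k] [CommRing T] [Algebra (SymAlg P k) T]

/-- The image of `α^∨` in the `S`-algebra `T`. -/
def corootT (P : RootPairing ι ℝ V N) [P.IsCrystallographic] (k T : Type*) [Field k]
    [CommRing T] [Algebra (SymAlg P k) T] (i : ι) : T :=
  algebraMap (SymAlg P k) T (corootS P k i)

/-- The set `I_T` of positive roots `α` such that `α^∨` is not invertible in `T`. -/
def nonInvertibleRoots : Set ι := {i ∈ posRoots b | ¬ IsUnit (corootT P k T i)}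

/-- The group `Ŵ_T`, generated by the `t_γ` with `γ ∈ ℤR` and the `s_{α,m}` with `α ∈ I_T`. -/
def affineWeylGroupT : Subgroup (V ≃ᵃ[ℝ] V) :=
  Subgroup.closure ({w | ∃ γ ∈ rootLattice P, w = translation γ} ∪
    {w | ∃ i ∈ nonInvertibleRoots b k T, ∃ m : ℤ, w = affineReflection P i m})

/-- The set `R_T⁺` of positive roots `α` such that `s_{α,m} ∈ Ŵ_T` for some `m`. -/
def posRootsT : Set ι :=
  {i ∈ posRoots b | ∃ m : ℤ, affineReflection P i m ∈ affineWeylGroupT b k T}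

/-- Base rings: commutative `S`-algebras `T` that are flat over `S` and saturated, the latter
meaning that `I_T = R_T⁺`. -/
structure IsBaseRing : Prop where
  flat : Module.Flat (SymAlg P k) T
  saturated : nonInvertibleRoots b k T = posRootsT b k T

variable [TopologicalSpace V]

/-- The set of alcoves, to be endowed with the order `⪯_T` and the resulting topology. -/
def AlcoveSpace (b : P.Base) (k T : Type*) [Field k] [CommRing T] [Algebra (SymAlg P k) T] :
    Type _ := Alcove b

/-- The generating relations of `⪯_T`. -/
def orderStep (A B : Alcove b) : Prop :=
  (∃ γ ∈ posCone b, (B : Set V) = translation γ '' (A : Set V)) ∨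
    ∃ i ∈ posRootsT b k T, ∃ n : ℤ, (A : Set V) ⊆ negHalfSpace P i n ∧
      (B : Set V) = affineReflection P i n '' (A : Set V)

/-- The order `⪯_T`. -/
instance : Preorder (AlcoveSpace b k T) where
  le := Relation.ReflTransGen (orderStep b k T)
  le_refl _ := Relation.ReflTransGen.refl
  le_trans _ _ _ := Relation.ReflTransGen.trans

/-- The open subsets are the order ideals (lower sets) for `⪯_T`. -/
instance : TopologicalSpace (AlcoveSpace b k T) := Topology.lowerSet _

variable {b k T}

/-- The smallest open subset `𝒯_⪯` containing a set `𝒯` of alcoves. -/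
def openHull (𝒯 : Set (AlcoveSpace b k T)) : Opens (AlcoveSpace b k T) :=
  ⟨lowerClosure 𝒯, (lowerClosure 𝒯).lower⟩

theorem openHull_le {𝒯 : Set (AlcoveSpace b k T)} {U : Opens (AlcoveSpace b k T)}
    (h : 𝒯 ⊆ U) : openHull 𝒯 ≤ U :=
  fun _ hA => by
    obtain ⟨B, hB, hAB⟩ := hA
    exact U.isOpen hAB (h hB)

theorem openHull_mono {𝒮 𝒯 : Set (AlcoveSpace b k T)} (h : 𝒮 ⊆ 𝒯) :
    openHull 𝒮 ≤ openHull 𝒯 :=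
  lowerClosure_mono h

/-- The set of alcoves in the `ℤR`-orbit `x`. -/
def orbitSet (x : Orbit b) : Set (AlcoveSpace b k T) := {A | orbitMap b A = x}

/-- The open set `(𝒥 ∩ x)_⪯`. -/
def orbitHull (x : Orbit b) (U : Opens (AlcoveSpace b k T)) : Opens (AlcoveSpace b k T) :=
  openHull (U ∩ orbitSet x)

theorem orbitHull_le (x : Orbit b) (U : Opens (AlcoveSpace b k T)) : orbitHull x U ≤ U :=
  openHull_le Set.inter_subset_left

theorem orbitHull_mono (x : Orbit b) {U W : Opens (AlcoveSpace b k T)} (h : U ≤ W) :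
    orbitHull x U ≤ orbitHull x W :=
  openHull_mono (Set.inter_subset_inter_left _ h)

/-- The set `𝒯^♯ = 𝒯 ∪ 𝒯 s`. -/
def sharpSet (s : V ≃ᵃ[ℝ] V) (𝒯 : Set (AlcoveSpace b k T)) : Set (AlcoveSpace b k T) :=
  𝒯 ∪ rightMulSet b s 𝒯

theorem sharpSet_mono (s : V ≃ᵃ[ℝ] V) {𝒮 𝒯 : Set (AlcoveSpace b k T)} (h : 𝒮 ⊆ 𝒯) :
    sharpSet s 𝒮 ⊆ sharpSet s 𝒯 :=
  Set.union_subset_union h fun _ ⟨A, hA, hAB⟩ => ⟨A, h hA, hAB⟩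

/-- The functor `𝒥 ↦ 𝒥^♯` on open sets. Formally its value is the smallest open set that contains
`𝒥 ∪ 𝒥 s`; this is `𝒥 ∪ 𝒥 s` whenever the latter is open. -/
def sharpFunctor (s : V ≃ᵃ[ℝ] V) :
    Opens (AlcoveSpace b k T) ⥤ Opens (AlcoveSpace b k T) :=
  Monotone.functor (f := fun U => openHull (sharpSet s (U : Set (AlcoveSpace b k T))))
    fun _ _ h => openHull_mono (sharpSet_mono s h)

/-- A set of alcoves is `s`-invariant if `𝒯 = 𝒯 s`. -/
def IsInvariant (s : V ≃ᵃ[ℝ] V) (𝒯 : Set (AlcoveSpace b k T)) : Prop :=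
  𝒯 = rightMulSet b s 𝒯

end BaseRing

/-! ### The structure algebra -/

section StructureAlgebra

variable {ι V N : Type*} [AddCommGroup V] [Module ℝ V] [AddCommGroup N] [Module ℝ N]
  [TopologicalSpace V] {P : RootPairing ι ℝ V N} [P.IsCrystallographic] (b : P.Base)
  (k T : Type*) [Field k] [CommRing T] [Algebra (SymAlg P k) T]

/-- The structure algebra `𝒵_S` over `S`: the tuples `(z_x)`, indexed by the finite set `𝒱`, with
`z_x ≡ z_{s_α x}` modulo `α^∨` for all `x` and all positive roots `α`. -/
def structureAlgebraS : Subalgebra (SymAlg P k) (Orbit b → SymAlg P k) where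
  carrier := {z | ∀ i ∈ posRoots b, ∀ A B : Alcove b,
    (B : Set V) = affineReflection P i 0 '' (A : Set V) →
      corootS P k i ∣ z (orbitMap b A) - z (orbitMap b B)}
  mul_mem' := by
    intro y z hy hz i hi A B h
    have := dvd_add ((hy i hi A B h).mul_right (z (orbitMap b A)))
      ((hz i hi A B h).mul_left (y (orbitMap b B)))
    convert this using 1
    simp only [Pi.mul_apply]
    ring
  add_mem' := by
    intro y z hy hz i hi A B h
    have := dvd_add (hy i hi A B h) (hz i hi A B h)
    convert this using 1
    simp only [Pi.add_apply]
    ring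
  algebraMap_mem' := by
    intro r i hi A B h
    simp [Pi.algebraMap_apply]

/-- The structure algebra `𝒵 = 𝒵_T = 𝒵_S ⊗_S T`. -/
abbrev StructureAlgebra : Type _ := T ⊗[SymAlg P k] structureAlgebraS b k

/-- The coordinate homomorphism `𝒵_T → 𝒵^x = T`, `z ↦ z_x`. -/
def coord (x : Orbit b) : StructureAlgebra b k T →ₐ[T] T :=
  Algebra.TensorProduct.lift (AlgHom.id T T)
    ((Algebra.ofId (SymAlg P k) T).comp
      ((Pi.evalAlgHom (SymAlg P k) (fun _ : Orbit b => SymAlg P k) x).comp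
        (structureAlgebraS b k).val))
    fun _ _ => Commute.all _ _

/-- The subalgebra `𝒵^s` of `s`-invariants: the elements with `z_x = z_{x s}` for all `x`. -/
def invariants (s : V ≃ᵃ[ℝ] V) : Subalgebra T (StructureAlgebra b k T) where
  carrier := {z | ∀ A B : Alcove b, IsRightMul b s A B →
    coord b k T (orbitMap b A) z = coord b k T (orbitMap b B) z}
  mul_mem' := by
    intro y z hy hz A B h
    simp only [map_mul, hy A B h, hz A B h]
  add_mem' := by
    intro y z hy hz A B h
    simp only [map_add, hy A B h, hz A B h]
  algebraMap_mem' := by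
    intro r A B h
    simp only [AlgHom.commutes]

end StructureAlgebra

/-! ### Modules over the structure algebra -/

section Modules

variable {ι : Type*} {V N k T : Type u} [AddCommGroup V] [Module ℝ V] [AddCommGroup N]
  [Module ℝ N] [TopologicalSpace V] {P : RootPairing ι ℝ V N} [P.IsCrystallographic] {b : P.Base}
  [Field k] [CommRing T] [Algebra (SymAlg P k) T]

/-- `M` is root torsion free if every `α^∨`, `α ∈ R⁺`, acts injectively on `M`. -/
def RootTorsionFree (M : ModuleCat.{u} (StructureAlgebra b k T)) : Prop :=
  ∀ i ∈ posRoots b, Function.Injective fun m : M =>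
    algebraMap T (StructureAlgebra b k T) (corootT P k T i) • m

/-- The kernel of `M → M^x`. Here `M^x` is the image of `M` in the summand `(M ⊗_T T^∅)^x` of
`M ⊗_T T^∅`, where `T^∅` is the localization of `T` at the coroots; that summand is the
localization at the coroots of `𝒵^x ⊗_𝒵 M = M / I_x M`, with `I_x` the kernel of `𝒵 → 𝒵^x`. So the
kernel consists of the `m` with `d m ∈ I_x M` for some product `d` of positive coroots. -/
def stalkKer (x : Orbit b) (M : ModuleCat.{u} (StructureAlgebra b k T)) :
    Submodule (StructureAlgebra b k T) M where
  carrier := {m | ∃ d ∈ Submonoid.closure (corootT P k T '' posRoots b),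
    algebraMap T (StructureAlgebra b k T) d • m ∈
      RingHom.ker (coord b k T x) • (⊤ : Submodule (StructureAlgebra b k T) M)}
  zero_mem' := ⟨1, one_mem _, by simp⟩
  add_mem' := by
    rintro m n ⟨d, hd, hm⟩ ⟨e, he, hn⟩
    refine ⟨d * e, mul_mem hd he, ?_⟩
    rw [smul_add, map_mul]
    refine add_mem ?_ ?_
    · rw [mul_comm, mul_smul]
      exact Submodule.smul_mem _ _ hm
    · rw [mul_smul]
      exact Submodule.smul_mem _ _ hn
  smul_mem' := by
    rintro z m ⟨d, hd, hm⟩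
    refine ⟨d, hd, ?_⟩
    rw [smul_comm]
    exact Submodule.smul_mem _ _ hm

theorem stalkKer_map (x : Orbit b) {M M' : ModuleCat.{u} (StructureAlgebra b k T)} (f : M ⟶ M') :
    stalkKer x M ≤ (stalkKer x M').comap f.hom := by
  rintro m ⟨d, hd, hm⟩
  refine ⟨d, hd, ?_⟩
  rw [← map_smul]
  have h := Submodule.mem_map_of_mem (f := f.hom) hm
  rw [Submodule.map_smul''] at h
  exact Submodule.smul_mono le_rfl le_top h

/-- The functor `M ↦ M^x` on `𝒵`-modules. -/
def stalk (x : Orbit b) :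
    ModuleCat.{u} (StructureAlgebra b k T) ⥤ ModuleCat.{u} (StructureAlgebra b k T) where
  obj M := ModuleCat.of _ (M ⧸ stalkKer x M)
  map {M M'} f := ModuleCat.ofHom (Submodule.mapQ _ _ f.hom (stalkKer_map x f))
  map_id M := by
    ext m
    rfl
  map_comp f g := by
    ext m
    rfl

/-- The functor `M ↦ 𝒵 ⊗_{𝒵^s} M` on `𝒵`-modules. -/
def induce (s : V ≃ᵃ[ℝ] V) :
    ModuleCat.{u} (StructureAlgebra b k T) ⥤ ModuleCat.{u} (StructureAlgebra b k T) :=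
  ModuleCat.restrictScalars (algebraMap (invariants b k T s) (StructureAlgebra b k T)) ⋙
    ModuleCat.extendScalars (R := invariants b k T s) (algebraMap _ (StructureAlgebra b k T))

end Modules

/-! ### Presheaves on the space of alcoves -/

section Presheaves

variable {ι : Type*} {V N : Type u} [AddCommGroup V] [Module ℝ V] [AddCommGroup N]
  [Module ℝ N] [TopologicalSpace V] {P : RootPairing ι ℝ V N} [P.IsCrystallographic] (b : P.Base)
  (k T : Type u) [Field k] [CommRing T] [Algebra (SymAlg P k) T]

/-- Presheaves of `𝒵`-modules on `𝒜_T`. -/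
abbrev Psh : Type _ :=
  (Opens (AlcoveSpace b k T))ᵒᵖ ⥤ ModuleCat.{u} (StructureAlgebra b k T)

variable {b k T}

/-- The restriction homomorphism `M(W) → M(U)` for `U ≤ W`. -/
abbrev res (M : Psh b k T) {U W : Opens (AlcoveSpace b k T)} (h : U ≤ W) :
    M.obj (op W) ⟶ M.obj (op U) :=
  M.map (homOfLE h).op

/-- All restriction homomorphisms are surjective. -/
def IsFlabby (M : Psh b k T) : Prop :=
  ∀ ⦃U W : Opens (AlcoveSpace b k T)⦄ (h : U ≤ W), Function.Surjective (res M h)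

/-- `M` is supported on `𝒯` if `M(𝒥) → M((𝒥 ∩ 𝒯)_⪯)` is an isomorphism for all open `𝒥`. -/
def IsSupportedOn (M : Psh b k T) (𝒯 : Set (AlcoveSpace b k T)) : Prop :=
  ∀ U : Opens (AlcoveSpace b k T),
    IsIso (res M (openHull_le (Set.inter_subset_left (s := (U : Set _)) (t := 𝒯))))

/-- `M(∅) = 0`, and `M` is supported on a finite set. -/
def IsFinitary (M : Psh b k T) : Prop :=
  Subsingleton (M.obj (op ⊥)) ∧ ∃ 𝒯 : Set (AlcoveSpace b k T), 𝒯.Finite ∧ IsSupportedOn M 𝒯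

/-- The support condition: `M(𝒥)^x → M((𝒥 ∩ x)_⪯)^x` is an isomorphism for all open `𝒥` and all
`ℤR`-orbits `x`. -/
def SupportCondition (M : Psh b k T) : Prop :=
  ∀ (x : Orbit b) (U : Opens (AlcoveSpace b k T)),
    IsIso ((stalk x).map (res M (orbitHull_le x U)))

variable (b k T) in
/-- The property that defines the full subcategory `𝐏_T` of the category of presheaves. -/
def isP : ObjectProperty (Psh b k T) := fun M =>
  IsFlabby M ∧ IsFinitary M ∧ (∀ U, RootTorsionFree (M.obj U)) ∧ SupportCondition M

variable (b k T) in
/-- The category `𝐏 = 𝐏_T`. -/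
abbrev CatP : Type _ := (isP b k T).FullSubcategory

variable (b k T) in
/-- The functor `ε_s`, on all presheaves: `(ε_s M)(𝒥) = 𝒵 ⊗_{𝒵^s} M(𝒥^♯)`. -/
def epsilon (s : V ≃ᵃ[ℝ] V) : Psh b k T ⥤ Psh b k T where
  obj M := (sharpFunctor s).op ⋙ M ⋙ induce s
  map f := Functor.whiskerLeft (sharpFunctor s).op (Functor.whiskerRight f (induce s))

/-- The kernel of `M(𝒥) → ⨁_x M((𝒥 ∩ x)_⪯)^x`. -/
def plusKer (M : Psh b k T) (U : Opens (AlcoveSpace b k T)) :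
    Submodule (StructureAlgebra b k T) (M.obj (op U)) :=
  ⨅ x : Orbit b, (stalkKer x (M.obj (op (orbitHull x U)))).comap (res M (orbitHull_le x U)).hom

theorem plusKer_res (M : Psh b k T) {U W : (Opens (AlcoveSpace b k T))ᵒᵖ} (f : W ⟶ U) :
    plusKer M W.unop ≤ (plusKer M U.unop).comap (M.map f).hom := by
  intro m hm
  simp only [plusKer, Submodule.mem_iInf, Submodule.mem_comap] at hm ⊢
  intro x
  have h := stalkKer_map x (res M (orbitHull_mono x f.unop.le)) (hm x)
  rw [Submodule.mem_comap] at h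
  convert h using 1
  rw [← ModuleCat.comp_apply, ← ModuleCat.comp_apply, res, res, res, ← M.map_comp, ← M.map_comp]
  rfl

theorem plusKer_map {M M' : Psh b k T} (f : M ⟶ M') (U : (Opens (AlcoveSpace b k T))ᵒᵖ) :
    plusKer M U.unop ≤ (plusKer M' U.unop).comap (f.app U).hom := by
  intro m hm
  simp only [plusKer, Submodule.mem_iInf, Submodule.mem_comap] at hm ⊢
  intro x
  have h := stalkKer_map x (f.app _) (hm x)
  rw [Submodule.mem_comap] at h
  convert h using 1
  rw [← ModuleCat.comp_apply, ← ModuleCat.comp_apply]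
  exact congrArg (fun g => g.hom m) (f.naturality (homOfLE (orbitHull_le x U.unop)).op).symm

variable (b k T) in
/-- The functor `M ↦ M^+`: the presheaf `M^+` is the image of the morphism `γ` with components
`M(𝒥) → ⨁_x M((𝒥 ∩ x)_⪯)^x`, i.e. the quotient of `M` by the kernel of `γ`. -/
def plus : Psh b k T ⥤ Psh b k T where
  obj M :=
    { obj := fun U => ModuleCat.of _ (M.obj U ⧸ plusKer M U.unop)
      map := fun f => ModuleCat.ofHom (Submodule.mapQ _ _ (M.map f).hom (plusKer_res M f))
      map_id := fun U => by
        ext m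
        exact congrArg (Submodule.Quotient.mk (p := plusKer M U.unop))
          (congrArg (fun g => g.hom m) (M.map_id U))
      map_comp := fun {U _ W} f g => by
        ext m
        exact congrArg (Submodule.Quotient.mk (p := plusKer M W.unop))
          (congrArg (fun h => h.hom m) (M.map_comp f g)) }
  map {M M'} f :=
    { app := fun U => ModuleCat.ofHom (Submodule.mapQ _ _ (f.app U).hom (plusKer_map f U))
      naturality := fun U W g => by
        ext m
        exact congrArg (Submodule.Quotient.mk (p := plusKer M' W.unop))
          (congrArg (fun h => h.hom m) (f.naturality g)) }
  map_id M := by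
    ext U m
    rfl
  map_comp f g := by
    ext U m
    rfl

variable (b k T) in
/-- The natural transformation `γ : id → (·)^+`. -/
def plusUnit : 𝟭 (Psh b k T) ⟶ plus b k T where
  app M :=
    { app := fun U => ModuleCat.ofHom (plusKer M U.unop).mkQ
      naturality := fun U W g => by
        ext m
        rfl }
  naturality M M' f := by
    ext U m
    rfl

variable (b k T) in
/-- The functor `ε_s` from `𝐏` to presheaves. -/
def epsilonP (s : V ≃ᵃ[ℝ] V) : CatP b k T ⥤ Psh b k T := (isP b k T).ι ⋙ epsilon b k T s

variable (b k T) in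
/-- The wall crossing functor `ϑ_s M = (ε_s M)^+` as a functor from `𝐏` to presheaves. -/
def thetaPsh (s : V ≃ᵃ[ℝ] V) : CatP b k T ⥤ Psh b k T := epsilonP b k T s ⋙ plus b k T

variable (b k T) in
/-- The wall crossing functor `ϑ_s` as an endofunctor of `𝐏`, given that its values lie in `𝐏`. -/
def theta (s : V ≃ᵃ[ℝ] V) (h : ∀ M : CatP b k T, isP b k T ((thetaPsh b k T s).obj M)) :
    CatP b k T ⥤ CatP b k T :=
  (isP b k T).lift (thetaPsh b k T s) h

variable (b k T) in
/-- The natural transformation `ρ_s : ε_s → ϑ_s` induced by `id → (·)^+`. -/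
def rho (s : V ≃ᵃ[ℝ] V) (h : ∀ M : CatP b k T, isP b k T ((thetaPsh b k T s).obj M)) :
    epsilonP b k T s ⟶ theta b k T s h ⋙ (isP b k T).ι :=
  Functor.whiskerLeft (epsilonP b k T s) (plusUnit b k T)

/-- A natural transformation `σ` from `ε_s` to an endofunctor `F` of `𝐏` is an isomorphism on
`s`-invariant open sets if `σ^M(𝒥) : (ε_s M)(𝒥) → (F M)(𝒥)` is an isomorphism for all `M` in `𝐏`
and all `s`-invariant open `𝒥`. -/
def IsIsoOnInvariants (s : V ≃ᵃ[ℝ] V) {F : CatP b k T ⥤ CatP b k T}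
    (σ : epsilonP b k T s ⟶ F ⋙ (isP b k T).ι) : Prop :=
  ∀ (M : CatP b k T) (U : Opens (AlcoveSpace b k T)), IsInvariant s (U : Set (AlcoveSpace b k T)) →
    IsIso ((σ.app M).app (op U))

end Presheaves

end AlcoveSheaves

end

/-!
The affine Weyl group acts simply transitively on the alcoves (`exists_smul_baseAlcove`,
`smul_left_injective_alcove`), so right multiplication by `s` is a well defined involution `A ↦ A s`
that commutes with the left action. The alcove `A s` is the mirror image of `A` in a wall, and
this wall is the only hyperplane that separates the two (`refl_smul_eq_rmul_of_separates`). Hence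
`A ↦ A s` preserves each generating relation `A ⪯ B`, unless `B = A s` (`orderStep_rmul`).
This gives the openness of `𝒥^♯` (`isOpen_sharpSet`) and the combinatorial core of the argument: if
`B ⪯ A` and `B` lies in the `ℤR`-orbit of `A s`, then `B s ⪯ A` (`rmul_le_of_orbitMap_eq`).
Consequently the open set `((𝒥 ∩ x)_⪯)^♯` meets the orbit `x` in `𝒥 ∩ x` and the orbit `x s` in
`(𝒥 ∩ x) s` (`mem_sharp_orbitHull_iff`, `mem_sharp_orbitHull_iff'`).

On the algebraic side, let `α_x^∨` be the coroot of the wall between an alcove `A` in `x` and `A s`,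
with the sign for which `A` lies on the positive side. The family of these coroots is an element
`η` of `𝒵` which `s` maps to `-η`. The coroots of distinct positive roots are non-associated primes
of `S`, and therefore the divided difference `(z - z^s) / η` of an element `z` of `𝒵_S` lies again
in `𝒵_S` (`wallS_dvd_sub_swapS`). As `2` is invertible, `𝒵 = 𝒵^s + η 𝒵^s`
(`exists_eq_add_wall_mul`). So a section of `ε_s M`, that is, an element of
`𝒵 ⊗_{𝒵^s} M(𝒥^♯)`, has the form `1 ⊗ m + η ⊗ m'`, and as `2` and `η` act injectively, it is
determined by its images under the two maps `z ⊗ m ↦ z m` and `z ⊗ m ↦ z^s m` to `M(𝒥^♯)`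
(`QuadraticExtension.eq_zero_of_fst_of_snd`). The rest of the argument uses only these two
maps and the fact that `M ↦ 𝒵 ⊗_{𝒵^s} M` preserves surjections.

Stalks of root torsion free modules are handled without localization. The element `point x` of
`𝒵`, which is the product of all positive coroots at `x` and zero elsewhere, plays the part of the
idempotent at `x`: an element `m` vanishes in the stalk at `x` if and only if `point x • m = 0`
(`RootTorsionFree.mem_stalkKer_iff`). The two maps above then show that a section of `ε_s M` over
`𝒥` vanishes in `(ε_s M)^+(𝒥)` if and only if, for every orbit `x`, the component at `x` of its
first image and the component at `x s` of its second image vanish over `((𝒥 ∩ x)_⪯)^♯`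
(`mem_plusKer_epsilon_iff`).

The presheaf `(ε_s M)^+` is flabby, root torsion free, and satisfies the support condition by
construction. That it is finitary requires more: if `M` is supported on the finite set `𝒯`, then the
component at `x` of a section of `M` over `𝒥` is determined over every open subset of `𝒥` that
contains `𝒥 ∩ x ∩ 𝒯` (`isP.point_smul_eq_zero_of_isSupportedOn`, by removing maximal alcoves
one at a time), and so `(ε_s M)^+` is supported on `𝒯 ∪ 𝒯 s`. If `𝒥` is invariant, then
`((𝒥 ∩ x)_⪯)^♯` contains all alcoves of `𝒥` in the orbits `x` and `x s`, so the support
condition for `M` makes `ρ_s` injective over `𝒥` (`plusKer_epsilon_eq_bot`).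

For the universal property let `σ : ε_s → F` be an isomorphism over invariant open sets. It is
surjective over every `𝒥`, because `F M` is flabby and `σ` is surjective over `𝒥^♯`
(`app_surjective`), and the support condition for `F M` together with the description of
`((𝒥 ∩ x)_⪯)^♯` shows that it has the same kernel as `ρ_s` (`app_eq_zero_iff`). Thus `σ` and `ρ_s` are
two quotient maps with the same kernel (`existsUnique_iso_of_surjective`).
-/

set_option linter.unusedSectionVars false

noncomputable section

namespace AlcoveSheaves

/-! ### Root systems: positivity, minuscule vectors and the exchange property -/

section RootSystems

variable {ι V N : Type*} [AddCommGroup V] [Module ℝ V] [AddCommGroup N] [Module ℝ N]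
  {P : RootPairing ι ℝ V N}

theorem root_reflectionPerm_self (i : ι) : P.root (P.reflectionPerm i i) = -P.root i := by
  simp [P.root_reflectionPerm]

theorem coroot'_reflectionPerm_self (i : ι) (v : V) :
    P.coroot' (P.reflectionPerm i i) v = -P.coroot' i v := by
  rw [← RootPairing.coroot'_reflection]
  simp [P.reflection_apply]
  ring

theorem isPos_reflectionPerm_self_iff (b : P.Base) (i : ι) :
    b.IsPos (P.reflectionPerm i i) ↔ ¬ b.IsPos i :=
  RootPairing.Base.IsPos.neg_iff_not b i

theorem two_mul_rootForm_root [Fintype ι] (v : V) (i : ι) :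
    2 * P.RootForm v (P.root i) = P.RootForm (P.root i) (P.root i) * P.coroot' i v := by
  have h := congrArg (fun y => P.toLinearMap v y) (P.rootForm_self_smul_coroot i)
  simp only [map_smul, map_nsmul, smul_eq_mul, P.toLinearMap_apply_apply_Polarization] at h
  have hsymm : P.RootForm v (P.root i) = P.RootForm (P.root i) v := by
    simp [P.rootForm_apply_apply, mul_comm]
  rw [nsmul_eq_mul, Nat.cast_ofNat] at h
  rw [hsymm, ← h]
  rfl

theorem rootForm_root_self_pos [Fintype ι] (i : ι) : 0 < P.RootForm (P.root i) (P.root i) := by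
  rw [P.rootForm_apply_apply]
  refine Finset.sum_pos' (fun j _ => mul_self_nonneg _) ⟨i, Finset.mem_univ _, ?_⟩
  simp

theorem rootForm_pos_iff [Fintype ι] (v : V) (i : ι) :
    0 < P.RootForm v (P.root i) ↔ 0 < P.coroot' i v := by
  have h := two_mul_rootForm_root (P := P) v i
  have h' := rootForm_root_self_pos (P := P) i
  constructor
  · intro h0
    exact pos_of_mul_pos_right (h ▸ by positivity) h'.le
  · intro h0
    have := mul_pos h' h0
    linarith

/-- There is a vector on which all positive coroots are positive. -/
theorem exists_forall_isPos_coroot'_pos [Finite ι] [P.IsRootSystem] [P.IsCrystallographic]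
    (b : P.Base) : ∃ v : V, ∀ i, b.IsPos i → 0 < P.coroot' i v := by
  cases nonempty_fintype ι
  obtain ⟨v, hv⟩ : ∃ v : V, ∀ i ∈ b.support, P.coroot' i v = 1 := by
    refine ⟨P.toPerfPair.symm (b.toCoweightBasis.constr ℝ fun _ => (1 : ℝ)), fun i hi => ?_⟩
    have h := b.toCoweightBasis.constr_basis ℝ (fun _ => (1 : ℝ)) ⟨i, hi⟩
    rw [b.toCoweightBasis_apply] at h
    change P.toPerfPair _ _ = _
    rw [LinearEquiv.apply_symm_apply]
    exact h
  refine ⟨v, fun i hi => ?_⟩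
  rw [← rootForm_pos_iff]
  refine hi.induction_on_add (p := fun i => 0 < P.RootForm v (P.root i)) (fun j hj => ?_)
    (fun j k l h hj hk => ?_)
  · rw [rootForm_pos_iff, hv j hj]
    exact one_pos
  · rw [h, map_add]
    exact add_pos hj ((rootForm_pos_iff v k).2 (by rw [hv k hk]; exact one_pos))

theorem eq_zero_of_forall_coroot'_eq_zero [P.IsRootSystem] {v : V}
    (h : ∀ i, P.coroot' i v = 0) : v = 0 := by
  apply P.toPerfPair.injective
  rw [map_zero]
  refine LinearMap.ext_on_range (v := P.coroot) ?_ h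
  exact RootPairing.IsRootSystem.span_coroot_eq_top

theorem coroot'_root_mem_int [P.IsCrystallographic] {v : V} (hv : v ∈ rootLattice P) (i : ι) :
    ∃ n : ℤ, P.coroot' i v = n := by
  induction hv using AddSubgroup.closure_induction with
  | mem x hx =>
    obtain ⟨j, rfl⟩ := hx
    obtain ⟨n, hn⟩ := P.exists_value (S := ℤ) j i
    exact ⟨n, by simpa using hn.symm⟩
  | zero => exact ⟨0, by simp⟩
  | add x y _ _ hx hy =>
    obtain ⟨m, hm⟩ := hx
    obtain ⟨n, hn⟩ := hy
    exact ⟨m + n, by rw [map_add, hm, hn, Int.cast_add]⟩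
  | neg x _ hx =>
    obtain ⟨m, hm⟩ := hx
    exact ⟨-m, by rw [map_neg, hm, Int.cast_neg]⟩

theorem root_mem_rootLattice (i : ι) : P.root i ∈ rootLattice P :=
  AddSubgroup.subset_closure ⟨i, rfl⟩

/-- Elements of the root lattice are sums of roots. -/
theorem exists_list_sum_of_mem_rootLattice {v : V} (hv : v ∈ rootLattice P) :
    ∃ l : List ι, v = (l.map P.root).sum := by
  induction hv using AddSubgroup.closure_induction with
  | mem x hx =>
    obtain ⟨j, rfl⟩ := hx
    exact ⟨[j], by simp⟩
  | zero => exact ⟨[], by simp⟩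
  | add x y _ _ hx hy =>
    obtain ⟨l, rfl⟩ := hx
    obtain ⟨m, rfl⟩ := hy
    exact ⟨l ++ m, by simp⟩
  | neg x _ hx =>
    obtain ⟨l, rfl⟩ := hx
    refine ⟨l.map fun i => P.reflectionPerm i i, ?_⟩
    clear * -
    induction l with
    | nil => simp
    | cons a t ih =>
      simp only [List.map_cons, List.sum_cons, neg_add, root_reflectionPerm_self]
      rw [ih]

/-- A vector of the root lattice on which all coroots take values at most one vanishes. In a
shortest expression of it as a sum of roots, no two roots make an obtuse angle; but then the
coroot of one of the roots takes a value at least two. -/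
theorem eq_zero_of_mem_rootLattice_of_coroot'_le_one [Finite ι] [P.IsRootSystem]
    [P.IsCrystallographic] [P.IsReduced] {v : V} (hv : v ∈ rootLattice P)
    (h : ∀ i, P.coroot' i v ≤ 1) : v = 0 := by
  classical
  cases nonempty_fintype ι
  obtain ⟨l, hl⟩ := exists_list_sum_of_mem_rootLattice hv
  induction hn : l.length using Nat.strong_induction_on generalizing l with
  | _ n ih =>
    by_contra hv0
    have hpos : 0 < P.RootForm v v := by
      rw [P.rootForm_apply_apply]
      by_contra hle
      apply hv0
      have h0 : ∑ i, P.coroot' i v * P.coroot' i v = 0 :=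
        le_antisymm (not_lt.1 hle) (Finset.sum_nonneg fun i _ => mul_self_nonneg _)
      rw [Finset.sum_eq_zero_iff_of_nonneg fun i _ => mul_self_nonneg _] at h0
      exact eq_zero_of_forall_coroot'_eq_zero fun i => by simpa using h0 i (Finset.mem_univ i)
    obtain ⟨i, hi, hiv⟩ : ∃ i ∈ l, 0 < P.RootForm v (P.root i) := by
      by_contra! hle
      have : P.RootForm v v = (l.map fun i => P.RootForm v (P.root i)).sum := by
        conv_lhs => rw [hl, map_list_sum, List.map_map, ← hl]
        rfl
      have h0 := List.sum_le_card_nsmul (l.map fun i => P.RootForm v (P.root i)) 0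
        (by simpa using hle)
      rw [← this, smul_zero] at h0
      exact absurd h0 (not_le.2 hpos)
    rw [rootForm_pos_iff] at hiv
    obtain ⟨l', hl'⟩ : ∃ l', l.Perm (i :: l') := ⟨_, List.perm_cons_erase hi⟩
    have hl₁ : v = P.root i + (l'.map P.root).sum := by
      rw [hl, (hl'.map P.root).sum_eq]
      simp
    obtain ⟨j, hj, hji⟩ : ∃ j ∈ l', P.pairing j i < 0 := by
      by_contra! hle
      have h1 := h i
      rw [hl₁, map_add, map_list_sum, List.map_map] at h1
      have : 0 ≤ (l'.map (P.coroot' i ∘ P.root)).sum := List.sum_nonneg (by simpa using hle)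
      simp only [RootPairing.root_coroot'_eq_pairing, RootPairing.pairing_same] at h1
      linarith
    obtain ⟨l'', hl''⟩ : ∃ l'', l'.Perm (j :: l'') := ⟨_, List.perm_cons_erase hj⟩
    have hl₂ : v = P.root j + P.root i + (l''.map P.root).sum := by
      rw [hl₁, (hl''.map P.root).sum_eq]
      simp only [List.map_cons, List.sum_cons]
      abel
    have hlen : n = l''.length + 2 := by
      rw [← hn, hl'.length_eq, List.length_cons, hl''.length_eq, List.length_cons]
    by_cases hneg : P.root j = -P.root i
    · exact hv0 (ih l''.length (by omega) l'' (by rw [hl₂, hneg]; simp) rfl)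
    · have hint : P.pairingIn ℤ j i < 0 := by
        have : ((P.pairingIn ℤ j i : ℤ) : ℝ) < 0 := by
          have := P.algebraMap_pairingIn ℤ j i
          simp only [algebraMap_int_eq, eq_intCast] at this
          rwa [this]
        exact_mod_cast this
      obtain ⟨m, hm⟩ := P.root_add_root_mem_of_pairingIn_neg hint hneg
      exact hv0 (ih (l''.length + 1) (by omega) (m :: l'') (by simp [hl₂, hm]) rfl)

/-- The group generated by the reflections is generated by the simple reflections. -/
theorem reflection_mem_closure_simple [Finite ι] [P.IsCrystallographic] [P.IsReduced]
    (b : P.Base) (i : ι) :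
    P.reflection i ∈ Subgroup.closure (P.reflection '' (b.support : Set ι)) := by
  refine b.induction_reflect i
    (p := fun i => P.reflection i ∈ Subgroup.closure (P.reflection '' (b.support : Set ι)))
    (fun j hj => ?_) (fun j hj => ?_) (fun j k hj hk => ?_)
  · rw [RootPairing.reflection_reflectionPerm]
    exact mul_mem (mul_mem hj hj) hj
  · exact Subgroup.subset_closure ⟨j, hj, rfl⟩
  · rw [RootPairing.reflection_reflectionPerm]
    have := Subgroup.subset_closure (k := P.reflection '' (b.support : Set ι)) ⟨k, hk, rfl⟩
    exact mul_mem (mul_mem this hj) this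

/-- The product of the simple reflections with indices in a list. -/
def reflectionWord (P : RootPairing ι ℝ V N) (l : List ι) : V ≃ₗ[ℝ] V :=
  (l.map P.reflection).prod

theorem reflectionWord_cons (i : ι) (l : List ι) :
    reflectionWord P (i :: l) = P.reflection i * reflectionWord P l := by
  simp [reflectionWord]

theorem reflection_mul_self (i : ι) : P.reflection i * P.reflection i = 1 := by
  rw [← sq, P.reflection_sq]

/-- Products of reflections map roots to roots and conjugate the corresponding reflections. -/
theorem exists_reflectionWord_root_eq (l : List ι) (j : ι) :
    ∃ k, reflectionWord P l (P.root j) = P.root k ∧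
      P.reflection k * reflectionWord P l = reflectionWord P l * P.reflection j := by
  induction l with
  | nil => exact ⟨j, rfl, by simp [reflectionWord]⟩
  | cons a t ih =>
    obtain ⟨k, hk, hk'⟩ := ih
    refine ⟨P.reflectionPerm a k, ?_, ?_⟩
    · rw [P.root_reflectionPerm, ← hk]
      rfl
    · rw [reflectionWord_cons, RootPairing.reflection_reflectionPerm]
      change P.reflection a * (P.reflection k * P.reflection a) * _ = _
      rw [mul_assoc, mul_assoc, ← mul_assoc (P.reflection a) (P.reflection a), reflection_mul_self,
        one_mul, hk', mul_assoc]

/-- The exchange property: if a product of simple reflections maps a simple root to a negative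
root, then one factor can be moved to the end, where it becomes the reflection at that root. -/
theorem exists_reflectionWord_eq_mul [Finite ι] [P.IsCrystallographic] [P.IsReduced] (b : P.Base)
    {j : ι} (hj : j ∈ b.support) (l : List ι) (hl : ∀ i ∈ l, i ∈ b.support) {k : ι}
    (hk : reflectionWord P l (P.root j) = P.root k) (hneg : ¬ b.IsPos k) :
    ∃ l' : List ι, (∀ i ∈ l', i ∈ b.support) ∧ l.length = l'.length + 1 ∧
      reflectionWord P l = reflectionWord P l' * P.reflection j := by
  induction l generalizing k with
  | nil =>
    obtain rfl : j = k := P.root.injective (by simpa [reflectionWord] using hk)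
    exact absurd (b.isPos_of_mem_support hj) hneg
  | cons a t ih =>
    have ht : ∀ i ∈ t, i ∈ b.support := fun i hi => hl i (List.mem_cons_of_mem _ hi)
    obtain ⟨m, hm, hm'⟩ := exists_reflectionWord_root_eq (P := P) t j
    by_cases hmp : b.IsPos m
    · have hkm : k = P.reflectionPerm a m := by
        apply P.root.injective
        rw [P.root_reflectionPerm, ← hk, ← hm]
        rfl
      have hma : m = a := by
        by_contra hma
        exact hneg (hkm ▸ hmp.reflectionPerm (hl a List.mem_cons_self) hma)
      exact ⟨t, ht, rfl, by rw [reflectionWord_cons, ← hma, hm']⟩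
    · obtain ⟨l', h₁, h₂, h₃⟩ := ih ht hm hmp
      refine ⟨a :: l', ?_, by simp [h₂], ?_⟩
      · simpa using ⟨hl a List.mem_cons_self, h₁⟩
      · rw [reflectionWord_cons, h₃, reflectionWord_cons, mul_assoc]

/-- A product of simple reflections that preserves positivity of roots is trivial. -/
theorem reflectionWord_eq_one [Finite ι] [P.IsCrystallographic] [P.IsReduced] (b : P.Base)
    (l : List ι) (hl : ∀ i ∈ l, i ∈ b.support)
    (hpos : ∀ j k, b.IsPos j → reflectionWord P l (P.root j) = P.root k → b.IsPos k) :
    reflectionWord P l = 1 := by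
  induction hn : l.length using Nat.strong_induction_on generalizing l with
  | _ n ih =>
    obtain rfl | ⟨t, j, rfl⟩ := l.eq_nil_or_concat'
    · simp [reflectionWord]
    have hj : j ∈ b.support := hl j (by simp)
    have ht : ∀ i ∈ t, i ∈ b.support := fun i hi => hl i (by simp [hi])
    have hw : reflectionWord P (t ++ [j]) = reflectionWord P t * P.reflection j := by
      simp [reflectionWord]
    obtain ⟨k, hk, -⟩ := exists_reflectionWord_root_eq (P := P) t j
    have hneg : ¬ b.IsPos k := by
      rw [← isPos_reflectionPerm_self_iff]
      refine hpos j _ (b.isPos_of_mem_support hj) ?_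
      rw [hw, root_reflectionPerm_self, ← hk, LinearEquiv.mul_apply, P.reflection_apply_self,
        map_neg]
    obtain ⟨l', h₁, h₂, h₃⟩ := exists_reflectionWord_eq_mul b hj t ht hk hneg
    have hw' : reflectionWord P (t ++ [j]) = reflectionWord P l' := by
      rw [hw, h₃, mul_assoc, reflection_mul_self, mul_one]
    rw [hw']
    refine ih l'.length ?_ l' h₁ (by rwa [hw'] at hpos) rfl
    simp at hn
    omega

/-- An element of the Weyl group that preserves positivity of roots is trivial. -/
theorem eq_one_of_forall_isPos [Finite ι] [P.IsCrystallographic] [P.IsReduced] (b : P.Base)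
    {w : V ≃ₗ[ℝ] V} (hw : w ∈ Subgroup.closure (Set.range P.reflection))
    (hpos : ∀ j k, b.IsPos j → w (P.root j) = P.root k → b.IsPos k) : w = 1 := by
  have hw' : w ∈ Subgroup.closure (P.reflection '' (b.support : Set ι)) := by
    refine (Subgroup.closure_le _).2 ?_ hw
    rintro _ ⟨i, rfl⟩
    exact reflection_mem_closure_simple b i
  obtain ⟨l, hl, rfl⟩ : ∃ l : List ι, (∀ i ∈ l, i ∈ b.support) ∧ w = reflectionWord P l := by
    clear hpos hw
    induction hw' using Subgroup.closure_induction_left with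
    | one => exact ⟨[], by simp, by simp [reflectionWord]⟩
    | mul_left x hx y _ ih =>
      obtain ⟨i, hi, rfl⟩ := hx
      obtain ⟨l, hl, rfl⟩ := ih
      exact ⟨i :: l, by simpa using ⟨hi, hl⟩, by rw [reflectionWord_cons]⟩
    | inv_mul_cancel x hx y _ ih =>
      obtain ⟨i, hi, rfl⟩ := hx
      obtain ⟨l, hl, rfl⟩ := ih
      exact ⟨i :: l, by simpa using ⟨hi, hl⟩, by rw [reflectionWord_cons, P.reflection_inv]⟩
  exact reflectionWord_eq_one b l hl hpos

end RootSystems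

/-! ### The affine Weyl group -/

section AffineWeylGroup

variable {ι V N : Type*} [AddCommGroup V] [Module ℝ V] [AddCommGroup N] [Module ℝ N]
  {P : RootPairing ι ℝ V N} (b : P.Base)

theorem affineReflection_reflectionPerm_self (i : ι) (n : ℤ) :
    affineReflection P (P.reflectionPerm i i) n = affineReflection P i (-n) := by
  ext v
  rw [affineReflection_apply, affineReflection_apply, coroot'_reflectionPerm_self,
    root_reflectionPerm_self]
  push_cast
  module

theorem affineReflection_mul_self (i : ι) (n : ℤ) :
    affineReflection P i n * affineReflection P i n = 1 := by
  ext v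
  rw [AffineEquiv.mul_def, AffineEquiv.trans_apply, affineReflection_apply, affineReflection_apply,
    map_sub, map_smul, RootPairing.root_coroot'_eq_pairing, P.pairing_same, smul_eq_mul]
  change _ = v
  module

theorem coroot'_affineReflection_self (i : ι) (n : ℤ) (v : V) :
    P.coroot' i (affineReflection P i n v) = 2 * n - P.coroot' i v := by
  rw [affineReflection_apply, map_sub, map_smul, RootPairing.root_coroot'_eq_pairing,
    P.pairing_same, smul_eq_mul]
  ring

theorem affineReflection_mem (i : ι) (n : ℤ) : affineReflection P i n ∈ affineWeylGroup b := by
  by_cases hi : b.IsPos i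
  · exact Subgroup.subset_closure ⟨i, hi, n, rfl⟩
  · rw [← neg_neg n, ← affineReflection_reflectionPerm_self]
    exact Subgroup.subset_closure ⟨_, (isPos_reflectionPerm_self_iff b i).2 hi, _, rfl⟩

/-- `s_{α,n}` and `s_{α,m}` differ by the translation by `(n - m) α`. -/
theorem translation_root (i : ι) (n m : ℤ) :
    translation ((n - m : ℝ) • P.root i) * affineReflection P i m = affineReflection P i n := by
  ext v
  rw [AffineEquiv.mul_def, AffineEquiv.trans_apply, affineReflection_apply, affineReflection_apply,
    AffineEquiv.constVAdd_apply, vadd_eq_add]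
  module

theorem translation_add (γ δ : V) : translation (γ + δ) = translation γ * translation δ := by
  ext v
  simp [AffineEquiv.mul_def]

theorem translation_zero : translation (0 : V) = 1 := by
  ext v
  simp [AffineEquiv.one_def]

theorem translation_neg (γ : V) : translation (-γ) = (translation γ)⁻¹ := by
  rw [eq_inv_iff_mul_eq_one, ← translation_add, neg_add_cancel, translation_zero]

theorem translation_mem {γ : V} (hγ : γ ∈ rootLattice P) : translation γ ∈ affineWeylGroup b := by
  induction hγ using AddSubgroup.closure_induction with
  | mem x hx =>
    obtain ⟨i, rfl⟩ := hx
    have h := translation_root (P := P) i 1 0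
    simp only [Int.cast_one, Int.cast_zero, sub_zero, one_smul] at h
    rw [← eq_mul_inv_iff_mul_eq] at h
    rw [h]
    exact mul_mem (affineReflection_mem b i 1) (inv_mem (affineReflection_mem b i 0))
  | zero =>
    rw [translation_zero]
    exact one_mem _
  | add x y _ _ hx hy =>
    rw [translation_add]
    exact mul_mem hx hy
  | neg x _ hx =>
    rw [translation_neg]
    exact inv_mem hx

/-- The linear part of an element of the affine Weyl group lies in the Weyl group, and its
translation part lies in the root lattice. -/
theorem linear_mem_and_apply_zero_mem [P.IsCrystallographic] {w : V ≃ᵃ[ℝ] V}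
    (hw : w ∈ affineWeylGroup b) :
    w.linear ∈ Subgroup.closure (Set.range P.reflection) ∧ w 0 ∈ rootLattice P := by
  suffices h : ∀ w ∈ affineWeylGroup b, w.linear ∈ Subgroup.closure (Set.range P.reflection) ∧
      ∀ v ∈ rootLattice P, w v ∈ rootLattice P from
    ⟨(h w hw).1, (h w hw).2 0 (zero_mem _)⟩
  intro w hw
  have key : ∀ (i : ι) (n : ℤ) (y : V ≃ᵃ[ℝ] V),
      (y.linear ∈ Subgroup.closure (Set.range P.reflection) ∧
        ∀ v ∈ rootLattice P, y v ∈ rootLattice P) →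
      (affineReflection P i n * y).linear ∈ Subgroup.closure (Set.range P.reflection) ∧
        ∀ v ∈ rootLattice P, (affineReflection P i n * y) v ∈ rootLattice P := by
    intro i n y ⟨h₁, h₂⟩
    constructor
    · have : (affineReflection P i n * y).linear = P.reflection i * y.linear := by
        ext v
        rfl
      rw [this]
      exact mul_mem (Subgroup.subset_closure ⟨i, rfl⟩) h₁
    · intro v hv
      rw [AffineEquiv.mul_def, AffineEquiv.trans_apply, affineReflection_apply]
      obtain ⟨m, hm⟩ := coroot'_root_mem_int (h₂ v hv) i
      rw [hm, ← Int.cast_sub, Int.cast_smul_eq_zsmul]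
      exact sub_mem (h₂ v hv) (zsmul_mem (root_mem_rootLattice i) _)
  induction hw using Subgroup.closure_induction_left with
  | one => exact ⟨one_mem _, fun v hv => hv⟩
  | mul_left x hx y _ ih =>
    obtain ⟨i, -, n, rfl⟩ := hx
    exact key i n y ih
  | inv_mul_cancel x hx y _ ih =>
    obtain ⟨i, -, n, rfl⟩ := hx
    rw [inv_eq_of_mul_eq_one_left (affineReflection_mul_self i n)]
    exact key i n y ih

theorem affineEquiv_apply (w : V ≃ᵃ[ℝ] V) (v : V) : w v = w.linear v + w 0 := by
  simpa using w.map_vadd 0 v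

theorem exists_perm_of_mem_closure_reflection {w : V ≃ₗ[ℝ] V}
    (hw : w ∈ Subgroup.closure (Set.range P.reflection)) :
    ∃ e : Equiv.Perm ι, (∀ i, w (P.root i) = P.root (e i)) ∧
      ∀ i v, P.coroot' (e i) (w v) = P.coroot' i v := by
  induction hw using Subgroup.closure_induction with
  | mem x hx =>
    obtain ⟨i, rfl⟩ := hx
    refine ⟨P.reflectionPerm i, fun j => (P.root_reflectionPerm i j).symm, fun j v => ?_⟩
    rw [RootPairing.coroot'_reflection, P.reflectionPerm_self]
  | one => exact ⟨1, fun _ => rfl, fun _ _ => rfl⟩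
  | mul x y _ _ hx hy =>
    obtain ⟨e, h₁, h₂⟩ := hx
    obtain ⟨f, h₃, h₄⟩ := hy
    refine ⟨e * f, fun i => ?_, fun i v => ?_⟩
    · rw [LinearEquiv.mul_apply, h₃, h₁]
      rfl
    · rw [LinearEquiv.mul_apply, Equiv.Perm.mul_apply, h₂, h₄]
  | inv x _ hx =>
    obtain ⟨e, h₁, h₂⟩ := hx
    refine ⟨e⁻¹, fun i => ?_, fun i v => ?_⟩
    · apply x.injective
      rw [h₁]
      simp
    · rw [← h₂]
      simp

/-- An element of the affine Weyl group permutes the affine coroot functions up to integral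
constants, and conjugates the affine reflections accordingly. -/
theorem exists_perm_of_mem_affineWeylGroup [P.IsCrystallographic] {w : V ≃ᵃ[ℝ] V}
    (hw : w ∈ affineWeylGroup b) :
    ∃ (e : Equiv.Perm ι) (c : ι → ℤ), (∀ i, w.linear (P.root i) = P.root (e i)) ∧
      (∀ i v, P.coroot' (e i) (w v) = P.coroot' i v + c i) ∧
      ∀ i n, affineReflection P (e i) (n + c i) * w = w * affineReflection P i n := by
  obtain ⟨h₁, h₂⟩ := linear_mem_and_apply_zero_mem b hw
  obtain ⟨e, he, he'⟩ := exists_perm_of_mem_closure_reflection h₁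
  choose c hc using fun i => coroot'_root_mem_int h₂ (e i)
  have hcw : ∀ i v, P.coroot' (e i) (w v) = P.coroot' i v + c i := fun i v => by
    rw [affineEquiv_apply, map_add, he', hc]
  refine ⟨e, c, he, hcw, fun i n => ?_⟩
  ext v
  rw [AffineEquiv.mul_def, AffineEquiv.mul_def, AffineEquiv.trans_apply, AffineEquiv.trans_apply,
    affineReflection_apply, affineReflection_apply, hcw, affineEquiv_apply w (v - _), map_sub,
    map_smul, he, affineEquiv_apply w v]
  push_cast
  module

end AffineWeylGroup

/-! ### Alcoves -/

section Alcoves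

variable {ι V N : Type*} [AddCommGroup V] [Module ℝ V] [AddCommGroup N] [Module ℝ N]
  {P : RootPairing ι ℝ V N} (b : P.Base)

theorem mem_regularSet_iff {v : V} :
    v ∈ regularSet b ↔ ∀ (i : ι) (n : ℤ), P.coroot' i v ≠ n := by
  constructor
  · intro h i n hin
    by_cases hi : b.IsPos i
    · exact h i hi n hin
    · refine h _ ((isPos_reflectionPerm_self_iff b i).2 hi) (-n) ?_
      change P.coroot' _ v = _
      rw [coroot'_reflectionPerm_self, hin, Int.cast_neg]
  · exact fun h i _ n => h i n

theorem apply_mem_regularSet [P.IsCrystallographic] {w : V ≃ᵃ[ℝ] V} (hw : w ∈ affineWeylGroup b)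
    {v : V} (hv : v ∈ regularSet b) : w v ∈ regularSet b := by
  obtain ⟨e, c, -, h, -⟩ := exists_perm_of_mem_affineWeylGroup b hw
  rw [mem_regularSet_iff] at hv ⊢
  intro i n hn
  refine hv (e.symm i) (n - c (e.symm i)) ?_
  have := h (e.symm i) v
  rw [Equiv.apply_symm_apply] at this
  push_cast
  linarith

/-- The set of regular vectors that lie on the same side as `v` of each affine hyperplane. -/
def cell (v : V) : Set V :=
  {v' | v' ∈ regularSet b ∧ ∀ (i : ι) (n : ℤ), P.coroot' i v' < n ↔ P.coroot' i v < n}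

theorem convex_cell (v : V) : Convex ℝ (cell b v) := by
  intro x hx y hy p q hp hq hpq
  have key : ∀ (i : ι) (n : ℤ), (P.coroot' i v < n → P.coroot' i (p • x + q • y) < n) ∧
      (¬ P.coroot' i v < n → n < P.coroot' i (p • x + q • y)) := by
    intro i n
    have hx' := (mem_regularSet_iff b).1 hx.1 i n
    have hy' := (mem_regularSet_iff b).1 hy.1 i n
    rw [map_add, map_smul, map_smul, smul_eq_mul, smul_eq_mul]
    have hq' : q = 1 - p := by linarith
    constructor
    · intro h
      exact (convex_Iio (n : ℝ)) ((hx.2 i n).2 h) ((hy.2 i n).2 h) hp hq hpq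
    · intro h
      refine (convex_Ioi (n : ℝ)) ?_ ?_ hp hq hpq
      · exact lt_of_le_of_ne (not_lt.1 fun h' => h ((hx.2 i n).1 h')) hx'.symm
      · exact lt_of_le_of_ne (not_lt.1 fun h' => h ((hy.2 i n).1 h')) hy'.symm
  refine ⟨(mem_regularSet_iff b).2 fun i n h => ?_, fun i n => ⟨fun h => ?_, (key i n).1⟩⟩
  · by_cases h' : P.coroot' i v < n
    · exact ((key i n).1 h').ne h
    · exact ((key i n).2 h').ne' h
  · by_contra h'
    exact lt_asymm h ((key i n).2 h')

variable [TopologicalSpace V] [IsTopologicalAddGroup V] [ContinuousSMul ℝ V] [T2Space V]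
  [FiniteDimensional ℝ V]

theorem continuous_coroot' (P : RootPairing ι ℝ V N) (i : ι) : Continuous (P.coroot' i) :=
  LinearMap.continuous_of_finiteDimensional _

theorem connectedComponentIn_regularSet {v : V} (hv : v ∈ regularSet b) :
    connectedComponentIn (regularSet b) v = cell b v := by
  apply Set.Subset.antisymm
  · intro x hx
    have hxr : x ∈ regularSet b := connectedComponentIn_subset _ _ hx
    refine ⟨hxr, fun i n => ?_⟩
    have hord : ∀ y ∈ connectedComponentIn (regularSet b) v,
        ∀ z ∈ connectedComponentIn (regularSet b) v, P.coroot' i y < n → P.coroot' i z < n := by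
      intro y hy z hz hyn
      by_contra hzn
      have hpre := (isPreconnected_connectedComponentIn (F := regularSet b) (x := v)).image
        (P.coroot' i) (continuous_coroot' P i).continuousOn
      obtain ⟨t, ht, htn⟩ := hpre.Icc_subset (Set.mem_image_of_mem _ hy)
        (Set.mem_image_of_mem _ hz) (show (n : ℝ) ∈ _ from ⟨hyn.le, not_lt.1 hzn⟩)
      exact (mem_regularSet_iff b).1 (connectedComponentIn_subset _ _ ht) i n htn
    have hv' := mem_connectedComponentIn hv
    exact ⟨hord x hx v hv', hord v hv' x hx⟩
  · exact (convex_cell b v).isPreconnected.subset_connectedComponentIn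
      ⟨hv, fun _ _ => Iff.rfl⟩ fun x hx => hx.1

variable {b}

namespace Alcove

theorem nonempty (A : Alcove b) : (A : Set V).Nonempty := by
  obtain ⟨_, v, hv, rfl⟩ := A
  exact ⟨v, mem_connectedComponentIn hv⟩

theorem subset_regularSet (A : Alcove b) : (A : Set V) ⊆ regularSet b := by
  obtain ⟨_, v, hv, rfl⟩ := A
  exact connectedComponentIn_subset _ _

theorem eq_cell (A : Alcove b) {v : V} (hv : v ∈ (A : Set V)) : (A : Set V) = cell b v := by
  have hvr := A.subset_regularSet hv
  obtain ⟨_, x, hx, rfl⟩ := A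
  rw [← connectedComponentIn_regularSet b hvr]
  exact connectedComponentIn_eq hv

theorem ext_of_mem {A B : Alcove b} {v : V} (hA : v ∈ (A : Set V)) (hB : v ∈ (B : Set V)) :
    A = B :=
  Subtype.ext ((A.eq_cell hA).trans (B.eq_cell hB).symm)

/-- An alcove lies on one side of each affine hyperplane. -/
theorem lt_iff_lt (A : Alcove b) {x y : V} (hx : x ∈ (A : Set V)) (hy : y ∈ (A : Set V)) (i : ι)
    (n : ℤ) : P.coroot' i x < n ↔ P.coroot' i y < n := by
  rw [A.eq_cell hy] at hx
  exact hx.2 i n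

theorem ne_int (A : Alcove b) {x : V} (hx : x ∈ (A : Set V)) (i : ι) (n : ℤ) :
    P.coroot' i x ≠ n :=
  (mem_regularSet_iff b).1 (A.subset_regularSet hx) i n

end Alcove

theorem image_cell [P.IsCrystallographic] {w : V ≃ᵃ[ℝ] V} (hw : w ∈ affineWeylGroup b) {v : V} :
    w '' cell b v = cell b (w v) := by
  have key : ∀ w ∈ affineWeylGroup b, ∀ v : V, w '' cell b v ⊆ cell b (w v) := by
    rintro w hw v _ ⟨x, hx, rfl⟩
    refine ⟨apply_mem_regularSet b hw hx.1, fun i n => ?_⟩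
    obtain ⟨e, c, -, h, -⟩ := exists_perm_of_mem_affineWeylGroup b hw
    have h' := hx.2 (e.symm i) (n - c (e.symm i))
    rw [← e.apply_symm_apply i, h, h]
    push_cast at h'
    rwa [lt_sub_iff_add_lt, lt_sub_iff_add_lt] at h'
  refine (key w hw v).antisymm fun x hx => ⟨w⁻¹ x, ?_, w.apply_symm_apply x⟩
  have := key w⁻¹ (inv_mem hw) (w v) ⟨x, hx, rfl⟩
  rwa [show w⁻¹ (w v) = v from w.symm_apply_apply v] at this

/-- The left action of the affine Weyl group on the alcoves. -/
instance [P.IsCrystallographic] : MulAction (affineWeylGroup b) (Alcove b) where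
  smul w A := ⟨w.1 '' A, by
    obtain ⟨v, hv⟩ := A.nonempty
    have hvr := A.subset_regularSet hv
    refine ⟨w.1 v, apply_mem_regularSet b w.2 hvr, ?_⟩
    rw [connectedComponentIn_regularSet b (apply_mem_regularSet b w.2 hvr), A.eq_cell hv,
      image_cell w.2]⟩
  one_smul A := Subtype.ext (Set.image_id _)
  mul_smul w w' A := Subtype.ext (Set.image_comp w.1 w'.1 A.1)

theorem apply_mem_smul [P.IsCrystallographic] (w : affineWeylGroup b) {A : Alcove b} {v : V}
    (hv : v ∈ (A : Set V)) : w.1 v ∈ ((w • A : Alcove b) : Set V) :=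
  Set.mem_image_of_mem _ hv

end Alcoves

/-! ### The affine Weyl group acts simply transitively on the alcoves -/

section SimplyTransitive

variable {ι V N : Type*} [Finite ι] [AddCommGroup V] [Module ℝ V] [AddCommGroup N] [Module ℝ N]
  {P : RootPairing ι ℝ V N} [P.IsRootSystem] [P.IsCrystallographic] [P.IsReduced] (b : P.Base)

theorem fundamentalAlcove_nonempty : (fundamentalAlcove b).Nonempty := by
  obtain ⟨v, hv⟩ := exists_forall_isPos_coroot'_pos b
  cases nonempty_fintype ι
  -- the sum of the absolute values bounds every coroot value on `v`
  set C : ℝ := 1 + ∑ i, |P.coroot' i v| with hC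
  have hC0 : 0 < C := by positivity
  refine ⟨C⁻¹ • v, fun i hi => ?_⟩
  rw [map_smul, smul_eq_mul]
  refine ⟨mul_pos (inv_pos.2 hC0) (hv i hi), ?_⟩
  rw [inv_mul_lt_one₀ hC0]
  have h₁ := Finset.single_le_sum (f := fun i => |P.coroot' i v|) (fun j _ => abs_nonneg _)
    (Finset.mem_univ i)
  have h₂ := le_abs_self (P.coroot' i v)
  linarith

theorem coroot'_mem_of_mem_fundamentalAlcove {v : V} (hv : v ∈ fundamentalAlcove b) (i : ι) :
    (b.IsPos i → 0 < P.coroot' i v ∧ P.coroot' i v < 1) ∧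
      (¬ b.IsPos i → -1 < P.coroot' i v ∧ P.coroot' i v < 0) := by
  refine ⟨hv i, fun hi => ?_⟩
  have := hv _ ((isPos_reflectionPerm_self_iff b i).2 hi)
  rw [coroot'_reflectionPerm_self] at this
  constructor <;> linarith [this.1, this.2]

theorem fundamentalAlcove_eq_cell {v : V} (hv : v ∈ fundamentalAlcove b) :
    fundamentalAlcove b = cell b v := by
  have hlt : ∀ x ∈ fundamentalAlcove b, ∀ y ∈ fundamentalAlcove b, ∀ (i : ι) (n : ℤ),
      P.coroot' i x < n → P.coroot' i y < n := by
    intro x hx y hy i n h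
    by_cases hi : b.IsPos i
    · have hn : (0 : ℝ) < n := (((coroot'_mem_of_mem_fundamentalAlcove b hx i).1 hi).1).trans h
      have hn' : (1 : ℝ) ≤ n := by exact_mod_cast Int.cast_pos.1 hn
      exact (((coroot'_mem_of_mem_fundamentalAlcove b hy i).1 hi).2).trans_le hn'
    · have hn : ((-1 : ℤ) : ℝ) < n := by
        push_cast
        exact (((coroot'_mem_of_mem_fundamentalAlcove b hx i).2 hi).1).trans h
      have hn' : (0 : ℤ) ≤ n := by
        have := Int.cast_lt.1 hn
        omega
      have hn'' : (0 : ℝ) ≤ n := by exact_mod_cast hn'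
      exact (((coroot'_mem_of_mem_fundamentalAlcove b hy i).2 hi).2).trans_le hn''
  ext x
  constructor
  · intro hx
    refine ⟨fun i hi n h => ?_, fun i n => ⟨hlt x hx v hv i n, hlt v hv x hx i n⟩⟩
    obtain ⟨h₁, h₂⟩ := hx i hi
    rw [h] at h₁ h₂
    have h₁' : (0 : ℤ) < n := by exact_mod_cast h₁
    have h₂' : n < (1 : ℤ) := by exact_mod_cast h₂
    omega
  · rintro ⟨hx, h⟩ i hi
    obtain ⟨h₁, h₂⟩ := hv i hi
    have h0 := h i 0
    have h1 := h i 1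
    push_cast at h0 h1
    refine ⟨lt_of_le_of_ne ?_ (Ne.symm ?_), h1.2 h₂⟩
    · exact not_lt.1 fun h' => lt_asymm h₁ (h0.1 h')
    · simpa using (mem_regularSet_iff b).1 hx i 0

/-- The set of elements of the affine Weyl group that move a point by a bounded amount, measured
by the coroots, is finite. -/
theorem finite_setOf_bounded (v a : V) (C : ℝ) :
    {w : affineWeylGroup b | ∀ i, |P.coroot' i (w.1 v - a)| ≤ C}.Finite := by
  classical
  cases nonempty_fintype ι
  choose e c he hc hr using fun w : affineWeylGroup b => exists_perm_of_mem_affineWeylGroup b w.2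
  set K : ℤ := ⌈C + ∑ i, |P.coroot' i v| + ∑ i, |P.coroot' i a|⌉ with hK
  refine Set.Finite.of_finite_image (f := fun w => (e w, c w)) ?_ ?_
  · refine Set.Finite.subset ((Set.finite_univ (α := Equiv.Perm ι)).prod
      (Set.Finite.pi' fun _ : ι => Set.finite_Icc (-K) K)) ?_
    rintro _ ⟨w, hw, rfl⟩
    refine ⟨Set.mem_univ _, fun i => ?_⟩
    have h₁ := hw (e w i)
    rw [map_sub, hc] at h₁
    have h₂ : |(c w i : ℝ)| ≤ C + |P.coroot' i v| + |P.coroot' (e w i) a| := by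
      have : (c w i : ℝ) = (P.coroot' i v + c w i - P.coroot' (e w i) a) - P.coroot' i v +
        P.coroot' (e w i) a := by ring
      rw [this]
      refine (abs_add_le _ _).trans (add_le_add ((abs_sub _ _).trans (add_le_add h₁ le_rfl)) le_rfl)
    have h₃ := Finset.single_le_sum (f := fun i => |P.coroot' i v|) (fun j _ => abs_nonneg _)
      (Finset.mem_univ i)
    have h₄ := Finset.single_le_sum (f := fun i => |P.coroot' i a|) (fun j _ => abs_nonneg _)
      (Finset.mem_univ (e w i))
    have h₅ : |(c w i : ℝ)| ≤ K := by
      refine le_trans ?_ (Int.le_ceil _)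
      linarith
    rw [abs_le] at h₅
    exact ⟨by exact_mod_cast h₅.1, by exact_mod_cast h₅.2⟩
  · intro w _ w' _ h
    obtain ⟨h₁, h₂⟩ := Prod.mk.inj h
    ext x
    refine sub_eq_zero.1 (eq_zero_of_forall_coroot'_eq_zero (P := P) fun i => ?_)
    obtain ⟨j, rfl⟩ := (e w).surjective i
    rw [map_sub, hc, h₁, hc, h₂, sub_self]

/-- Each regular vector can be moved into the fundamental alcove: a point of its orbit that is as
close as possible to a point of the fundamental alcove lies in the fundamental alcove, because
the reflection at a separating hyperplane would move it closer. -/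
theorem exists_apply_mem_fundamentalAlcove {v : V} (hv : v ∈ regularSet b) :
    ∃ w ∈ affineWeylGroup b, w v ∈ fundamentalAlcove b := by
  classical
  cases nonempty_fintype ι
  obtain ⟨a, ha⟩ := fundamentalAlcove_nonempty b
  set Q : affineWeylGroup b → ℝ := fun w => P.RootForm (w.1 v - a) (w.1 v - a) with hQ
  have hQ' : ∀ w i, |P.coroot' i (w.1 v - a)| ^ 2 ≤ Q w := by
    intro w i
    rw [sq_abs, sq, hQ]
    simp only
    rw [P.rootForm_apply_apply]
    exact Finset.single_le_sum
      (f := fun i => P.coroot' i (w.1 v - a) * P.coroot' i (w.1 v - a))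
      (fun j _ => mul_self_nonneg _) (Finset.mem_univ i)
  have hfin : {w : affineWeylGroup b | Q w ≤ Q 1}.Finite := by
    refine (finite_setOf_bounded b v a (Q 1 + 1)).subset fun w hw i => ?_
    have h₁ := (hQ' w i).trans hw
    nlinarith [sq_nonneg (|P.coroot' i (w.1 v - a)| - 1)]
  obtain ⟨w, hw, hmin⟩ := Set.exists_min_image _ Q hfin ⟨1, le_refl (Q 1)⟩
  have hmin' : ∀ w', Q w ≤ Q w' := by
    intro w'
    by_cases h : Q w' ≤ Q 1
    · exact hmin w' h
    · exact le_trans hw (not_le.1 h).le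
  refine ⟨w.1, w.2, fun i hi => ?_⟩
  have hreg := (mem_regularSet_iff b).1 (apply_mem_regularSet b w.2 hv) i
  obtain ⟨ha₁, ha₂⟩ := ha i hi
  have key : ∀ n : ℤ, 0 ≤ (P.coroot' i (w.1 v) - n) * (P.coroot' i a - n) := by
    intro n
    have h := hmin' (⟨affineReflection P i n, affineReflection_mem b i n⟩ * w)
    have hB := two_mul_rootForm_root (P := P) (w.1 v - a) i
    have hsymm : P.RootForm (P.root i) (w.1 v - a) = P.RootForm (w.1 v - a) (P.root i) := by
      rw [P.rootForm_apply_apply, P.rootForm_apply_apply]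
      exact Finset.sum_congr rfl fun _ _ => mul_comm _ _
    have heq : Q (⟨affineReflection P i n, affineReflection_mem b i n⟩ * w) =
        Q w + P.RootForm (P.root i) (P.root i) *
          ((P.coroot' i (w.1 v) - n) * (P.coroot' i a - n)) := by
      have : (⟨affineReflection P i n, affineReflection_mem b i n⟩ * w : affineWeylGroup b).1 v - a
          = (w.1 v - a) - (P.coroot' i (w.1 v) - n) • P.root i := by
        change affineReflection P i n (w.1 v) - a = _
        rw [affineReflection_apply]
        abel
      simp only [hQ]
      rw [this]
      simp only [map_sub, LinearMap.sub_apply, map_smul, LinearMap.smul_apply, smul_eq_mul]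
        at hB hsymm ⊢
      linear_combination -(P.coroot' i (w.1 v) - n) * hsymm - (P.coroot' i (w.1 v) - n) * hB
    rw [heq] at h
    have := rootForm_root_self_pos (P := P) i
    exact nonneg_of_mul_nonneg_right (by linarith) this
  have h0 := key 0
  have h1 := key 1
  have hr0 := hreg 0
  have hr1 := hreg 1
  push_cast at h0 h1 hr0 hr1
  simp only [sub_zero] at h0
  constructor
  · exact lt_of_le_of_ne (nonneg_of_mul_nonneg_left h0 ha₁) hr0.symm
  · refine lt_of_le_of_ne ?_ hr1
    by_contra hlt
    nlinarith

/-- An element of the affine Weyl group that maps the fundamental alcove onto itself is trivial: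
it moves `0` to an element of `ℤR` on which all coroots take values of absolute value at most `1`,
hence fixes `0`, and its linear part preserves the positive roots. -/
theorem eq_one_of_image_fundamentalAlcove {w : V ≃ᵃ[ℝ] V} (hw : w ∈ affineWeylGroup b)
    (h : w '' fundamentalAlcove b = fundamentalAlcove b) : w = 1 := by
  obtain ⟨h₁, h₂⟩ := linear_mem_and_apply_zero_mem b hw
  obtain ⟨a, ha⟩ := fundamentalAlcove_nonempty b
  have hle : ∀ i, b.IsPos i → 0 ≤ P.coroot' i (w 0) ∧ P.coroot' i (w 0) ≤ 1 := by
    intro i hi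
    -- `w (t a)` lies in the alcove for `0 < t < 1`; let `t` tend to `0`
    have hta : ∀ t : ℝ, 0 < t → t < 1 → 0 < t * P.coroot' i (w.linear a) + P.coroot' i (w 0) ∧
        t * P.coroot' i (w.linear a) + P.coroot' i (w 0) < 1 := by
      intro t ht₀ ht₁
      have hmem : t • a ∈ fundamentalAlcove b := by
        intro j hj
        obtain ⟨h₃, h₄⟩ := ha j hj
        rw [map_smul, smul_eq_mul]
        exact ⟨mul_pos ht₀ h₃, by nlinarith⟩
      have := (h ▸ Set.mem_image_of_mem w hmem : w (t • a) ∈ fundamentalAlcove b) i hi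
      rwa [affineEquiv_apply, map_smul, map_add, map_smul, smul_eq_mul] at this
    have hlim : Filter.Tendsto (fun t : ℝ => t * P.coroot' i (w.linear a) + P.coroot' i (w 0))
        (nhdsWithin 0 (Set.Ioi 0)) (nhds (P.coroot' i (w 0))) := by
      have : Continuous fun t : ℝ => t * P.coroot' i (w.linear a) + P.coroot' i (w 0) := by
        fun_prop
      simpa using (this.tendsto 0).mono_left nhdsWithin_le_nhds
    have hev : ∀ᶠ t : ℝ in nhdsWithin 0 (Set.Ioi 0), 0 < t ∧ t < 1 :=
      Ioo_mem_nhdsGT one_pos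
    exact ⟨ge_of_tendsto hlim (hev.mono fun t ht => (hta t ht.1 ht.2).1.le),
      le_of_tendsto hlim (hev.mono fun t ht => (hta t ht.1 ht.2).2.le)⟩
  have hw0 : w 0 = 0 := by
    refine eq_zero_of_mem_rootLattice_of_coroot'_le_one (P := P) h₂ fun i => ?_
    by_cases hi : b.IsPos i
    · exact (hle i hi).2
    · have := (hle _ ((isPos_reflectionPerm_self_iff b i).2 hi)).1
      rw [coroot'_reflectionPerm_self] at this
      linarith
  have hlin : w.linear = 1 := by
    refine eq_one_of_forall_isPos b h₁ fun j k hj hk => ?_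
    obtain ⟨e, he, he'⟩ := exists_perm_of_mem_closure_reflection h₁
    obtain rfl : e j = k := P.root.injective ((he j).symm.trans hk)
    have hwa : w a ∈ fundamentalAlcove b := h ▸ Set.mem_image_of_mem w ha
    by_contra hneg
    have h₅ := ((coroot'_mem_of_mem_fundamentalAlcove b hwa (e j)).2 hneg).2
    rw [affineEquiv_apply, hw0, add_zero, he'] at h₅
    exact lt_asymm h₅ (ha j hj).1
  ext v
  rw [affineEquiv_apply, hw0, hlin, add_zero]
  rfl

variable [TopologicalSpace V] [IsTopologicalAddGroup V] [ContinuousSMul ℝ V] [T2Space V]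
  [FiniteDimensional ℝ V]

/-- The fundamental alcove `A_e`, as an alcove. -/
def baseAlcove : Alcove b :=
  ⟨fundamentalAlcove b, by
    obtain ⟨v, hv⟩ := fundamentalAlcove_nonempty b
    have h := fundamentalAlcove_eq_cell b hv
    have hvr : v ∈ regularSet b := (h ▸ hv : v ∈ cell b v).1
    exact ⟨v, hvr, by rw [connectedComponentIn_regularSet b hvr, h]⟩⟩

variable {b}

theorem exists_smul_baseAlcove (A : Alcove b) : ∃ w : affineWeylGroup b, w • baseAlcove b = A := by
  obtain ⟨v, hv⟩ := A.nonempty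
  obtain ⟨w, hw, hwv⟩ := exists_apply_mem_fundamentalAlcove b (A.subset_regularSet hv)
  have : (⟨w, hw⟩ : affineWeylGroup b) • A = baseAlcove b :=
    Alcove.ext_of_mem (apply_mem_smul ⟨w, hw⟩ hv) hwv
  exact ⟨⟨w, hw⟩⁻¹, by rw [← this, inv_smul_smul]⟩

/-- The affine Weyl group acts freely on the alcoves. -/
theorem smul_left_injective_alcove (A : Alcove b) {w w' : affineWeylGroup b} (h : w • A = w' • A) :
    w = w' := by
  obtain ⟨x, rfl⟩ := exists_smul_baseAlcove A
  have h' : (x⁻¹ * w'⁻¹ * w * x) • baseAlcove b = baseAlcove b := by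
    rw [mul_smul, mul_smul, h, mul_smul, inv_smul_smul, inv_smul_smul]
  have h1 : x⁻¹ * w'⁻¹ * w * x = 1 :=
    Subtype.ext (eq_one_of_image_fundamentalAlcove b (Subtype.property _)
      (congrArg (fun A : Alcove b => (A : Set V)) h'))
  have h2 : w'⁻¹ * w = 1 := by
    have : w'⁻¹ * w = x * (x⁻¹ * w'⁻¹ * w * x) * x⁻¹ := by group
    rw [this, h1]
    group
  exact (inv_mul_eq_one.1 h2).symm

/-- The element `w` of the affine Weyl group with `A = w(A_e)`. -/
def elt (A : Alcove b) : affineWeylGroup b := (exists_smul_baseAlcove A).choose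

@[simp]
theorem elt_smul (A : Alcove b) : elt A • baseAlcove b = A := (exists_smul_baseAlcove A).choose_spec

theorem elt_smul_eq (w : affineWeylGroup b) (A : Alcove b) : elt (w • A) = w * elt A :=
  smul_left_injective_alcove (baseAlcove b) (by rw [elt_smul, mul_smul, elt_smul])

end SimplyTransitive

/-! ### The right action of a simple affine reflection -/

section RightMul

variable {ι V N : Type*} [Finite ι] [AddCommGroup V] [Module ℝ V] [AddCommGroup N] [Module ℝ N]
  {P : RootPairing ι ℝ V N} [P.IsRootSystem] [P.IsCrystallographic] [P.IsReduced] {b : P.Base}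

/-- The hyperplane `H_{α,n}` determines `(α, n)` up to sign. -/
theorem eq_or_eq_of_hyperplane_subset {i j : ι} {n m : ℤ}
    (h : hyperplane P j m ⊆ hyperplane P i n) :
    (i = j ∧ n = m) ∨ (i = P.reflectionPerm j j ∧ n = -m) := by
  have hx : ∀ v, P.coroot' j v = 0 → P.coroot' i v = 0 := by
    have hmem : ∀ v, P.coroot' j v = 0 → (m / 2 : ℝ) • P.root j + v ∈ hyperplane P j m := by
      intro v hv
      change P.coroot' j _ = _
      rw [map_add, hv, map_smul, RootPairing.root_coroot'_eq_pairing, P.pairing_same, smul_eq_mul]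
      ring
    intro v hv
    have h₁ : P.coroot' i _ = _ := h (hmem v hv)
    have h₂ : P.coroot' i _ = _ := h (hmem 0 (map_zero _))
    rw [map_add] at h₁ h₂
    rw [map_zero, add_zero] at h₂
    linarith
  set t : ℝ := P.coroot' i (P.root j) / 2 with ht
  have hcor : ∀ v, P.coroot' i v = t * P.coroot' j v := by
    intro v
    have h0 := hx (v - (P.coroot' j v / 2) • P.root j) (by
      rw [map_sub, map_smul, RootPairing.root_coroot'_eq_pairing, P.pairing_same, smul_eq_mul]
      ring)
    rw [map_sub, map_smul, smul_eq_mul] at h0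
    rw [ht]
    linarith
  have hco : P.coroot i = t • P.coroot j := by
    apply P.flip.toPerfPair.injective
    ext v
    rw [map_smul]
    exact hcor v
  have : IsAddTorsionFree V := .of_isTorsionFree ℝ V
  have : IsAddTorsionFree N := .of_isTorsionFree ℝ N
  have hroot : t • P.root i = P.root j := by
    refine RootPairing.smul_coroot_eq_of_root_eq_smul (P := P.flip) j i t hco
  have hdep : ¬ LinearIndependent ℝ ![P.root i, P.root j] := by
    intro hind
    have := LinearIndependent.pair_iff.1 hind t (-1) (by rw [hroot]; module)
    norm_num at this
  have hm : P.coroot' i ((m / 2 : ℝ) • P.root j) = n := h (by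
    change P.coroot' j _ = _
    rw [map_smul, RootPairing.root_coroot'_eq_pairing, P.pairing_same, smul_eq_mul]
    ring)
  rcases RootPairing.IsReduced.eq_or_eq_neg i j hdep with hij | hij
  · obtain rfl : i = j := P.root.injective hij
    rw [map_smul, RootPairing.root_coroot'_eq_pairing, P.pairing_same, smul_eq_mul] at hm
    left
    refine ⟨rfl, ?_⟩
    have : (n : ℝ) = m := by linarith
    exact_mod_cast this
  · obtain rfl : i = P.reflectionPerm j j :=
      P.root.injective (by rw [hij, root_reflectionPerm_self])
    rw [coroot'_reflectionPerm_self, map_smul, RootPairing.root_coroot'_eq_pairing,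
      P.pairing_same, smul_eq_mul] at hm
    right
    refine ⟨rfl, ?_⟩
    have : (n : ℝ) = ((-m : ℤ) : ℝ) := by push_cast; linarith
    exact_mod_cast this

theorem affineReflection_apply_eq_self_iff (i : ι) (n : ℤ) (v : V) :
    affineReflection P i n v = v ↔ v ∈ hyperplane P i n := by
  rw [affineReflection_apply, sub_eq_self, smul_eq_zero, sub_eq_zero]
  exact or_iff_left (P.ne_zero i)

theorem affineReflection_eq_imp {i j : ι} {n m : ℤ}
    (h : affineReflection P i n = affineReflection P j m) :
    (i = j ∧ n = m) ∨ (i = P.reflectionPerm j j ∧ n = -m) := by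
  refine eq_or_eq_of_hyperplane_subset fun v hv => ?_
  rwa [← affineReflection_apply_eq_self_iff, h, affineReflection_apply_eq_self_iff]

variable (b) in
/-- The affine reflection `s_{α,n}` as an element of the affine Weyl group. -/
def refl (i : ι) (n : ℤ) : affineWeylGroup b := ⟨affineReflection P i n, affineReflection_mem b i n⟩

theorem refl_mul_self (i : ι) (n : ℤ) : refl b i n * refl b i n = 1 :=
  Subtype.ext (affineReflection_mul_self i n)

theorem refl_reflectionPerm_self (i : ι) (n : ℤ) :
    refl b (P.reflectionPerm i i) n = refl b i (-n) :=
  Subtype.ext (affineReflection_reflectionPerm_self i n)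

variable (b) in
/-- The translation `t_γ`, `γ ∈ ℤR`, as an element of the affine Weyl group. -/
def transl (γ : rootLattice P) : affineWeylGroup b := ⟨translation γ.1, translation_mem b γ.2⟩

theorem transl_apply (γ : rootLattice P) (v : V) : (transl b γ).1 v = γ.1 + v := rfl

variable [TopologicalSpace V] [IsTopologicalAddGroup V] [ContinuousSMul ℝ V] [T2Space V]
  [FiniteDimensional ℝ V]

theorem orbitMap_eq_iff {A B : Alcove b} :
    orbitMap b A = orbitMap b B ↔ ∃ γ : rootLattice P, B = transl b γ • A := by
  refine (Quotient.eq (r := orbitSetoid b)).trans ?_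
  constructor
  · rintro ⟨γ, hγ, h⟩
    exact ⟨⟨γ, hγ⟩, Subtype.ext h⟩
  · rintro ⟨γ, h⟩
    exact ⟨γ.1, γ.2, congrArg Subtype.val h⟩

theorem orbitMap_transl_smul (γ : rootLattice P) (A : Alcove b) :
    orbitMap b (transl b γ • A) = orbitMap b A :=
  (orbitMap_eq_iff.2 ⟨γ, rfl⟩).symm

/-- The `ℤR`-orbit of `w A_e` is determined by the linear part of `w`, that is, by a permutation
of the roots. -/
instance : Finite (Orbit b) := by
  classical
  choose e c he hc hr using fun w : affineWeylGroup b => exists_perm_of_mem_affineWeylGroup b w.2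
  have key : ∀ A B : Alcove b, e (elt A) = e (elt B) → orbitMap b A = orbitMap b B := by
    intro A B h
    have hlin : (elt A).1.linear = (elt B).1.linear := by
      apply LinearEquiv.toLinearMap_injective
      refine LinearMap.ext_on_range (v := P.root) RootPairing.IsRootSystem.span_root_eq_top
        fun i => ?_
      change (elt A).1.linear _ = (elt B).1.linear _
      rw [he, he, h]
    have hγ : (elt B).1 0 - (elt A).1 0 ∈ rootLattice P :=
      sub_mem (linear_mem_and_apply_zero_mem b (elt B).2).2
        (linear_mem_and_apply_zero_mem b (elt A).2).2
    have : elt B = transl b ⟨_, hγ⟩ * elt A := by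
      ext v
      change _ = ((elt B).1 0 - (elt A).1 0) + (elt A).1 v
      rw [affineEquiv_apply, affineEquiv_apply (elt A).1 v, hlin]
      abel
    refine orbitMap_eq_iff.2 ⟨⟨_, hγ⟩, ?_⟩
    conv_lhs => rw [← elt_smul B, this, mul_smul, elt_smul]
  refine Finite.of_injective (β := Equiv.Perm ι)
    (fun x : Orbit b => e (elt (Quotient.out x))) fun x y h => ?_
  rw [← Quotient.out_eq x, ← Quotient.out_eq y]
  exact key _ _ h

/-- The alcove `A s`. -/
def rmul (s : affineWeylGroup b) (A : Alcove b) : Alcove b := (elt A * s) • baseAlcove b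

theorem rmul_smul (s w : affineWeylGroup b) (A : Alcove b) : rmul s (w • A) = w • rmul s A := by
  rw [rmul, rmul, elt_smul_eq, mul_assoc, mul_smul]

theorem isRightMul_iff {s : affineWeylGroup b} {A B : Alcove b} :
    IsRightMul b s.1 A B ↔ B = rmul s A := by
  constructor
  · rintro ⟨w, hw, hA, hB⟩
    obtain rfl : A = (⟨w, hw⟩ : affineWeylGroup b) • baseAlcove b := Subtype.ext hA
    have : elt ((⟨w, hw⟩ : affineWeylGroup b) • baseAlcove b) = ⟨w, hw⟩ :=
      smul_left_injective_alcove (baseAlcove b) (elt_smul _)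
    rw [rmul, this]
    exact Subtype.ext hB
  · rintro rfl
    exact ⟨(elt A).1, (elt A).2, congrArg Subtype.val (elt_smul A).symm, rfl⟩

theorem orbitMap_rmul_congr (s : affineWeylGroup b) {A B : Alcove b}
    (h : orbitMap b A = orbitMap b B) : orbitMap b (rmul s A) = orbitMap b (rmul s B) := by
  obtain ⟨γ, rfl⟩ := orbitMap_eq_iff.1 h
  rw [rmul_smul, orbitMap_transl_smul]

variable {s : affineWeylGroup b} (hs : IsSimpleAffineReflection b s.1)
include hs

theorem mul_self_of_isSimple : s * s = 1 := by
  obtain ⟨i, -, n, h, -⟩ := hs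
  rw [show s = refl b i n from Subtype.ext h, refl_mul_self]

theorem rmul_rmul (A : Alcove b) : rmul s (rmul s A) = A := by
  have h : elt (rmul s A) = elt A * s :=
    smul_left_injective_alcove (baseAlcove b) (elt_smul _)
  rw [rmul, h, mul_assoc, mul_self_of_isSimple hs, mul_one, elt_smul]

/-- The only hyperplane that separates `A` from `A s` is the one at which `A s` is the mirror image
of `A`. For `A = A_e` the points of the wall lie in the closures of both alcoves, hence in each
separating hyperplane. -/
theorem refl_smul_eq_rmul_of_separates {A : Alcove b} {i : ι} {n : ℤ} {x y : V}
    (hx : x ∈ (A : Set V)) (hxn : P.coroot' i x < n) (hy : y ∈ (rmul s A : Set V))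
    (hyn : n < P.coroot' i y) : refl b i n • A = rmul s A := by
  obtain ⟨j, hj, m, hsm, hspan⟩ := hs
  have base : ∀ (i : ι) (n : ℤ) (x y : V), x ∈ fundamentalAlcove b → P.coroot' i x < n →
      y ∈ s.1 '' fundamentalAlcove b → n < P.coroot' i y → refl b i n = s := by
    intro i n x y hx hxn hy hyn
    have hA : ∀ z ∈ fundamentalAlcove b, P.coroot' i z < n := fun z hz =>
      ((baseAlcove b).lt_iff_lt hz hx i n).2 hxn
    have hB : ∀ z ∈ s.1 '' fundamentalAlcove b, n < P.coroot' i z := fun z hz =>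
      lt_of_le_of_ne (not_lt.1 fun h => lt_asymm hyn
        (((s • baseAlcove b).lt_iff_lt hz hy i n).1 h)) ((s • baseAlcove b).ne_int hz i n).symm
    have hsub : closure (fundamentalAlcove b) ∩ hyperplane P j m ⊆ hyperplane P i n := by
      rintro z ⟨hz, hzm⟩
      refine le_antisymm ?_ ?_
      · exact closure_minimal (fun z hz => (hA z hz).le)
          (isClosed_le (continuous_coroot' P i) continuous_const) hz
      · have hsz : s.1 z = z := by rwa [hsm, affineReflection_apply_eq_self_iff]
        have hcont : Continuous s.1 := by
          have : ⇑s.1 = fun v => v - (P.coroot' j v - m) • P.root j := by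
            funext v
            rw [hsm, affineReflection_apply]
          rw [this]
          exact continuous_id.sub
            (((continuous_coroot' P j).sub continuous_const).smul continuous_const)
        have hz' : z ∈ closure (s.1 '' fundamentalAlcove b) := by
          rw [← hsz]
          exact image_closure_subset_closure_image hcont (Set.mem_image_of_mem _ hz)
        exact closure_minimal (fun z hz => (hB z hz).le)
          (isClosed_le continuous_const (continuous_coroot' P i)) hz'
    have hsub' : hyperplane P j m ⊆ hyperplane P i n := by
      refine hspan.trans ?_
      let E : AffineSubspace ℝ V :=
        (AffineSubspace.mk' ((n : ℝ)) ⊥).comap (P.coroot' i).toAffineMap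
      have hE : (E : Set V) = hyperplane P i n := by
        ext z
        simp [E, hyperplane, AffineSubspace.mem_mk', sub_eq_zero]
      rw [← hE] at hsub ⊢
      exact affineSpan_le.2 hsub
    apply Subtype.ext
    rw [hsm]
    rcases eq_or_eq_of_hyperplane_subset hsub' with ⟨rfl, rfl⟩ | ⟨rfl, rfl⟩
    · rfl
    · change affineReflection P _ _ = _
      rw [affineReflection_reflectionPerm_self, neg_neg]
  obtain ⟨w, rfl⟩ := exists_smul_baseAlcove A
  rw [rmul_smul] at hy ⊢
  obtain ⟨e, c, -, hc, hr⟩ := exists_perm_of_mem_affineWeylGroup b w.2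
  obtain ⟨x, hx, rfl⟩ := hx
  obtain ⟨y, hy, rfl⟩ := hy
  obtain ⟨i, rfl⟩ := e.surjective i
  obtain ⟨n, rfl⟩ : ∃ m, n = m + c i := ⟨n - c i, by ring⟩
  rw [hc] at hxn hyn
  push_cast at hxn hyn
  have hone : elt (baseAlcove b) = 1 :=
    smul_left_injective_alcove (baseAlcove b) ((elt_smul _).trans (one_smul _ _).symm)
  have hbase : rmul s (baseAlcove b) = s • baseAlcove b := by rw [rmul, hone, one_mul]
  rw [hbase] at hy ⊢
  have hs' := base i n x y hx (by linarith) hy (by linarith)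
  have hr' : refl b (e i) (n + c i) * w = w * refl b i n := Subtype.ext (hr i n)
  rw [← mul_smul, hr', mul_smul, hs']

/-- The alcove `A s` is the mirror image of `A` at some hyperplane, and the sign of the root can be
chosen such that `A` lies on its positive side. -/
theorem exists_wall (A : Alcove b) :
    ∃ (j : ι) (n : ℤ), refl b j n • A = rmul s A ∧ ∀ v ∈ (A : Set V), n < P.coroot' j v := by
  obtain ⟨j, -, m, hsm, -⟩ := hs
  obtain ⟨e, c, -, -, hr⟩ := exists_perm_of_mem_affineWeylGroup b (elt A).2
  have hr' : refl b (e j) (m + c j) * elt A = elt A * s :=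
    Subtype.ext ((hr j m).trans (by rw [← hsm]; rfl))
  have hrefl : refl b (e j) (m + c j) • A = rmul s A := by
    conv_lhs => rw [← elt_smul A, ← mul_smul, hr']
    rfl
  generalize m + c j = n at hrefl
  generalize e j = j at hrefl
  obtain ⟨v, hv⟩ := A.nonempty
  by_cases h : P.coroot' j v < n
  · refine ⟨P.reflectionPerm j j, -n, by rw [refl_reflectionPerm_self, neg_neg, hrefl], ?_⟩
    intro x hx
    rw [coroot'_reflectionPerm_self, Int.cast_neg, neg_lt_neg_iff]
    exact (A.lt_iff_lt hx hv j n).2 h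
  · refine ⟨j, n, hrefl, fun x hx =>
      lt_of_le_of_ne (not_lt.1 fun h' => h ?_) (A.ne_int hx j n).symm⟩
    exact (A.lt_iff_lt hx hv j n).1 h'

/-- The index of the root `α` for which `A` lies on the positive side of the hyperplane `H_{α,n}`
that separates it from `A s`. -/
def wallIndex (A : Alcove b) : ι := (exists_wall hs A).choose

theorem wallIndex_eq {A : Alcove b} {j : ι} {n : ℤ} (h : refl b j n • A = rmul s A)
    (hpos : ∀ v ∈ (A : Set V), n < P.coroot' j v) : wallIndex hs A = j := by
  obtain ⟨m, hm, hmpos⟩ := (exists_wall hs A).choose_spec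
  change refl b (wallIndex hs A) m • A = _ at hm
  change ∀ v ∈ (A : Set V), m < P.coroot' (wallIndex hs A) v at hmpos
  have heq := smul_left_injective_alcove A (hm.trans h.symm)
  rcases affineReflection_eq_imp (congrArg Subtype.val heq) with ⟨h₁, -⟩ | ⟨h₁, h₂⟩
  · exact h₁
  · obtain ⟨v, hv⟩ := A.nonempty
    have h₃ := hmpos v hv
    rw [h₁, h₂, coroot'_reflectionPerm_self, Int.cast_neg, neg_lt_neg_iff] at h₃
    exact absurd h₃ (not_lt.2 (hpos v hv).le)

theorem exists_refl_wallIndex (A : Alcove b) :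
    ∃ n : ℤ, refl b (wallIndex hs A) n • A = rmul s A ∧
      ∀ v ∈ (A : Set V), n < P.coroot' (wallIndex hs A) v :=
  (exists_wall hs A).choose_spec

theorem root_wallIndex_smul (w : affineWeylGroup b) (A : Alcove b) :
    P.root (wallIndex hs (w • A)) = w.1.linear (P.root (wallIndex hs A)) := by
  obtain ⟨n, hn, hpos⟩ := exists_refl_wallIndex hs A
  obtain ⟨e, c, he, hc, hr⟩ := exists_perm_of_mem_affineWeylGroup b w.2
  have hr' : refl b (e (wallIndex hs A)) (n + c _) * w = w * refl b (wallIndex hs A) n :=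
    Subtype.ext (hr _ n)
  rw [he]
  congr 1
  refine wallIndex_eq hs (n := n + c (wallIndex hs A)) ?_ ?_
  · rw [← mul_smul, hr', mul_smul, hn, rmul_smul]
  · rintro _ ⟨v, hv, rfl⟩
    rw [hc]
    push_cast
    linarith [hpos v hv]

theorem wallIndex_refl_smul (i : ι) (n : ℤ) (A : Alcove b) :
    wallIndex hs (refl b i n • A) = P.reflectionPerm i (wallIndex hs A) := by
  apply P.root.injective
  rw [root_wallIndex_smul, P.root_reflectionPerm]
  rfl

theorem wallIndex_rmul (A : Alcove b) :
    wallIndex hs (rmul s A) = P.reflectionPerm (wallIndex hs A) (wallIndex hs A) := by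
  obtain ⟨n, hn, -⟩ := exists_refl_wallIndex hs A
  rw [← hn, wallIndex_refl_smul]

theorem wallIndex_congr {A B : Alcove b} (h : orbitMap b A = orbitMap b B) :
    wallIndex hs A = wallIndex hs B := by
  obtain ⟨γ, rfl⟩ := orbitMap_eq_iff.1 h
  apply P.root.injective
  rw [root_wallIndex_smul]
  have : (transl b γ).1.linear = 1 := AffineEquiv.linear_constVAdd ℝ V _
  rw [this]
  rfl

end RightMul

/-! ### The order on alcoves and the right action -/

section Order

variable {ι V N : Type*} [Finite ι] [AddCommGroup V] [Module ℝ V] [AddCommGroup N] [Module ℝ N]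
  {P : RootPairing ι ℝ V N} [P.IsRootSystem] [P.IsCrystallographic] [P.IsReduced] {b : P.Base}

variable (b) in
/-- There is a linear form that is positive on all positive roots. -/
theorem exists_forall_isPos_root_pos : ∃ f : V →ₗ[ℝ] ℝ, ∀ i, b.IsPos i → 0 < f (P.root i) := by
  have hf : ∀ i ∈ b.support, b.toWeightBasis.constr ℝ (fun _ => (1 : ℝ)) (P.root i) = 1 := by
    intro i hi
    have h := b.toWeightBasis.constr_basis ℝ (fun _ => (1 : ℝ)) ⟨i, hi⟩
    rwa [b.toWeightBasis_apply] at h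
  refine ⟨b.toWeightBasis.constr ℝ fun _ => (1 : ℝ), fun i hi => ?_⟩
  refine hi.induction_on_add
    (p := fun i => 0 < b.toWeightBasis.constr ℝ (fun _ => (1 : ℝ)) (P.root i))
    (fun j hj => ?_) (fun j k l h hj hk => ?_)
  · rw [hf j hj]
    exact one_pos
  · rw [h, map_add, hf k hk]
    exact add_pos hj one_pos

theorem posCone_le_rootLattice {γ : V} (hγ : γ ∈ posCone b) : γ ∈ rootLattice P := by
  induction hγ using AddSubmonoid.closure_induction with
  | mem x hx =>
    obtain ⟨i, -, rfl⟩ := hx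
    exact root_mem_rootLattice i
  | zero => exact zero_mem _
  | add x y _ _ hx hy => exact add_mem hx hy

variable [TopologicalSpace V] [IsTopologicalAddGroup V] [ContinuousSMul ℝ V] [T2Space V]
  [FiniteDimensional ℝ V] {k T : Type*} [Field k] [CommRing T] [Algebra (SymAlg P k) T]

theorem orderStep_iff {A B : Alcove b} : orderStep b k T A B ↔
    (∃ γ : rootLattice P, γ.1 ∈ posCone b ∧ B = transl b γ • A) ∨
      ∃ i ∈ posRootsT b k T, ∃ n : ℤ, (∀ v ∈ (A : Set V), P.coroot' i v < n) ∧
        B = refl b i n • A := by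
  constructor
  · rintro (⟨γ, hγ, h⟩ | ⟨i, hi, n, hA, h⟩)
    · exact Or.inl ⟨⟨γ, posCone_le_rootLattice hγ⟩, hγ, Subtype.ext h⟩
    · exact Or.inr ⟨i, hi, n, hA, Subtype.ext h⟩
  · rintro (⟨γ, hγ, rfl⟩ | ⟨i, hi, n, hA, rfl⟩)
    · exact Or.inl ⟨γ.1, hγ, rfl⟩
    · exact Or.inr ⟨i, hi, n, hA, rfl⟩

variable (b k T) in
/-- The order `⪯_T`, as a relation on the set of alcoves. -/
abbrev AlcoveLE (A B : Alcove b) : Prop := Relation.ReflTransGen (orderStep b k T) A B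

theorem exists_refl_transl (γ : rootLattice P) (i : ι) : ∃ c : ℤ,
    (∀ n, refl b i (n + c) * transl b γ = transl b γ * refl b i n) ∧
      ∀ v, P.coroot' i ((transl b γ).1 v) = P.coroot' i v + c := by
  obtain ⟨e, c, he, hc, hr⟩ := exists_perm_of_mem_affineWeylGroup b (transl b γ).2
  have hlin : (transl b γ).1.linear = 1 := AffineEquiv.linear_constVAdd ℝ V _
  have hi : e i = i := P.root.injective (by rw [← he, hlin]; rfl)
  refine ⟨c i, fun n => Subtype.ext ?_, fun v => ?_⟩
  · have := hr i n
    rwa [hi] at this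
  · have := hc i v
    rwa [hi] at this

theorem orderStep_transl_smul {A B : Alcove b} (h : orderStep b k T A B) (γ : rootLattice P) :
    orderStep b k T (transl b γ • A) (transl b γ • B) := by
  rw [orderStep_iff] at h ⊢
  rcases h with ⟨δ, hδ, rfl⟩ | ⟨i, hi, n, hA, rfl⟩
  · refine Or.inl ⟨δ, hδ, ?_⟩
    rw [← mul_smul, ← mul_smul]
    congr 1
    apply Subtype.ext
    change translation γ.1 * translation δ.1 = translation δ.1 * translation γ.1
    rw [← translation_add, ← translation_add, add_comm]
  · obtain ⟨c, hc, hc'⟩ := exists_refl_transl (b := b) γ i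
    refine Or.inr ⟨i, hi, n + c, ?_, by rw [← mul_smul, ← mul_smul, hc]⟩
    rintro _ ⟨v, hv, rfl⟩
    rw [hc']
    push_cast
    linarith [hA v hv]

/-- Elements that are comparable lie in one orbit of `Ŵ_T`. -/
theorem exists_mem_affineWeylGroupT_of_le {A B : Alcove b} (h : AlcoveLE b k T A B) :
    ∃ w : affineWeylGroup b, w.1 ∈ affineWeylGroupT b k T ∧ B = w • A := by
  induction h with
  | refl => exact ⟨1, one_mem _, (one_smul _ _).symm⟩
  | tail _ hstep ih =>
    obtain ⟨w, hw, rfl⟩ := ih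
    rcases orderStep_iff.1 hstep with ⟨γ, -, rfl⟩ | ⟨i, hi, n, -, rfl⟩
    · exact ⟨transl b γ * w,
        mul_mem (Subgroup.subset_closure (Or.inl ⟨γ.1, γ.2, rfl⟩)) hw, (mul_smul _ _ _).symm⟩
    · refine ⟨refl b i n * w, mul_mem ?_ hw, (mul_smul _ _ _).symm⟩
      obtain ⟨-, m, hm⟩ := hi
      have h := translation_root (P := P) i n m
      change affineReflection P i n ∈ _
      rw [← h]
      refine mul_mem (Subgroup.subset_closure (Or.inl ⟨_, ?_, rfl⟩)) hm
      rw [← Int.cast_sub, Int.cast_smul_eq_zsmul]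
      exact zsmul_mem (root_mem_rootLattice i) _

/-- A linear form that is positive on the positive roots strictly increases along the order. -/
theorem eq_or_exists_lt_of_le {f : V →ₗ[ℝ] ℝ} (hf : ∀ i, b.IsPos i → 0 < f (P.root i))
    {A B : Alcove b} (h : AlcoveLE b k T A B) :
    A = B ∨ ∃ w : affineWeylGroup b, B = w • A ∧
      ∀ v ∈ (A : Set V), f v < f (w.1 v) := by
  have hcone : ∀ γ ∈ posCone b, γ = 0 ∨ 0 < f γ := by
    intro γ hγ
    induction hγ using AddSubmonoid.closure_induction with
    | mem x hx =>
      obtain ⟨i, hi, rfl⟩ := hx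
      exact Or.inr (hf i hi)
    | zero => exact Or.inl rfl
    | add x y _ _ hx hy =>
      rcases hx with rfl | hx
      · simpa using hy
      · rcases hy with rfl | hy
        · simpa using Or.inr hx
        · exact Or.inr (by rw [map_add]; exact add_pos hx hy)
  induction h with
  | refl => exact Or.inl rfl
  | @tail C D hAC hstep ih =>
    have hstep' : C = D ∨ ∃ w : affineWeylGroup b, D = w • C ∧
        ∀ v ∈ (C : Set V), f v < f (w.1 v) := by
      rcases orderStep_iff.1 hstep with ⟨γ, hγ, rfl⟩ | ⟨i, hi, n, hneg, rfl⟩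
      · rcases hcone _ hγ with h0 | hpos
        · left
          have : transl b γ = 1 := Subtype.ext (by
            change translation γ.1 = 1
            rw [h0, translation_zero])
          rw [this, one_smul]
        · refine Or.inr ⟨_, rfl, fun v _ => ?_⟩
          rw [transl_apply, map_add]
          linarith
      · refine Or.inr ⟨_, rfl, fun v hv => ?_⟩
        change f v < f (affineReflection P i n v)
        rw [affineReflection_apply, map_sub, map_smul, smul_eq_mul]
        nlinarith [hneg v hv, hf i hi.1]
    rcases ih with rfl | ⟨w, rfl, hw⟩
    · exact hstep'
    · rcases hstep' with rfl | ⟨w', rfl, hw'⟩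
      · exact Or.inr ⟨w, rfl, hw⟩
      · refine Or.inr ⟨w' * w, (mul_smul _ _ _).symm, fun v hv => (hw v hv).trans ?_⟩
        exact hw' _ (apply_mem_smul w hv)

theorem AlcoveLE.antisymm {A B : Alcove b} (h₁ : AlcoveLE b k T A B)
    (h₂ : AlcoveLE b k T B A) : A = B := by
  obtain ⟨f, hf⟩ := exists_forall_isPos_root_pos b
  rcases eq_or_exists_lt_of_le hf h₁ with h | ⟨w, rfl, hw⟩
  · exact h
  rcases eq_or_exists_lt_of_le hf h₂ with h | ⟨w', h', hw'⟩
  · exact h.symm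
  obtain ⟨v, hv⟩ := A.nonempty
  have h1 : w' * w = 1 := smul_left_injective_alcove A (by
    rw [mul_smul, one_smul]
    exact h'.symm)
  have h2 : w'.1 (w.1 v) = v := by
    change (w' * w).1 v = v
    rw [h1]
    rfl
  have := (hw v hv).trans (hw' _ (apply_mem_smul w hv))
  rw [h2] at this
  exact absurd this (lt_irrefl _)

variable {s : affineWeylGroup b} (hs : IsSimpleAffineReflection b s.1)
include hs

/-- Right multiplication by `s` preserves generating relations, except that it may collapse
`A ⪯ A s`. -/
theorem orderStep_rmul {A B : Alcove b} (h : orderStep b k T A B) :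
    orderStep b k T (rmul s A) (rmul s B) ∨ rmul s A = B := by
  rcases orderStep_iff.1 h with ⟨γ, hγ, rfl⟩ | ⟨i, hi, n, hA, rfl⟩
  · exact Or.inl (orderStep_iff.2 (Or.inl ⟨γ, hγ, rmul_smul _ _ _⟩))
  · by_cases hall : ∀ v ∈ (rmul s A : Set V), P.coroot' i v < n
    · exact Or.inl (orderStep_iff.2 (Or.inr ⟨i, hi, n, hall, rmul_smul _ _ _⟩))
    · push Not at hall
      obtain ⟨y, hy, hyn⟩ := hall
      obtain ⟨x, hx⟩ := A.nonempty
      right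
      exact (refl_smul_eq_rmul_of_separates hs hx (hA x hx) hy
        (lt_of_le_of_ne hyn ((rmul s A).ne_int hy i n).symm)).symm

/-- If `A s ⪯ A`, then the set of alcoves below `A` is stable under `s`. -/
theorem rmul_le_of_le {A C : Alcove b} (hA : AlcoveLE b k T (rmul s A) A)
    (h : AlcoveLE b k T C A) : AlcoveLE b k T (rmul s C) A := by
  induction h using Relation.ReflTransGen.head_induction_on with
  | refl => exact hA
  | head hstep hle ih =>
    rcases orderStep_rmul hs hstep with h | h
    · exact Relation.ReflTransGen.head h ih
    · rw [h]
      exact hle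

/-- If `B` lies in the `ℤR`-orbit of `A s` and `B ⪯ A`, then also `B s ⪯ A`. -/
theorem rmul_le_of_orbitMap_eq {A B : Alcove b}
    (hAB : orbitMap b B = orbitMap b (rmul s A)) (h : AlcoveLE b k T B A) :
    AlcoveLE b k T (rmul s B) A := by
  obtain ⟨i, hi, n, hn⟩ : ∃ i, b.IsPos i ∧ ∃ n, refl b i n • A = rmul s A := by
    obtain ⟨n, hn, -⟩ := exists_refl_wallIndex hs A
    by_cases hj : b.IsPos (wallIndex hs A)
    · exact ⟨_, hj, n, hn⟩
    · exact ⟨_, (isPos_reflectionPerm_self_iff b _).2 hj, -n, by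
        rw [refl_reflectionPerm_self, neg_neg, hn]⟩
  by_cases hiT : i ∈ posRootsT b k T
  · by_cases hneg : ∀ v ∈ (A : Set V), P.coroot' i v < n
    · -- here `A ⪯ A s`, hence `B s ⪯ B`
      have hstep : orderStep b k T A (rmul s A) :=
        orderStep_iff.2 (Or.inr ⟨i, hiT, n, hneg, hn.symm⟩)
      obtain ⟨γ, hγ⟩ := orbitMap_eq_iff.1 hAB.symm
      have hB : rmul s B = transl b γ • A := by
        rw [hγ, rmul_smul, rmul_rmul hs]
      have := orderStep_transl_smul hstep γ
      rw [← hγ, ← hB] at this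
      exact Relation.ReflTransGen.head this h
    · -- here `A s ⪯ A`
      refine rmul_le_of_le hs (Relation.ReflTransGen.single (orderStep_iff.2 ?_)) h
      refine Or.inr ⟨i, hiT, n, ?_, by rw [← hn, ← mul_smul, refl_mul_self, one_smul]⟩
      push Not at hneg
      obtain ⟨x, hx, hxn⟩ := hneg
      rw [← hn]
      rintro _ ⟨v, hv, rfl⟩
      change P.coroot' i (affineReflection P i n v) < n
      rw [coroot'_affineReflection_self]
      have hvn : ¬ P.coroot' i v < n := fun h' =>
        absurd ((A.lt_iff_lt hx hv i n).2 h') (not_lt.2 hxn)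
      have := lt_of_le_of_ne (not_lt.1 hvn) (A.ne_int hv i n).symm
      linarith
  · -- `B = t_γ s_{α,n} A` and `A` lie in one orbit of `Ŵ_T`, which acts freely, so that
    -- `s_{α,n}` belongs to `Ŵ_T` and `α` to `R_T^+`
    exfalso
    apply hiT
    refine ⟨hi, n, ?_⟩
    obtain ⟨w, hw, hwB⟩ := exists_mem_affineWeylGroupT_of_le h
    obtain ⟨γ, hγ⟩ := orbitMap_eq_iff.1 hAB.symm
    have h1 : w * transl b γ * refl b i n = 1 := smul_left_injective_alcove A (by
      rw [mul_smul, mul_smul, hn, ← hγ, one_smul]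
      exact hwB.symm)
    have h2 : refl b i n = (w * transl b γ)⁻¹ := eq_inv_of_mul_eq_one_right h1
    change (refl b i n).1 ∈ _
    rw [h2]
    exact inv_mem (mul_mem hw (Subgroup.subset_closure (Or.inl ⟨γ.1, γ.2, rfl⟩)))

omit hs in
variable (s) in
/-- The map `A ↦ A s` on the space of alcoves. -/
def spaceMul (A : AlcoveSpace b k T) : AlcoveSpace b k T := rmul s A

omit hs in
/-- The orbit map on the space of alcoves. -/
def orb (A : AlcoveSpace b k T) : Orbit b := orbitMap b A

omit hs in
theorem mem_of_le {U : Opens (AlcoveSpace b k T)} {A B : AlcoveSpace b k T} (h : A ≤ B)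
    (hB : B ∈ U) : A ∈ U :=
  (show IsLowerSet (U : Set (AlcoveSpace b k T)) from U.isOpen) h hB

theorem spaceMul_spaceMul (A : AlcoveSpace b k T) : spaceMul s (spaceMul s A) = A :=
  rmul_rmul hs A

theorem mem_rightMulSet_iff {𝒯 : Set (AlcoveSpace b k T)} {A : AlcoveSpace b k T} :
    A ∈ rightMulSet b s.1 𝒯 ↔ spaceMul s A ∈ 𝒯 := by
  constructor
  · rintro ⟨B, hB, h⟩
    rwa [show spaceMul s A = B by rw [isRightMul_iff.1 h]; exact rmul_rmul hs B]
  · intro h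
    exact ⟨_, h, isRightMul_iff.2 (rmul_rmul hs A).symm⟩

theorem mem_sharpSet_iff {𝒯 : Set (AlcoveSpace b k T)} {A : AlcoveSpace b k T} :
    A ∈ sharpSet s.1 𝒯 ↔ A ∈ 𝒯 ∨ spaceMul s A ∈ 𝒯 :=
  or_congr Iff.rfl (mem_rightMulSet_iff hs)

/-- If `B ⪯ A` is a generating relation and `A s ∈ 𝒥`, then either `B s ⪯ A s`, or `A s = B` and
`B` itself lies in `𝒥`. -/
theorem isOpen_sharpSet (U : Opens (AlcoveSpace b k T)) :
    IsOpen (sharpSet s.1 (U : Set (AlcoveSpace b k T))) := by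
  change IsLowerSet _
  intro A B hBA hA
  have hBA' : AlcoveLE b k T B A := hBA
  clear hBA
  induction hBA' using Relation.ReflTransGen.head_induction_on with
  | refl => exact hA
  | @head C D hstep hle ih =>
    have ih' := (mem_sharpSet_iff hs).1 ih
    refine (mem_sharpSet_iff hs).2 ?_
    rcases ih' with h | h
    · exact Or.inl (mem_of_le (Relation.ReflTransGen.single hstep) h)
    · rcases orderStep_rmul hs hstep with h' | h'
      · exact Or.inr (mem_of_le (Relation.ReflTransGen.single h') h)
      · left
        have : spaceMul s (D : AlcoveSpace b k T) = (C : AlcoveSpace b k T) := by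
          rw [← h']
          exact rmul_rmul hs C
        exact this ▸ h

theorem isInvariant_iff {U : Set (AlcoveSpace b k T)} :
    IsInvariant s.1 U ↔ ∀ A : AlcoveSpace b k T, A ∈ U ↔ spaceMul s A ∈ U :=
  Set.ext_iff.trans (forall_congr' fun _ => iff_congr Iff.rfl (mem_rightMulSet_iff hs))

variable (s) in
omit hs in
/-- The open set `𝒥^♯`. -/
abbrev sharp (U : Opens (AlcoveSpace b k T)) : Opens (AlcoveSpace b k T) :=
  (sharpFunctor s.1).obj U

theorem mem_sharp_iff {U : Opens (AlcoveSpace b k T)} {A : AlcoveSpace b k T} :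
    A ∈ sharp s U ↔ A ∈ U ∨ spaceMul s A ∈ U := by
  refine Iff.trans ⟨?_, ?_⟩ (mem_sharpSet_iff (𝒯 := (U : Set (AlcoveSpace b k T))) hs)
  · rintro ⟨B, hB, hAB⟩
    exact (show IsLowerSet _ from isOpen_sharpSet hs U) hAB hB
  · intro h
    exact ⟨A, h, le_rfl⟩

theorem le_sharp (U : Opens (AlcoveSpace b k T)) : U ≤ sharp s U := fun _ hA =>
  (mem_sharp_iff hs).2 (Or.inl hA)

theorem isInvariant_sharp (U : Opens (AlcoveSpace b k T)) :
    IsInvariant s.1 (sharp s U : Set (AlcoveSpace b k T)) := by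
  rw [isInvariant_iff hs]
  intro A
  rw [SetLike.mem_coe, SetLike.mem_coe, mem_sharp_iff hs, mem_sharp_iff hs, spaceMul_spaceMul hs,
    or_comm]

theorem sharp_eq_self {U : Opens (AlcoveSpace b k T)}
    (hU : IsInvariant s.1 (U : Set (AlcoveSpace b k T))) : sharp s U = U := by
  ext A
  have := (isInvariant_iff hs).1 hU A
  rw [SetLike.mem_coe, SetLike.mem_coe] at this
  rw [SetLike.mem_coe, SetLike.mem_coe, mem_sharp_iff hs, ← this, or_self]

theorem sharp_sharp (U : Opens (AlcoveSpace b k T)) : sharp s (sharp s U) = sharp s U :=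
  sharp_eq_self hs (isInvariant_sharp hs U)

omit hs in
theorem mem_orbitHull_iff {x : Orbit b} {U : Opens (AlcoveSpace b k T)} {A : AlcoveSpace b k T} :
    A ∈ orbitHull x U ↔ ∃ B : AlcoveSpace b k T, (B ∈ U ∧ orb B = x) ∧ A ≤ B := Iff.rfl

omit hs in
theorem mem_orbitHull_of_orb_eq {x : Orbit b} {U : Opens (AlcoveSpace b k T)}
    {A : AlcoveSpace b k T} (hx : orb A = x) : A ∈ orbitHull x U ↔ A ∈ U :=
  ⟨fun h => orbitHull_le x U h, fun h => ⟨A, ⟨h, hx⟩, le_rfl⟩⟩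

variable (s) in
omit hs in
/-- The right action of `s` on the set of orbits. -/
def orbitMul (x : Orbit b) : Orbit b :=
  Quotient.lift (fun A => orbitMap b (rmul s A))
    (fun _ _ h => orbitMap_rmul_congr s (Quotient.sound h)) x

omit hs in
theorem orbitMul_orbitMap (A : Alcove b) : orbitMul s (orbitMap b A) = orbitMap b (rmul s A) := rfl

omit hs in
theorem exists_orbitMap_eq (x : Orbit b) : ∃ A, orbitMap b A = x := Quotient.exists_rep x

theorem orbitMul_orbitMul (x : Orbit b) : orbitMul s (orbitMul s x) = x := by
  obtain ⟨A, rfl⟩ := exists_orbitMap_eq x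
  rw [orbitMul_orbitMap, orbitMul_orbitMap, rmul_rmul hs]

omit hs in
theorem orb_spaceMul (A : AlcoveSpace b k T) : orb (spaceMul s A) = orbitMul s (orb A) := rfl

theorem orb_spaceMul_eq_iff {A : AlcoveSpace b k T} {x : Orbit b} :
    orb (spaceMul s A) = x ↔ orb A = orbitMul s x := by
  rw [orb_spaceMul]
  constructor
  · rintro rfl
    rw [orbitMul_orbitMul hs]
  · intro h
    rw [h, orbitMul_orbitMul hs]

theorem spaceMul_le_of_orb_eq {A B : AlcoveSpace b k T} (hAB : orb B = orbitMul s (orb A))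
    (h : B ≤ A) : spaceMul s B ≤ A :=
  rmul_le_of_orbitMap_eq hs hAB h

/-- `((𝒥 ∩ x)_⪯)^♯` and `𝒥` have the same intersection with `x`. -/
theorem mem_sharp_orbitHull_iff {x : Orbit b} {U : Opens (AlcoveSpace b k T)}
    {A : AlcoveSpace b k T} (hx : orb A = x) :
    A ∈ sharp s (orbitHull x U) ↔ A ∈ U := by
  rw [mem_sharp_iff hs, mem_orbitHull_of_orb_eq hx]
  refine ⟨?_, Or.inl⟩
  rintro (h | h)
  · exact h
  · obtain ⟨B, ⟨hB, hBx⟩, hle⟩ := mem_orbitHull_iff.1 h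
    have := spaceMul_le_of_orb_eq hs (by rw [orb_spaceMul, hx, hBx]) hle
    rw [spaceMul_spaceMul hs] at this
    exact mem_of_le this hB

/-- `((𝒥 ∩ x)_⪯)^♯` and `𝒥 s` have the same intersection with `x s`. -/
theorem mem_sharp_orbitHull_iff' {x : Orbit b} {U : Opens (AlcoveSpace b k T)}
    {A : AlcoveSpace b k T} (hx : orb A = orbitMul s x) :
    A ∈ sharp s (orbitHull x U) ↔ spaceMul s A ∈ U := by
  have hx' := (orb_spaceMul_eq_iff hs).2 hx
  rw [mem_sharp_iff hs, mem_orbitHull_of_orb_eq hx']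
  refine ⟨?_, Or.inr⟩
  rintro (h | h)
  · obtain ⟨B, ⟨hB, hBx⟩, hle⟩ := mem_orbitHull_iff.1 h
    exact mem_of_le (spaceMul_le_of_orb_eq hs (by rw [hx, hBx]) hle) hB
  · exact h

end Order

/-! ### Linear elements of symmetric algebras -/

section SymmetricAlgebra

variable {k M : Type*} [Field k] [AddCommGroup M] [Module k M]

theorem isDomain_symmetricAlgebra : IsDomain (SymmetricAlgebra k M) :=
  (SymmetricAlgebra.equivMvPolynomial (Module.Basis.ofVectorSpace k M)).toMulEquiv.isDomain _

theorem prime_symmetricAlgebra_ι {v : M} (hv : v ≠ 0) : Prime (SymmetricAlgebra.ι k M v) := by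
  have hli : LinearIndepOn k id ({v} : Set M) := by
    simpa using hv
  let B := Module.Basis.extend hli
  obtain ⟨i, hi⟩ : ∃ i, B i = v := by
    refine ⟨⟨v, hli.subset_extend _ rfl⟩, ?_⟩
    exact Module.Basis.extend_apply_self hli _
  rw [← hi, ← MulEquiv.prime_iff (SymmetricAlgebra.equivMvPolynomial B).toMulEquiv]
  change Prime (SymmetricAlgebra.equivMvPolynomial B _)
  rw [SymmetricAlgebra.equivMvPolynomial_ι_apply]
  exact MvPolynomial.X_prime

theorem not_symmetricAlgebra_ι_dvd {v w : M} (h : w ∉ Submodule.span k {v}) :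
    ¬ SymmetricAlgebra.ι k M v ∣ SymmetricAlgebra.ι k M w := by
  obtain ⟨f, hf, hf'⟩ := Submodule.exists_le_ker_of_notMem h
  rintro ⟨z, hz⟩
  have h' := congrArg (SymmetricAlgebra.lift f) hz
  rw [map_mul, SymmetricAlgebra.lift_ι_apply, SymmetricAlgebra.lift_ι_apply,
    show f v = 0 from hf' (Submodule.mem_span_singleton_self v), zero_mul] at h'
  exact hf h'

end SymmetricAlgebra

/-! ### Coroots in the symmetric algebra -/

section Coroots

variable {ι V N : Type*} [Finite ι] [AddCommGroup V] [Module ℝ V] [AddCommGroup N] [Module ℝ N]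
  {P : RootPairing ι ℝ V N} [P.IsRootSystem] [P.IsCrystallographic] [P.IsReduced] {b : P.Base}
  {k : Type*} [Field k]

/-- The pairing with the root `α`, as an integral linear form on the coweight lattice. -/
def latticeRoot (P : RootPairing ι ℝ V N) (i : ι) : coweightLattice P →+ ℤ where
  toFun v := (v.2 i).choose
  map_zero' := by
    apply Int.cast_injective (α := ℝ)
    exact (((0 : coweightLattice P).2 i).choose_spec.symm.trans (map_zero (P.root' i))).trans
      Int.cast_zero.symm
  map_add' v w := by
    apply Int.cast_injective (α := ℝ)
    refine ((v + w).2 i).choose_spec.symm.trans ((map_add (P.root' i) v.1 w.1).trans ?_)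
    rw [Int.cast_add, ← (v.2 i).choose_spec, ← (w.2 i).choose_spec]

theorem latticeRoot_corootInLattice (i : ι) : latticeRoot P i (corootInLattice P i) = 2 := by
  have h : P.root' i (P.coroot i) = _ := ((corootInLattice P i).2 i).choose_spec
  rw [RootPairing.root'_coroot_eq_pairing, P.pairing_same] at h
  exact_mod_cast h.symm

theorem corootK_ne_zero (hk : GKM b k) (i : ι) : corootK P k i ≠ 0 := by
  intro h
  have h' := congrArg (fun z => TensorProduct.rid ℤ k
    ((latticeRoot P i).toIntLinearMap.lTensor k z)) h
  simp only [corootK, LinearMap.lTensor_tmul, map_zero, AddMonoidHom.coe_toIntLinearMap,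
    latticeRoot_corootInLattice, TensorProduct.rid_tmul] at h'
  refine Ring.two_ne_zero hk.1 ?_
  simpa using h'

theorem corootInLattice_reflectionPerm (i j : ι) : corootInLattice P (P.reflectionPerm i j) =
    corootInLattice P j - P.pairingIn ℤ i j • corootInLattice P i := by
  apply Subtype.ext
  rw [AddSubgroupClass.coe_sub, AddSubgroupClass.coe_zsmul]
  change P.coroot _ = P.coroot j - _ • P.coroot i
  rw [P.coroot_reflectionPerm, P.coreflection_apply_coroot, ← Int.cast_smul_eq_zsmul ℝ]
  congr 2
  exact (P.algebraMap_pairingIn ℤ i j).symm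

theorem corootS_reflectionPerm (i j : ι) : corootS P k (P.reflectionPerm i j) =
    corootS P k j - P.pairingIn ℤ i j • corootS P k i := by
  rw [corootS, corootS, corootS, corootK, corootInLattice_reflectionPerm, TensorProduct.tmul_sub,
    TensorProduct.tmul_smul, map_sub, map_zsmul]
  rfl

theorem corootS_reflectionPerm_self (i : ι) :
    corootS P k (P.reflectionPerm i i) = -corootS P k i := by
  have : P.pairingIn ℤ i i = 2 := by
    have := P.algebraMap_pairingIn ℤ i i
    rw [P.pairing_same, algebraMap_int_eq, eq_intCast] at this
    exact_mod_cast this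
  rw [corootS_reflectionPerm, this, two_smul]
  abel

theorem corootS_dvd_reflectionPerm_sub (i j : ι) :
    corootS P k i ∣ corootS P k j - corootS P k (P.reflectionPerm i j) := by
  rw [corootS_reflectionPerm, sub_sub_cancel]
  exact ⟨P.pairingIn ℤ i j, by rw [zsmul_eq_mul, mul_comm]⟩

theorem prime_corootS (hk : GKM b k) (i : ι) : Prime (corootS P k i) :=
  prime_symmetricAlgebra_ι (corootK_ne_zero hk i)

theorem not_corootS_dvd (hk : GKM b k) {i j : ι} (hi : b.IsPos i) (hij : j ≠ i)
    (hij' : j ≠ P.reflectionPerm i i) : ¬ corootS P k i ∣ corootS P k j := by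
  have key : ∀ j, b.IsPos j → j ≠ i → ¬ corootS P k i ∣ corootS P k j := fun j hj hij =>
    not_symmetricAlgebra_ι_dvd (hk.2 j hj i hi hij)
  by_cases hj : b.IsPos j
  · exact key j hj hij
  · have h := key _ ((isPos_reflectionPerm_self_iff b j).2 hj) (by
      intro h
      apply hij'
      apply P.root.injective
      rw [root_reflectionPerm_self, ← h, root_reflectionPerm_self, neg_neg])
    rwa [corootS_reflectionPerm_self, dvd_neg] at h

variable (b k) in
/-- The product of all positive coroots. -/
def corootProd : SymAlg P k := ∏ᶠ i ∈ posRoots b, corootS P k i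

theorem corootS_dvd_corootProd (i : ι) : corootS P k i ∣ corootProd b k := by
  have key : ∀ i, b.IsPos i → corootS P k i ∣ corootProd b k := by
    intro i hi
    rw [corootProd, finprod_mem_eq_finite_toFinset_prod _ (Set.toFinite (posRoots b))]
    exact Finset.dvd_prod_of_mem _ ((Set.Finite.mem_toFinset _).2 hi)
  by_cases hi : b.IsPos i
  · exact key i hi
  · have := key _ ((isPos_reflectionPerm_self_iff b i).2 hi)
    rwa [corootS_reflectionPerm_self, neg_dvd] at this

end Coroots

/-! ### The structure algebra over the symmetric algebra -/

section StructureAlgebraS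

variable {ι V N : Type*} [Finite ι] [AddCommGroup V] [Module ℝ V] [AddCommGroup N] [Module ℝ N]
  {P : RootPairing ι ℝ V N} [P.IsRootSystem] [P.IsCrystallographic] [P.IsReduced] {b : P.Base}
  [TopologicalSpace V] [IsTopologicalAddGroup V] [ContinuousSMul ℝ V] [T2Space V]
  [FiniteDimensional ℝ V] {k : Type*} [Field k]

theorem mem_structureAlgebraS_iff {z : Orbit b → SymAlg P k} : z ∈ structureAlgebraS b k ↔
    ∀ i, b.IsPos i → ∀ A : Alcove b,
      corootS P k i ∣ z (orbitMap b A) - z (orbitMap b (refl b i 0 • A)) :=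
  ⟨fun h i hi A => h i hi A _ rfl, fun h i hi A B hAB => by
    obtain rfl : B = refl b i 0 • A := Subtype.ext hAB
    exact h i hi A⟩

/-- Every tuple of multiples of the product of the positive coroots lies in `𝒵_S`. -/
theorem corootProd_mul_mem (f : Orbit b → SymAlg P k) :
    (fun x => corootProd b k * f x) ∈ structureAlgebraS b k := by
  rw [mem_structureAlgebraS_iff]
  intro i _ A
  exact dvd_sub ((corootS_dvd_corootProd i).mul_right _) ((corootS_dvd_corootProd i).mul_right _)

open Classical in
variable (k) in
/-- The element of `𝒵_S` that is supported on `x`, where it is the product of all positive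
coroots. -/
def pointS (x : Orbit b) : structureAlgebraS b k :=
  ⟨fun y => corootProd b k * if y = x then 1 else 0, corootProd_mul_mem _⟩

variable (k) in
/-- The involution of `𝒵_S` given by the right action of `s`. -/
def swapS (s : affineWeylGroup b) : structureAlgebraS b k →ₐ[SymAlg P k] structureAlgebraS b k where
  toFun z := ⟨fun x => z.1 (orbitMul s x), by
    rw [mem_structureAlgebraS_iff]
    intro i hi A
    rw [orbitMul_orbitMap, orbitMul_orbitMap, rmul_smul]
    exact mem_structureAlgebraS_iff.1 z.2 i hi _⟩
  map_one' := rfl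
  map_mul' _ _ := rfl
  map_zero' := rfl
  map_add' _ _ := rfl
  commutes' _ := rfl

variable {s : affineWeylGroup b} (hs : IsSimpleAffineReflection b s.1)
include hs

/-- The index of the root `α_x`, where `x s` is the image of `x` under the reflection at `α_x`. -/
def orbitWall (x : Orbit b) : ι := wallIndex hs (Quotient.out x)

theorem orbitWall_orbitMap (A : Alcove b) : orbitWall hs (orbitMap b A) = wallIndex hs A :=
  wallIndex_congr hs (Quotient.out_eq (orbitMap b A))

theorem orbitWall_orbitMul (x : Orbit b) :
    orbitWall hs (orbitMul s x) = P.reflectionPerm (orbitWall hs x) (orbitWall hs x) := by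
  obtain ⟨A, rfl⟩ := exists_orbitMap_eq x
  rw [orbitMul_orbitMap, orbitWall_orbitMap, orbitWall_orbitMap, wallIndex_rmul]

variable (k) in
/-- The element `η ∈ 𝒵_S` with `η_x = α_x^∨`. -/
def wallS : structureAlgebraS b k :=
  ⟨fun x => corootS P k (orbitWall hs x), by
    rw [mem_structureAlgebraS_iff]
    intro i hi A
    rw [orbitWall_orbitMap, orbitWall_orbitMap, wallIndex_refl_smul]
    exact corootS_dvd_reflectionPerm_sub i _⟩

theorem orbitMap_refl_wallIndex (A : Alcove b) :
    orbitMap b (refl b (wallIndex hs A) 0 • A) = orbitMap b (rmul s A) := by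
  obtain ⟨n, hn, -⟩ := exists_refl_wallIndex hs A
  rw [← hn]
  have h := translation_root (P := P) (wallIndex hs A) n 0
  have hmem : ((n : ℝ) - (0 : ℤ)) • P.root (wallIndex hs A) ∈ rootLattice P := by
    rw [← Int.cast_sub, Int.cast_smul_eq_zsmul]
    exact zsmul_mem (root_mem_rootLattice _) _
  have h' : transl b ⟨_, hmem⟩ * refl b (wallIndex hs A) 0 = refl b (wallIndex hs A) n :=
    Subtype.ext h
  rw [← h', mul_smul, orbitMap_transl_smul]

/-- The divided difference: `z - z^s` is divisible by `η` in `𝒵_S`. At roots other than `± α_x`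
this holds because the coroots are pairwise non-associated primes. -/
theorem wallS_dvd_sub_swapS (hk : GKM b k) (z : structureAlgebraS b k) :
    ∃ y : structureAlgebraS b k, z - swapS k s z = wallS k hs * y ∧ swapS k s y = y := by
  have : IsDomain (SymAlg P k) := isDomain_symmetricAlgebra
  have hdvd : ∀ x, corootS P k (orbitWall hs x) ∣ z.1 x - z.1 (orbitMul s x) := by
    intro x
    obtain ⟨A, rfl⟩ := exists_orbitMap_eq x
    rw [orbitMul_orbitMap, orbitWall_orbitMap, ← orbitMap_refl_wallIndex hs]
    by_cases hpos : b.IsPos (wallIndex hs A)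
    · exact mem_structureAlgebraS_iff.1 z.2 _ hpos A
    · have := mem_structureAlgebraS_iff.1 z.2 _ ((isPos_reflectionPerm_self_iff b _).2 hpos) A
      rwa [corootS_reflectionPerm_self, neg_dvd, refl_reflectionPerm_self, neg_zero] at this
  choose y hy using hdvd
  have hne : ∀ x, corootS P k (orbitWall hs x) ≠ 0 := fun x => (prime_corootS hk _).ne_zero
  have hys : ∀ x, y (orbitMul s x) = y x := by
    intro x
    have h₁ := hy x
    have h₂ := hy (orbitMul s x)
    rw [orbitMul_orbitMul hs, orbitWall_orbitMul, corootS_reflectionPerm_self] at h₂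
    refine mul_left_cancel₀ (hne x) ?_
    linear_combination h₁ + h₂
  have hmem : y ∈ structureAlgebraS b k := by
    rw [mem_structureAlgebraS_iff]
    intro i hi A
    have hy' : ∀ A, z.1 (orbitMap b A) - z.1 (orbitMap b (rmul s A)) =
        corootS P k (wallIndex hs A) * y (orbitMap b A) := by
      intro A
      have := hy (orbitMap b A)
      rwa [orbitWall_orbitMap] at this
    have heq : ∀ n : ℤ, refl b (wallIndex hs A) n = refl b i 0 →
        corootS P k i ∣ y (orbitMap b A) - y (orbitMap b (refl b i 0 • A)) := by
      intro n hn
      have h1 : orbitMap b (refl b i 0 • A) = orbitMap b (rmul s A) := by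
        rcases affineReflection_eq_imp (congrArg Subtype.val hn) with ⟨h, -⟩ | ⟨h, -⟩
        · rw [← h, orbitMap_refl_wallIndex hs]
        · rw [← orbitMap_refl_wallIndex hs, h, refl_reflectionPerm_self, neg_zero]
      rw [h1, ← orbitMul_orbitMap, hys, sub_self]
      exact dvd_zero _
    by_cases h₁ : wallIndex hs A = i
    · exact heq 0 (by rw [h₁])
    by_cases h₂ : wallIndex hs A = P.reflectionPerm i i
    · exact heq 0 (by rw [h₂, refl_reflectionPerm_self, neg_zero])
    refine ((prime_corootS hk i).dvd_or_dvd ?_).resolve_left (not_corootS_dvd hk hi h₁ h₂)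
    have e₁ := hy' A
    have e₂ := hy' (refl b i 0 • A)
    rw [rmul_smul, wallIndex_refl_smul] at e₂
    have d₁ := mem_structureAlgebraS_iff.1 z.2 i hi A
    have d₂ := mem_structureAlgebraS_iff.1 z.2 i hi (rmul s A)
    have d₃ := (corootS_dvd_reflectionPerm_sub (P := P) (k := k) i (wallIndex hs A)).mul_right
      (y (orbitMap b (refl b i 0 • A)))
    have := dvd_sub (dvd_sub d₁ d₂) d₃
    convert this using 1
    linear_combination e₂ - e₁
  refine ⟨⟨y, hmem⟩, Subtype.ext (funext hy), Subtype.ext (funext hys)⟩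

end StructureAlgebraS

/-! ### The structure algebra over a base ring -/

section StructureAlgebraT

variable {ι V N : Type*} [Finite ι] [AddCommGroup V] [Module ℝ V] [AddCommGroup N] [Module ℝ N]
  {P : RootPairing ι ℝ V N} [P.IsRootSystem] [P.IsCrystallographic] [P.IsReduced] {b : P.Base}
  [TopologicalSpace V] [IsTopologicalAddGroup V] [ContinuousSMul ℝ V] [T2Space V]
  [FiniteDimensional ℝ V] {k T : Type*} [Field k] [CommRing T] [Algebra (SymAlg P k) T]

theorem coord_tmul (x : Orbit b) (t : T) (z : structureAlgebraS b k) :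
    coord b k T x (t ⊗ₜ z) = t * algebraMap (SymAlg P k) T (z.1 x) :=
  rfl

/-- By flatness of `T`, the coordinates embed `𝒵` into a product of copies of `T`. -/
theorem coord_ext (hT : Module.Flat (SymAlg P k) T) {z w : StructureAlgebra b k T}
    (h : ∀ x, coord b k T x z = coord b k T x w) : z = w := by
  classical
  cases nonempty_fintype (Orbit b)
  have hinj := Module.Flat.lTensor_preserves_injective_linearMap (M := T)
    (structureAlgebraS b k).val.toLinearMap Subtype.val_injective
  apply hinj
  apply (TensorProduct.piScalarRight (SymAlg P k) (SymAlg P k) T (Orbit b)).injective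
  funext x
  have key : ∀ z : StructureAlgebra b k T,
      TensorProduct.piScalarRight (SymAlg P k) (SymAlg P k) T (Orbit b)
        ((structureAlgebraS b k).val.toLinearMap.lTensor T z) x = coord b k T x z := by
    intro z
    induction z using TensorProduct.induction_on with
    | zero => simp only [map_zero, Pi.zero_apply]
    | tmul t z =>
      rw [coord_tmul, LinearMap.lTensor_tmul, TensorProduct.piScalarRight_apply,
        TensorProduct.piScalarRightHom_tmul, mul_comm]
      exact Algebra.smul_def (z.1 x) t
    | add z w hz hw => rw [map_add, map_add, map_add, Pi.add_apply, hz, hw]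
  rw [key, key, h x]

variable (b k T) in
/-- The image of the product of all positive coroots in `T`. -/
def corootProdT : T := algebraMap (SymAlg P k) T (corootProd b k)

variable (b k T) in
/-- The multiplicative set generated by the positive coroots. -/
abbrev corootMonoid : Submonoid T := Submonoid.closure (corootT P k T '' posRoots b)

theorem corootProdT_mem : corootProdT b k T ∈ corootMonoid b k T := by
  rw [corootProdT, corootProd, finprod_mem_eq_finite_toFinset_prod _ (Set.toFinite (posRoots b)),
    map_prod]
  refine prod_mem fun i hi => Submonoid.subset_closure ⟨i, ?_, rfl⟩
  exact (Set.Finite.mem_toFinset _).1 hi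

variable (k T) in
/-- The element of `𝒵` that is supported on `x`, where it is the product of all positive
coroots. It replaces the idempotent at `x`, which exists only after inverting the coroots. -/
def point (x : Orbit b) : StructureAlgebra b k T := 1 ⊗ₜ pointS k x

theorem coord_point_self (x : Orbit b) : coord b k T x (point k T x) = corootProdT b k T := by
  rw [point, coord_tmul, one_mul, pointS, corootProdT]
  simp

theorem coord_point_of_ne {x y : Orbit b} (h : y ≠ x) : coord b k T y (point k T x) = 0 := by
  rw [point, coord_tmul, one_mul, pointS]
  simp [h]

theorem point_mul_eq_zero (hT : Module.Flat (SymAlg P k) T) {x : Orbit b}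
    {z : StructureAlgebra b k T} (h : coord b k T x z = 0) : point k T x * z = 0 := by
  refine coord_ext hT fun y => ?_
  rw [map_mul, map_zero]
  by_cases hy : y = x
  · rw [hy, h, mul_zero]
  · rw [coord_point_of_ne hy, zero_mul]

variable (k T) in
/-- The involution of `𝒵` given by the right action of `s`. -/
def swap (s : affineWeylGroup b) : StructureAlgebra b k T →ₐ[T] StructureAlgebra b k T :=
  Algebra.TensorProduct.map (AlgHom.id T T) (swapS k s)

theorem swap_tmul (s : affineWeylGroup b) (t : T) (z : structureAlgebraS b k) :
    swap k T s (t ⊗ₜ z) = t ⊗ₜ swapS k s z := rfl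

theorem coord_swap (s : affineWeylGroup b) (x : Orbit b) (z : StructureAlgebra b k T) :
    coord b k T x (swap k T s z) = coord b k T (orbitMul s x) z := by
  induction z using TensorProduct.induction_on with
  | zero => simp only [map_zero]
  | tmul t z => rfl
  | add z w hz hw => rw [map_add, map_add, map_add, hz, hw]

theorem mem_invariants_iff (hT : Module.Flat (SymAlg P k) T) {s : affineWeylGroup b}
    {z : StructureAlgebra b k T} : z ∈ invariants b k T s.1 ↔ swap k T s z = z := by
  constructor
  · intro h
    refine coord_ext hT fun x => ?_
    obtain ⟨A, rfl⟩ := exists_orbitMap_eq x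
    rw [coord_swap]
    exact (h A _ (isRightMul_iff.2 rfl)).symm
  · intro h A B hAB
    rw [isRightMul_iff.1 hAB, ← orbitMul_orbitMap, ← coord_swap, h]

variable {s : affineWeylGroup b} (hs : IsSimpleAffineReflection b s.1)
include hs

theorem swap_point (hT : Module.Flat (SymAlg P k) T) (x : Orbit b) :
    swap k T s (point k T x) = point k T (orbitMul s x) := by
  refine coord_ext hT fun y => ?_
  rw [coord_swap]
  by_cases h : y = orbitMul s x
  · rw [h, orbitMul_orbitMul hs, coord_point_self, coord_point_self]
  · rw [coord_point_of_ne h, coord_point_of_ne]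
    rintro rfl
    rw [orbitMul_orbitMul hs] at h
    exact h rfl

variable (k T) in
/-- The element `η ∈ 𝒵` with `η_x = α_x^∨`. -/
def wall : StructureAlgebra b k T := 1 ⊗ₜ wallS k hs

theorem swapS_wallS : swapS k s (wallS k hs) = -wallS k hs := by
  apply Subtype.ext
  funext x
  change corootS P k (orbitWall hs (orbitMul s x)) = -corootS P k (orbitWall hs x)
  rw [orbitWall_orbitMul, corootS_reflectionPerm_self]

theorem swap_wall : swap k T s (wall k T hs) = -wall k T hs := by
  rw [wall, swap_tmul, swapS_wallS, TensorProduct.tmul_neg]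

/-- The square of the product of the positive coroots is a multiple of `η`. -/
theorem exists_mul_wall_eq : ∃ z : StructureAlgebra b k T,
    z * wall k T hs =
      algebraMap T (StructureAlgebra b k T) (corootProdT b k T * corootProdT b k T) := by
  choose q hq using fun x : Orbit b => corootS_dvd_corootProd (b := b) (k := k) (orbitWall hs x)
  refine ⟨1 ⊗ₜ ⟨_, corootProd_mul_mem q⟩, ?_⟩
  have h : (⟨_, corootProd_mul_mem q⟩ : structureAlgebraS b k) * wallS k hs =
      algebraMap (SymAlg P k) _ (corootProd b k * corootProd b k) := by
    apply Subtype.ext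
    funext x
    change corootProd b k * q x * corootS P k (orbitWall hs x) = corootProd b k * corootProd b k
    rw [mul_assoc, mul_comm (q x), ← hq]
  rw [wall, Algebra.TensorProduct.tmul_mul_tmul, h, one_mul, corootProdT, ← map_mul,
    Algebra.algebraMap_eq_smul_one, TensorProduct.tmul_smul, TensorProduct.smul_tmul',
    Algebra.smul_def, mul_one]
  rfl

/-- The decomposition `𝒵 = 𝒵^s + η 𝒵^s`. -/
theorem exists_eq_add_wall_mul (hk : GKM b k) (hT : Module.Flat (SymAlg P k) T)
    (z : StructureAlgebra b k T) :
    ∃ x ∈ invariants b k T s.1, ∃ y ∈ invariants b k T s.1, z = x + wall k T hs * y := by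
  induction z using TensorProduct.induction_on with
  | zero => exact ⟨0, zero_mem _, 0, zero_mem _, by simp⟩
  | tmul t z =>
    obtain ⟨y, hy, hys⟩ := wallS_dvd_sub_swapS hs hk z
    have h2 : (2 : k) ≠ 0 := Ring.two_ne_zero hk.1
    have hss : swapS k s (swapS k s z) = z := by
      apply Subtype.ext
      funext x
      exact congrArg z.1 (orbitMul_orbitMul hs x)
    set c : SymAlg P k := algebraMap k _ (2⁻¹ : k) with hc
    have hc2 : c * 2 = 1 := by
      rw [hc, ← map_ofNat (algebraMap k (SymAlg P k)) 2, ← map_mul, inv_mul_cancel₀ h2, map_one]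
    have hz : z = c • (z + swapS k s z) + wallS k hs * c • y := by
      rw [mul_smul_comm, ← hy, ← smul_add]
      have : z + swapS k s z + (z - swapS k s z) = (2 : SymAlg P k) • z := by
        rw [two_smul]
        abel
      rw [this, smul_smul, hc2, one_smul]
    refine ⟨t ⊗ₜ (c • (z + swapS k s z)), ?_, t ⊗ₜ (c • y), ?_, ?_⟩
    · rw [mem_invariants_iff hT, swap_tmul, map_smul, map_add, hss, add_comm]
    · rw [mem_invariants_iff hT, swap_tmul, map_smul, hys]
    · rw [wall, Algebra.TensorProduct.tmul_mul_tmul, one_mul, ← TensorProduct.tmul_add, ← hz]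
  | add z w hz hw =>
    obtain ⟨x, hx, y, hy, rfl⟩ := hz
    obtain ⟨x', hx', y', hy', rfl⟩ := hw
    exact ⟨x + x', add_mem hx hx', y + y', add_mem hy hy', by ring⟩

omit hs in
variable (T) in
/-- Two is invertible in the base ring. -/
theorem exists_add_self_eq_one (hk : GKM b k) : ∃ c : T, c + c = 1 := by
  have h2 : (2 : k) ≠ 0 := Ring.two_ne_zero hk.1
  refine ⟨algebraMap (SymAlg P k) T (algebraMap k _ (2⁻¹ : k)), ?_⟩
  rw [← map_add, ← map_add, ← two_mul, mul_inv_cancel₀ h2, map_one, map_one]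

end StructureAlgebraT

/-! ### Extension of scalars along a quadratic extension -/

section ScalarExtension

open ModuleCat

variable {R S : Type u} [CommRing R] [CommRing S] (f : R →+* S)

/-- The element `z ⊗ m` of `S ⊗_R M`. -/
def extTmul (M : ModuleCat.{u} S) (z : S) (m : M) :
    (restrictScalars f ⋙ extendScalars f).obj M :=
  TensorProduct.tmul R (M := (restrictScalars f).obj (ModuleCat.of S S))
    (N := (restrictScalars f).obj M) z m

variable {f} {M M' : ModuleCat.{u} S}

theorem extTmul_add (z : S) (m m' : M) :
    extTmul f M z (m + m') = extTmul f M z m + extTmul f M z m' :=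
  TensorProduct.tmul_add _ _ _

theorem add_extTmul (z w : S) (m : M) :
    extTmul f M (z + w) m = extTmul f M z m + extTmul f M w m :=
  TensorProduct.add_tmul _ _ _

theorem smul_extTmul (z w : S) (m : M) : z • extTmul f M w m = extTmul f M (z * w) m :=
  ExtendScalars.smul_tmul f z w _

theorem extTmul_mul (z : S) (r : R) (m : M) :
    extTmul f M (z * f r) m = extTmul f M z (f r • m) := by
  rw [mul_comm]
  exact TensorProduct.smul_tmul (R := R) (M := (restrictScalars f).obj (ModuleCat.of S S))
    (N := (restrictScalars f).obj M) r z m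

theorem map_extTmul (g : M ⟶ M') (z : S) (m : M) :
    (restrictScalars f ⋙ extendScalars f).map g (extTmul f M z m) = extTmul f M' z (g m) := rfl

theorem extTmul_induction {p : (restrictScalars f ⋙ extendScalars f).obj M → Prop} (h0 : p 0)
    (h1 : ∀ z m, p (extTmul f M z m)) (h2 : ∀ x y, p x → p y → p (x + y))
    (n : (restrictScalars f ⋙ extendScalars f).obj M) : p n :=
  TensorProduct.induction_on n h0 h1 h2

variable (f M) in
/-- The additive map `S ⊗_R M → M`, `z ⊗ m ↦ τ(z) m`, for a ring endomorphism `τ` of `S` over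
`R`. -/
def extTwist (τ : S →+* S) (hτ : ∀ r, τ (f r) = f r) :
    (restrictScalars f ⋙ extendScalars f).obj M →+ M :=
  TensorProduct.liftAddHom (R := R) (M := (restrictScalars f).obj (ModuleCat.of S S))
    (N := (restrictScalars f).obj M)
    (AddMonoidHom.mk' (fun z : S => AddMonoidHom.mk' (fun m : M => τ z • m)
        fun m m' => smul_add _ m m')
      fun (z w : S) => by
        ext m
        exact (congrArg (· • (show M from m)) (map_add τ z w)).trans (add_smul _ _ _))
    fun r (z : S) (m : M) => by
      change τ (f r * z) • m = τ z • f r • m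
      rw [map_mul, hτ r, mul_comm, mul_smul]

variable (τ : S →+* S) (hτ : ∀ r, τ (f r) = f r)

theorem extTwist_extTmul (z : S) (m : M) : extTwist f M τ hτ (extTmul f M z m) = τ z • m := rfl

theorem extTwist_smul (z : S) (n : (restrictScalars f ⋙ extendScalars f).obj M) :
    extTwist f M τ hτ (z • n) = τ z • extTwist f M τ hτ n := by
  induction n using extTmul_induction with
  | h0 => rw [smul_zero, map_zero, smul_zero]
  | h1 w m => rw [smul_extTmul, extTwist_extTmul, extTwist_extTmul, map_mul, mul_smul]
  | h2 x y hx hy => rw [smul_add, map_add, map_add, smul_add, hx, hy]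

theorem extTwist_naturality (g : M ⟶ M') (n : (restrictScalars f ⋙ extendScalars f).obj M) :
    extTwist f M' τ hτ ((restrictScalars f ⋙ extendScalars f).map g n) =
      g (extTwist f M τ hτ n) := by
  induction n using extTmul_induction with
  | h0 => rw [map_zero, map_zero, map_zero, map_zero]
  | h1 w m => rw [map_extTmul, extTwist_extTmul, extTwist_extTmul, map_smul]
  | h2 x y hx hy => rw [map_add, map_add, map_add, map_add, hx, hy]

variable (f M) in
/-- The additive map `m ↦ 1 ⊗ m` from `M` to `S ⊗_R M`. -/
def oneTmul : M →+ (restrictScalars f ⋙ extendScalars f).obj M :=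
  AddMonoidHom.mk' (extTmul f M 1) (extTmul_add 1)

/-- If `S = R + η R`, then `S ⊗_R M = 1 ⊗ M + η (1 ⊗ M)`. -/
theorem exists_eq_oneTmul_add {η : S} (h : ∀ z : S, ∃ r r' : R, z = f r + η * f r')
    (n : (restrictScalars f ⋙ extendScalars f).obj M) :
    ∃ m m' : M, n = oneTmul f M m + η • oneTmul f M m' := by
  induction n using extTmul_induction with
  | h0 => exact ⟨0, 0, by rw [map_zero, smul_zero, add_zero]⟩
  | h1 w m =>
    obtain ⟨r, r', hw⟩ := h w
    refine ⟨f r • m, f r' • m, ?_⟩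
    change _ = extTmul f M 1 _ + η • extTmul f M 1 _
    rw [smul_extTmul, mul_one, ← extTmul_mul, ← extTmul_mul, one_mul, ← add_extTmul, hw]
  | h2 x y hx hy =>
    obtain ⟨m, m', rfl⟩ := hx
    obtain ⟨l, l', rfl⟩ := hy
    refine ⟨m + l, m' + l', ?_⟩
    rw [map_add, map_add, smul_add]
    exact add_add_add_comm _ _ _ _

theorem extTwist_oneTmul (m : M) : extTwist f M τ hτ (oneTmul f M m) = m := by
  change τ 1 • m = m
  rw [map_one, one_smul]

theorem map_oneTmul (g : M ⟶ M') (m : M) :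
    (restrictScalars f ⋙ extendScalars f).map g (oneTmul f M m) = oneTmul f M' (g m) := rfl

/-- A presentation of an endofunctor `E` of the category of `S`-modules as a quadratic extension of
scalars `M ↦ S ⊗_R M`, where `S = R + η R` and `τ` is an involution of `S` over `R`: it consists of
the maps `m ↦ 1 ⊗ m`, `z ⊗ m ↦ z m` and `z ⊗ m ↦ τ(z) m` with their formal properties. -/
structure QuadraticExtension {S : Type u} [Ring S] (E : ModuleCat.{u} S ⥤ ModuleCat.{u} S)
    (η : S) (τ : S →+* S) where
  /-- The map `m ↦ 1 ⊗ m`. -/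
  one (M : ModuleCat.{u} S) : M →+ E.obj M
  /-- The map `z ⊗ m ↦ z m`. -/
  fst (M : ModuleCat.{u} S) : E.obj M →+ M
  /-- The map `z ⊗ m ↦ τ(z) m`. -/
  snd (M : ModuleCat.{u} S) : E.obj M →+ M
  fst_one {M : ModuleCat.{u} S} (m : M) : fst M (one M m) = m
  snd_one {M : ModuleCat.{u} S} (m : M) : snd M (one M m) = m
  fst_smul {M : ModuleCat.{u} S} (z : S) (n : E.obj M) : fst M (z • n) = z • fst M n
  snd_smul {M : ModuleCat.{u} S} (z : S) (n : E.obj M) : snd M (z • n) = τ z • snd M n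
  map_one {M M' : ModuleCat.{u} S} (g : M ⟶ M') (m : M) : E.map g (one M m) = one M' (g m)
  fst_map {M M' : ModuleCat.{u} S} (g : M ⟶ M') (n : E.obj M) :
    fst M' (E.map g n) = g (fst M n)
  snd_map {M M' : ModuleCat.{u} S} (g : M ⟶ M') (n : E.obj M) :
    snd M' (E.map g n) = g (snd M n)
  exists_eq {M : ModuleCat.{u} S} (n : E.obj M) : ∃ m m' : M, n = one M m + η • one M m'

namespace QuadraticExtension

variable {S : Type u} [Ring S] {E : ModuleCat.{u} S ⥤ ModuleCat.{u} S} {η : S} {τ : S →+* S}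
  (Q : QuadraticExtension E η τ) {M M' : ModuleCat.{u} S}
include Q

/-- If `τ(η) = -η`, and if `2` and `η` act injectively on `M`, then `z ⊗ m ↦ z m` and
`z ⊗ m ↦ τ(z) m` are jointly injective: they send `1 ⊗ m + η ⊗ m'` to `m + η m'` and
`m - η m'`. -/
theorem eq_zero_of_fst_of_snd (hη : τ η = -η) (h : ∀ m : M, m + m = 0 → m = 0)
    (h' : ∀ m : M, η • m = 0 → m = 0) {n : E.obj M} (h₁ : Q.fst M n = 0)
    (h₂ : Q.snd M n = 0) : n = 0 := by
  obtain ⟨m, m', rfl⟩ := Q.exists_eq n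
  rw [map_add, Q.fst_smul, Q.fst_one, Q.fst_one] at h₁
  rw [map_add, Q.snd_smul, Q.snd_one, Q.snd_one, hη, neg_smul] at h₂
  have hm : m = 0 := h m <| by
    calc m + m = (m + η • m') + (m + -(η • m')) := by abel
      _ = 0 := by rw [h₁, h₂, add_zero]
  rw [hm, zero_add] at h₁
  rw [hm, h' m' h₁, map_zero, smul_zero, add_zero]

theorem map_surjective {g : M ⟶ M'} (hg : Function.Surjective g) :
    Function.Surjective (E.map g) := by
  intro n
  obtain ⟨m, m', rfl⟩ := Q.exists_eq n
  obtain ⟨m, rfl⟩ := hg m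
  obtain ⟨m', rfl⟩ := hg m'
  refine ⟨Q.one M m + η • Q.one M m', ?_⟩
  rw [map_add, map_smul, Q.map_one, Q.map_one]

end QuadraticExtension

/-- Extension of scalars along `f : R → S`, where `S = R + η R`. The homomorphism `f` occurs twice
to allow for different presentations of it. -/
def quadraticExtension (f f' : R →+* S) (hf : f = f') {η : S}
    (h : ∀ z : S, ∃ r r' : R, z = f r + η * f r') (τ : S →+* S) (hτ : ∀ r, τ (f r) = f r) :
    QuadraticExtension (restrictScalars f ⋙ extendScalars f') η τ := by
  subst hf
  exact
    { one := oneTmul f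
      fst := fun M => extTwist f M (RingHom.id S) fun _ => rfl
      snd := fun M => extTwist f M τ hτ
      fst_one := extTwist_oneTmul _ _
      snd_one := extTwist_oneTmul _ _
      fst_smul := extTwist_smul _ _
      snd_smul := extTwist_smul _ _
      map_one := map_oneTmul
      fst_map := extTwist_naturality _ _
      snd_map := extTwist_naturality _ _
      exists_eq := exists_eq_oneTmul_add h }

end ScalarExtension

section Induce

variable {ι : Type*} {V N k T : Type u} [AddCommGroup V] [Module ℝ V] [AddCommGroup N]
  [Module ℝ N] [TopologicalSpace V] {P : RootPairing ι ℝ V N} [P.IsCrystallographic] {b : P.Base}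
  [Field k] [CommRing T] [Algebra (SymAlg P k) T]

/-- The functor `M ↦ 𝒵 ⊗_{𝒵^s} M` as a quadratic extension of scalars. -/
def induceQuadratic (s : V ≃ᵃ[ℝ] V) {η : StructureAlgebra b k T}
    (h : ∀ z, ∃ x ∈ invariants b k T s, ∃ y ∈ invariants b k T s, z = x + η * y)
    (τ : StructureAlgebra b k T →+* StructureAlgebra b k T)
    (hτ : ∀ z ∈ invariants b k T s, τ z = z) :
    QuadraticExtension (induce s) η τ := by
  unfold induce
  refine @quadraticExtension (invariants b k T s) (StructureAlgebra b k T) inferInstance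
    inferInstance _ _ ?_ η ?_ τ ?_
  · exact RingHom.ext fun _ => rfl
  · intro z
    obtain ⟨x, hx, y, hy, h⟩ := h z
    exact ⟨⟨x, hx⟩, ⟨y, hy⟩, h⟩
  · exact fun r => hτ r.1 r.2

end Induce

/-! ### Root torsion free modules and their stalks -/

section Stalks

variable {ι : Type*} [Finite ι] {V N k T : Type u} [AddCommGroup V] [Module ℝ V]
  [AddCommGroup N] [Module ℝ N] {P : RootPairing ι ℝ V N} [P.IsRootSystem] [P.IsCrystallographic]
  [P.IsReduced] {b : P.Base} [TopologicalSpace V] [IsTopologicalAddGroup V] [ContinuousSMul ℝ V]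
  [T2Space V] [FiniteDimensional ℝ V] [Field k] [CommRing T] [Algebra (SymAlg P k) T]
  {M M' : ModuleCat.{u} (StructureAlgebra b k T)}

theorem RootTorsionFree.eq_zero (hM : RootTorsionFree M) {d : T} (hd : d ∈ corootMonoid b k T)
    {m : M} (h : algebraMap T (StructureAlgebra b k T) d • m = 0) : m = 0 := by
  induction hd using Submonoid.closure_induction generalizing m with
  | mem d hd =>
    obtain ⟨i, hi, rfl⟩ := hd
    exact hM i hi (h.trans (smul_zero _).symm)
  | one => rwa [map_one, one_smul] at h
  | mul d e _ _ hd he =>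
    rw [map_mul, mul_smul] at h
    exact he (hd h)

/-- An element vanishes in the stalk at `x` if and only if a product of coroots kills its component
at `x`. -/
theorem mem_stalkKer_iff (hT : Module.Flat (SymAlg P k) T) {x : Orbit b} {m : M} :
    m ∈ stalkKer x M ↔ ∃ d ∈ corootMonoid b k T,
      algebraMap T (StructureAlgebra b k T) d • point k T x • m = 0 := by
  constructor
  · rintro ⟨d, hd, h⟩
    refine ⟨d, hd, ?_⟩
    rw [smul_comm]
    refine Submodule.smul_induction_on (p := fun n => point k T x • n = 0) h ?_ ?_
    · intro z hz n _
      rw [smul_smul, point_mul_eq_zero hT hz]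
      exact zero_smul (StructureAlgebra b k T) n
    · intro n n' hn hn'
      rw [smul_add, hn, hn', add_zero]
  · rintro ⟨d, hd, h⟩
    refine ⟨corootProdT b k T * d, mul_mem corootProdT_mem hd, ?_⟩
    have e : algebraMap T (StructureAlgebra b k T) (corootProdT b k T * d) • m =
        (algebraMap T (StructureAlgebra b k T) (corootProdT b k T) - point k T x) •
          algebraMap T (StructureAlgebra b k T) d • m := by
      rw [sub_smul, smul_comm (point k T x), h, sub_zero, map_mul, mul_smul]
    rw [e]
    refine Submodule.smul_mem_smul ?_ trivial
    rw [RingHom.mem_ker, map_sub, coord_point_self, AlgHom.commutes]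
    exact sub_self _

theorem RootTorsionFree.mem_stalkKer_iff (hT : Module.Flat (SymAlg P k) T)
    (hM : RootTorsionFree M) {x : Orbit b} {m : M} :
    m ∈ stalkKer x M ↔ point k T x • m = 0 := by
  rw [AlcoveSheaves.mem_stalkKer_iff hT]
  constructor
  · rintro ⟨d, hd, h⟩
    exact hM.eq_zero hd h
  · intro h
    exact ⟨1, one_mem _, by rw [h, smul_zero]⟩

/-- The components of `1` at the orbits add up to the product of the coroots. -/
theorem sum_point [Fintype (Orbit b)] (hT : Module.Flat (SymAlg P k) T) :
    ∑ x : Orbit b, point k T x = algebraMap T (StructureAlgebra b k T) (corootProdT b k T) := by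
  refine coord_ext hT fun y => ?_
  rw [map_sum, AlgHom.commutes, Finset.sum_eq_single y, coord_point_self]
  · rfl
  · exact fun x _ hx => coord_point_of_ne hx.symm
  · exact fun h => absurd (Finset.mem_univ _) h

/-- An element of a root torsion free module vanishes if all its components do. -/
theorem RootTorsionFree.eq_zero_of_point_smul (hT : Module.Flat (SymAlg P k) T)
    (hM : RootTorsionFree M) {m : M} (h : ∀ x : Orbit b, point k T x • m = 0) : m = 0 := by
  cases nonempty_fintype (Orbit b)
  refine hM.eq_zero corootProdT_mem ?_
  rw [← sum_point (b := b) (k := k) hT, Finset.sum_smul]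
  exact Finset.sum_eq_zero fun x _ => h x

/-- Components at different orbits are orthogonal. -/
theorem point_smul_point_smul_of_ne (hT : Module.Flat (SymAlg P k) T) {x y : Orbit b}
    (h : y ≠ x) (m : M) : point k T x • point k T y • m = 0 := by
  rw [smul_smul, point_mul_eq_zero hT (coord_point_of_ne h.symm)]
  exact zero_smul (StructureAlgebra b k T) m

end Stalks

/-! ### The modules `𝒵 ⊗_{𝒵^s} M` -/

section Induction

variable {ι : Type*} [Finite ι] {V N k T : Type u} [AddCommGroup V] [Module ℝ V]
  [AddCommGroup N] [Module ℝ N] {P : RootPairing ι ℝ V N} [P.IsRootSystem] [P.IsCrystallographic]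
  [P.IsReduced] {b : P.Base} [TopologicalSpace V] [IsTopologicalAddGroup V] [ContinuousSMul ℝ V]
  [T2Space V] [FiniteDimensional ℝ V] [Field k] [CommRing T] [Algebra (SymAlg P k) T]
  {M M' : ModuleCat.{u} (StructureAlgebra b k T)}
  {s : affineWeylGroup b} (hs : IsSimpleAffineReflection b s.1) (hk : GKM b k)
  (hT : Module.Flat (SymAlg P k) T)

/-- The functor `M ↦ 𝒵 ⊗_{𝒵^s} M`, with `𝒵 = 𝒵^s + η 𝒵^s` and the involution given by `s`. -/
def wallExtension : QuadraticExtension (induce (b := b) (k := k) (T := T) s.1) (wall k T hs)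
    (swap k T s).toRingHom :=
  induceQuadratic s.1 (exists_eq_add_wall_mul hs hk hT) (swap k T s).toRingHom
    fun _ hz => (mem_invariants_iff hT).1 hz

theorem RootTorsionFree.wall_smul (hM : RootTorsionFree M) {m : M}
    (h : wall k T hs • m = 0) : m = 0 := by
  obtain ⟨z, hz⟩ := exists_mul_wall_eq (k := k) (T := T) hs
  refine hM.eq_zero (mul_mem corootProdT_mem corootProdT_mem) ?_
  rw [← hz, mul_smul, h, smul_zero]

theorem add_self_eq_zero (hk : GKM b k) {m : M} (h : m + m = 0) : m = 0 := by
  obtain ⟨c, hc⟩ := exists_add_self_eq_one (b := b) T hk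
  have := congrArg (fun n : M => algebraMap T (StructureAlgebra b k T) c • n) h
  rwa [smul_zero, smul_add, ← add_smul, ← map_add, hc, map_one, one_smul] at this

theorem eq_zero_of_fst_of_snd (hM : RootTorsionFree M) {n : (induce s.1).obj M}
    (h₁ : (wallExtension hs hk hT).fst M n = 0) (h₂ : (wallExtension hs hk hT).snd M n = 0) :
    n = 0 :=
  (wallExtension hs hk hT).eq_zero_of_fst_of_snd (swap_wall hs) (fun _ => add_self_eq_zero hk)
    (fun _ => hM.wall_smul hs) h₁ h₂

theorem snd_algebraMap_smul (d : T) (n : (induce s.1).obj M) :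
    (wallExtension hs hk hT).snd M (algebraMap T (StructureAlgebra b k T) d • n) =
      algebraMap T (StructureAlgebra b k T) d • (wallExtension hs hk hT).snd M n :=
  ((wallExtension hs hk hT).snd_smul _ n).trans
    (congrArg (· • (wallExtension hs hk hT).snd M n) ((swap k T s).commutes d))

theorem snd_point_smul (x : Orbit b) (n : (induce s.1).obj M) :
    (wallExtension hs hk hT).snd M (point k T x • n) =
      point k T (orbitMul s x) • (wallExtension hs hk hT).snd M n :=
  ((wallExtension hs hk hT).snd_smul _ n).trans
    (congrArg (· • (wallExtension hs hk hT).snd M n) (swap_point hs hT x))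

include hs hk hT in
theorem RootTorsionFree.induce (hM : RootTorsionFree M) :
    RootTorsionFree ((induce s.1).obj M) := by
  intro i hi n n' h
  have hd : corootT P k T i ∈ corootMonoid b k T := Submonoid.subset_closure ⟨i, hi, rfl⟩
  have h0 : algebraMap T (StructureAlgebra b k T) (corootT P k T i) • (n - n') = 0 := by
    rw [smul_sub]
    exact sub_eq_zero.2 h
  refine sub_eq_zero.1 (eq_zero_of_fst_of_snd hs hk hT hM ?_ ?_)
  · refine hM.eq_zero hd ?_
    rw [← (wallExtension hs hk hT).fst_smul, h0, map_zero]
  · refine hM.eq_zero hd ?_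
    rw [← snd_algebraMap_smul, h0, map_zero]

theorem point_smul_eq_zero_iff (hM : RootTorsionFree M) {x : Orbit b} {n : (induce s.1).obj M} :
    point k T x • n = 0 ↔ point k T x • (wallExtension hs hk hT).fst M n = 0 ∧
      point k T (orbitMul s x) • (wallExtension hs hk hT).snd M n = 0 := by
  rw [← (wallExtension hs hk hT).fst_smul, ← snd_point_smul]
  constructor
  · intro h
    rw [h, map_zero, map_zero]
    exact ⟨rfl, rfl⟩
  · exact fun h => eq_zero_of_fst_of_snd hs hk hT hM h.1 h.2

include hs hk hT in
theorem induce_map_surjective {g : M ⟶ M'} (hg : Function.Surjective g) :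
    Function.Surjective ((induce s.1).map g) :=
  (wallExtension hs hk hT).map_surjective hg

end Induction

/-! ### Presheaves of root torsion free modules -/

section Presheaves

variable {ι : Type*} [Finite ι] {V N k T : Type u} [AddCommGroup V] [Module ℝ V]
  [AddCommGroup N] [Module ℝ N] {P : RootPairing ι ℝ V N} [P.IsRootSystem] [P.IsCrystallographic]
  [P.IsReduced] {b : P.Base} [TopologicalSpace V] [IsTopologicalAddGroup V] [ContinuousSMul ℝ V]
  [T2Space V] [FiniteDimensional ℝ V] [Field k] [CommRing T] [Algebra (SymAlg P k) T]
  {M : Psh b k T} {U W X : Opens (AlcoveSpace b k T)}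

theorem res_self (m : M.obj (op U)) (h : U ≤ U) : res M h m = m :=
  congrArg (fun g => g.hom m) (M.map_id (op U))

theorem res_res (h : U ≤ W) (h' : W ≤ X) (m : M.obj (op X)) :
    res M h (res M h' m) = res M (h.trans h') m :=
  (congrArg (fun g => g.hom m) (M.map_comp (homOfLE h').op (homOfLE h).op)).symm

theorem eq_zero_of_res_eq_zero (h : U ≤ W) (h' : W ≤ U) {m : M.obj (op W)}
    (hm : res M h m = 0) : m = 0 := by
  rw [← res_self m le_rfl, ← res_res h' h m, hm, map_zero]

theorem point_smul_res_eq_zero (h : U ≤ W) {x : Orbit b} {m : M.obj (op W)}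
    (hm : point k T x • m = 0) : point k T x • res M h m = 0 := by
  rw [← map_smul, hm, map_zero]

theorem isIso_of_surjective {M M' : ModuleCat.{u} (StructureAlgebra b k T)} {f : M ⟶ M'}
    (hf : Function.Surjective f) (h : ∀ m, f m = 0 → m = 0) : IsIso f :=
  (ConcreteCategory.isIso_iff_bijective f).2 ⟨(injective_iff_map_eq_zero f.hom).2 h, hf⟩

theorem eq_zero_of_isIso {M M' : ModuleCat.{u} (StructureAlgebra b k T)} (f : M ⟶ M') [IsIso f]
    {m : M} (h : f m = 0) : m = 0 :=
  ((ConcreteCategory.isIso_iff_bijective f).1 inferInstance).1 (h.trans (map_zero f.hom).symm)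

/-- For a flabby presheaf of root torsion free modules, the support condition says that the
component at `x` of a section over `𝒥` vanishes if it vanishes over `(𝒥 ∩ x)_⪯`. -/
theorem supportCondition_iff (hT : Module.Flat (SymAlg P k) T) (hM : IsFlabby M)
    (hM' : ∀ U, RootTorsionFree (M.obj U)) : SupportCondition M ↔
      ∀ (x : Orbit b) (U : Opens (AlcoveSpace b k T)) (m : M.obj (op U)),
        point k T x • res M (orbitHull_le x U) m = 0 → point k T x • m = 0 := by
  constructor
  · intro h x U m hm
    have := h x U
    rw [← (hM' _).mem_stalkKer_iff hT] at hm ⊢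
    rw [← Submodule.Quotient.mk_eq_zero]
    refine eq_zero_of_isIso ((stalk x).map (res M (orbitHull_le x U))) ?_
    exact (Submodule.Quotient.mk_eq_zero _).2 hm
  · intro h x U
    refine isIso_of_surjective ?_ ?_
    · intro n
      obtain ⟨n, rfl⟩ := Submodule.Quotient.mk_surjective _ n
      obtain ⟨m, rfl⟩ := hM (orbitHull_le x U) n
      exact ⟨Submodule.Quotient.mk m, rfl⟩
    · intro n hn
      obtain ⟨m, rfl⟩ := Submodule.Quotient.mk_surjective _ n
      refine (Submodule.Quotient.mk_eq_zero _).2 ?_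
      rw [(hM' _).mem_stalkKer_iff hT]
      refine h x U m ?_
      rw [← (hM' _).mem_stalkKer_iff hT]
      exact (Submodule.Quotient.mk_eq_zero _).1 hn

theorem mem_plusKer_iff (hT : Module.Flat (SymAlg P k) T)
    (hM : ∀ U, RootTorsionFree (M.obj U)) {m : M.obj (op U)} : m ∈ plusKer M U ↔
      ∀ x : Orbit b, point k T x • res M (orbitHull_le x U) m = 0 := by
  simp only [plusKer, Submodule.mem_iInf, Submodule.mem_comap]
  exact forall_congr' fun x => (hM _).mem_stalkKer_iff hT

section CatP

variable (hT : Module.Flat (SymAlg P k) T) (hM : isP b k T M)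
include hT hM

/-- The component at `x` of a section over `W` vanishes if it vanishes over some open subset that
contains `W ∩ x`. -/
theorem isP.point_smul_eq_zero_of_inter_subset (h : U ≤ W) {x : Orbit b}
    (hx : (W : Set (AlcoveSpace b k T)) ∩ orbitSet x ⊆ U) {m : M.obj (op W)}
    (hm : point k T x • res M h m = 0) : point k T x • m = 0 := by
  obtain ⟨h₁, -, h₂, h₃⟩ := hM
  refine (supportCondition_iff hT h₁ h₂).1 h₃ x W m ?_
  rw [← res_res (show orbitHull x W ≤ U from openHull_le hx) h]
  exact point_smul_res_eq_zero _ hm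

/-- If `M` in `𝐏` is supported on the finite set `𝒯`, then the component at `x` of a section over
`W` vanishes if it vanishes over some open subset `U` that contains `W ∩ x ∩ 𝒯`. -/
theorem isP.point_smul_eq_zero_of_isSupportedOn {𝒯 : Set (AlcoveSpace b k T)} (h𝒯 : 𝒯.Finite)
    (hM𝒯 : IsSupportedOn M 𝒯) (h : U ≤ W) {x : Orbit b}
    (hx : (W : Set (AlcoveSpace b k T)) ∩ orbitSet x ∩ 𝒯 ⊆ U) {m : M.obj (op W)}
    (hm : point k T x • res M h m = 0) : point k T x • m = 0 := by
  have hfin (W : Opens (AlcoveSpace b k T)) : ((W : Set (AlcoveSpace b k T)) ∩ 𝒯).Finite :=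
    h𝒯.subset Set.inter_subset_right
  induction hn : ((W : Set (AlcoveSpace b k T)) ∩ 𝒯).ncard using Nat.strong_induction_on
    generalizing U W with
  | _ n ih =>
  subst hn
  by_cases hU : (W : Set (AlcoveSpace b k T)) ∩ 𝒯 ⊆ U
  · have := hM𝒯 W
    refine eq_zero_of_isIso (res M (openHull_le (Set.inter_subset_left (s := (W : Set _))
      (t := 𝒯)))) ?_
    rw [map_smul, ← res_res (openHull_le hU) h]
    exact point_smul_res_eq_zero _ hm
  -- A maximal alcove `A` of `W ∩ 𝒯` outside `U` is not in `x`, and restricting alternately to the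
  -- hulls of the intersections with `x` and with `𝒯` removes it.
  obtain ⟨A₀, hA₀, hA₀U⟩ := Set.not_subset.1 hU
  obtain ⟨A, ⟨hA, hAU⟩, hAmax⟩ := ((hfin W).subset
    (Set.sdiff_subset (t := (U : Set (AlcoveSpace b k T))))).exists_maximal ⟨A₀, hA₀, hA₀U⟩
  let W₁ := orbitHull x W
  let W₂ : Opens (AlcoveSpace b k T) := openHull (W₁ ∩ 𝒯)
  let W₃ := orbitHull x W₂
  have h₁ : W₁ ≤ W := orbitHull_le x W
  have h₂ : W₂ ≤ W₁ := openHull_le Set.inter_subset_left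
  have h₃ : W₃ ≤ W₂ := orbitHull_le x W₂
  have h₃W : W₃ ≤ W := h₃.trans (h₂.trans h₁)
  have hA₃ : A ∉ W₃ := by
    rintro ⟨B, ⟨⟨C, hC, hBC⟩, hBx⟩, hAB⟩
    have hCU : C ∉ U := fun hCU => hAU (mem_of_le (hAB.trans hBC) hCU)
    have hCA : C ≤ A := hAmax ⟨⟨h₁ hC.1, hC.2⟩, hCU⟩ (hAB.trans hBC)
    obtain rfl : A = B := AlcoveLE.antisymm hAB (hBC.trans hCA)
    exact hAU (hx ⟨⟨hA.1, hBx⟩, hA.2⟩)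
  have hlt : ((W₃ : Set (AlcoveSpace b k T)) ∩ 𝒯).ncard <
      ((W : Set (AlcoveSpace b k T)) ∩ 𝒯).ncard :=
    Set.ncard_lt_ncard ⟨Set.inter_subset_inter_left _ h₃W, fun hs => hA₃ (hs hA).1⟩ (hfin W)
  have key : point k T x • res M h₃W m = 0 := by
    refine ih _ hlt (U := U ⊓ W₃) inf_le_right
      (fun B hB => ⟨hx ⟨⟨h₃W hB.1.1, hB.1.2⟩, hB.2⟩, hB.1.1⟩) ?_ rfl
    rw [res_res, ← res_res (inf_le_left (a := U) (b := W₃)) h]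
    exact point_smul_res_eq_zero _ hm
  refine hM.point_smul_eq_zero_of_inter_subset hT h₁ (subset_lowerClosure) ?_
  have := hM𝒯 W₁
  refine eq_zero_of_isIso (res M h₂) ?_
  rw [map_smul]
  refine hM.point_smul_eq_zero_of_inter_subset hT h₃ (subset_lowerClosure) ?_
  rwa [res_res, res_res]

end CatP

end Presheaves

/-! ### The presheaf `ε_s M` -/

section Epsilon

variable {ι : Type*} [Finite ι] {V N k T : Type u} [AddCommGroup V] [Module ℝ V]
  [AddCommGroup N] [Module ℝ N] {P : RootPairing ι ℝ V N} [P.IsRootSystem] [P.IsCrystallographic]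
  [P.IsReduced] {b : P.Base} [TopologicalSpace V] [IsTopologicalAddGroup V] [ContinuousSMul ℝ V]
  [T2Space V] [FiniteDimensional ℝ V] [Field k] [CommRing T] [Algebra (SymAlg P k) T]
  {M : Psh b k T} {U W : Opens (AlcoveSpace b k T)}
  {s : affineWeylGroup b} (hs : IsSimpleAffineReflection b s.1) (hk : GKM b k)
  (hT : Module.Flat (SymAlg P k) T)

theorem sharp_mono (h : U ≤ W) : sharp s U ≤ sharp s W :=
  ((sharpFunctor s.1).map (homOfLE h)).le

variable (M U) in
/-- The map `(ε_s M)(𝒥) → M(𝒥^♯)`, `z ⊗ m ↦ z m`. -/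
def sectionFst : ((epsilon b k T s.1).obj M).obj (op U) →+ M.obj (op (sharp s U)) :=
  (wallExtension hs hk hT).fst (M.obj (op (sharp s U)))

variable (M U) in
/-- The map `(ε_s M)(𝒥) → M(𝒥^♯)`, `z ⊗ m ↦ s(z) m`. -/
def sectionSnd : ((epsilon b k T s.1).obj M).obj (op U) →+ M.obj (op (sharp s U)) :=
  (wallExtension hs hk hT).snd (M.obj (op (sharp s U)))

theorem sectionFst_res (h : U ≤ W) (n : ((epsilon b k T s.1).obj M).obj (op W)) :
    sectionFst M U hs hk hT (res _ h n) = res M (sharp_mono h) (sectionFst M W hs hk hT n) :=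
  (wallExtension hs hk hT).fst_map (res M (sharp_mono h)) n

theorem sectionSnd_res (h : U ≤ W) (n : ((epsilon b k T s.1).obj M).obj (op W)) :
    sectionSnd M U hs hk hT (res _ h n) = res M (sharp_mono h) (sectionSnd M W hs hk hT n) :=
  (wallExtension hs hk hT).snd_map (res M (sharp_mono h)) n

variable (hM : ∀ U, RootTorsionFree (M.obj U))
include hM

theorem eq_zero_of_sectionFst_of_sectionSnd {n : ((epsilon b k T s.1).obj M).obj (op U)}
    (h₁ : sectionFst M U hs hk hT n = 0) (h₂ : sectionSnd M U hs hk hT n = 0) : n = 0 :=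
  eq_zero_of_fst_of_snd hs hk hT (hM _) h₁ h₂

theorem epsilon_point_smul_eq_zero_iff {x : Orbit b}
    {n : ((epsilon b k T s.1).obj M).obj (op U)} : point k T x • n = 0 ↔
      point k T x • sectionFst M U hs hk hT n = 0 ∧
      point k T (orbitMul s x) • sectionSnd M U hs hk hT n = 0 :=
  point_smul_eq_zero_iff hs hk hT (hM _)

include hs hk hT

theorem epsilon_rootTorsionFree (U : (Opens (AlcoveSpace b k T))ᵒᵖ) :
    RootTorsionFree (((epsilon b k T s.1).obj M).obj U) :=
  RootTorsionFree.induce hs hk hT (hM (op (sharp s U.unop)))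

/-- The kernel of `ε_s M → (ε_s M)^+` in terms of components: a section over `𝒥` is tested over
`((𝒥 ∩ x)_⪯)^♯`. -/
theorem mem_plusKer_epsilon_iff {n : ((epsilon b k T s.1).obj M).obj (op U)} :
    n ∈ plusKer ((epsilon b k T s.1).obj M) U ↔ ∀ x : Orbit b,
      point k T x • res M (sharp_mono (orbitHull_le x U)) (sectionFst M U hs hk hT n) = 0 ∧
      point k T (orbitMul s x) •
        res M (sharp_mono (orbitHull_le x U)) (sectionSnd M U hs hk hT n) = 0 := by
  refine (mem_plusKer_iff hT (epsilon_rootTorsionFree hs hk hT hM)).trans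
    (forall_congr' fun x => ?_)
  rw [← sectionFst_res, ← sectionSnd_res]
  exact epsilon_point_smul_eq_zero_iff hs hk hT hM

omit hM

theorem epsilon_isFlabby (hM : IsFlabby M) : IsFlabby ((epsilon b k T s.1).obj M) :=
  fun _ _ h => induce_map_surjective hs hk hT (hM (sharp_mono (s := s) h))

theorem subsingleton_epsilon_bot (hM : Subsingleton (M.obj (op ⊥))) :
    Subsingleton (((epsilon b k T s.1).obj M).obj (op ⊥)) := by
  have hbot : sharp s (⊥ : Opens (AlcoveSpace b k T)) = ⊥ := by
    ext A
    change A ∈ sharp s ⊥ ↔ A ∈ (⊥ : Opens (AlcoveSpace b k T))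
    rw [mem_sharp_iff hs]
    exact or_iff_left_of_imp fun h => h
  have : Subsingleton (M.obj (op (sharp s (⊥ : Opens (AlcoveSpace b k T))))) := by
    rw [hbot]
    exact hM
  refine subsingleton_of_forall_eq 0 fun n => ?_
  obtain ⟨m, m', h⟩ := (wallExtension hs hk hT).exists_eq
    (M := M.obj (op (sharp s (⊥ : Opens (AlcoveSpace b k T))))) n
  refine h.trans ?_
  rw [Subsingleton.elim m 0, Subsingleton.elim m' 0, map_zero, smul_zero, add_zero]
  rfl

/-- The restriction `(ε_s M)(𝒥^♯) → (ε_s M)(𝒥)` is an isomorphism. -/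
theorem isIso_epsilon_res (U : Opens (AlcoveSpace b k T)) :
    IsIso (res ((epsilon b k T s.1).obj M) (le_sharp hs U)) := by
  have : IsIso ((sharpFunctor s.1).map (homOfLE (le_sharp hs U))) :=
    ⟨homOfLE (sharp_sharp hs U).le, Subsingleton.elim _ _, Subsingleton.elim _ _⟩
  change IsIso ((induce s.1).map (M.map ((sharpFunctor s.1).map (homOfLE (le_sharp hs U))).op))
  infer_instance

end Epsilon

/-! ### The presheaf `ϑ_s M` -/

section Theta

variable {ι : Type*} [Finite ι] {V N k T : Type u} [AddCommGroup V] [Module ℝ V]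
  [AddCommGroup N] [Module ℝ N] {P : RootPairing ι ℝ V N} [P.IsRootSystem] [P.IsCrystallographic]
  [P.IsReduced] {b : P.Base} [TopologicalSpace V] [IsTopologicalAddGroup V] [ContinuousSMul ℝ V]
  [T2Space V] [FiniteDimensional ℝ V] [Field k] [CommRing T] [Algebra (SymAlg P k) T]
  {M : Psh b k T} {U W : Opens (AlcoveSpace b k T)}

theorem plus_isFlabby (hM : IsFlabby M) : IsFlabby ((plus b k T).obj M) := by
  intro U W h n
  obtain ⟨n, rfl⟩ := Submodule.Quotient.mk_surjective _ n
  obtain ⟨m, rfl⟩ := hM h n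
  exact ⟨Submodule.Quotient.mk m, rfl⟩

variable (hT : Module.Flat (SymAlg P k) T) (hM : ∀ U, RootTorsionFree (M.obj U))
include hT hM

theorem plus_rootTorsionFree (U : (Opens (AlcoveSpace b k T))ᵒᵖ) :
    RootTorsionFree (((plus b k T).obj M).obj U) := by
  intro i hi n n' h
  obtain ⟨n, rfl⟩ := Submodule.Quotient.mk_surjective _ n
  obtain ⟨n', rfl⟩ := Submodule.Quotient.mk_surjective _ n'
  have hd : corootT P k T i ∈ corootMonoid b k T := Submonoid.subset_closure ⟨i, hi, rfl⟩
  have h' : algebraMap T (StructureAlgebra b k T) (corootT P k T i) • n -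
      algebraMap T (StructureAlgebra b k T) (corootT P k T i) • n' ∈ plusKer M U.unop :=
    (Submodule.Quotient.eq _).1 h
  refine (Submodule.Quotient.eq _).2 ?_
  rw [← smul_sub, mem_plusKer_iff hT hM] at h'
  rw [mem_plusKer_iff hT hM]
  intro x
  refine (hM _).eq_zero hd ?_
  rw [smul_comm, ← map_smul]
  exact h' x

/-- The support condition holds for `M^+` for every flabby presheaf `M` of root torsion free
modules. -/
theorem plus_supportCondition (hM' : IsFlabby M) : SupportCondition ((plus b k T).obj M) := by
  rw [supportCondition_iff hT (plus_isFlabby hM') (plus_rootTorsionFree hT hM)]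
  intro x U n h
  obtain ⟨n, rfl⟩ := Submodule.Quotient.mk_surjective _ n
  have h' : point k T x • res M (orbitHull_le x U) n ∈ plusKer M (orbitHull x U) :=
    (Submodule.Quotient.mk_eq_zero _).1 h
  refine (Submodule.Quotient.mk_eq_zero _).2 ?_
  change point k T x • n ∈ plusKer M U
  rw [mem_plusKer_iff hT hM] at h' ⊢
  intro y
  rw [map_smul]
  by_cases hy : y = x
  · subst hy
    have := h' y
    rw [← map_smul] at this
    exact eq_zero_of_res_eq_zero (orbitHull_le y _) (fun A hA => by
      obtain ⟨B, hB, hAB⟩ := hA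
      exact ⟨B, ⟨subset_lowerClosure hB, hB.2⟩, hAB⟩) this
  · exact point_smul_point_smul_of_ne hT (Ne.symm hy) _

end Theta

section WallCrossing

variable {ι : Type*} [Finite ι] {V N k T : Type u} [AddCommGroup V] [Module ℝ V]
  [AddCommGroup N] [Module ℝ N] {P : RootPairing ι ℝ V N} [P.IsRootSystem] [P.IsCrystallographic]
  [P.IsReduced] {b : P.Base} [TopologicalSpace V] [IsTopologicalAddGroup V] [ContinuousSMul ℝ V]
  [T2Space V] [FiniteDimensional ℝ V] [Field k] [CommRing T] [Algebra (SymAlg P k) T]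
  {M : Psh b k T} {U W : Opens (AlcoveSpace b k T)}
  {s : affineWeylGroup b} (hs : IsSimpleAffineReflection b s.1) (hk : GKM b k)
  (hT : Module.Flat (SymAlg P k) T)
include hs hk hT

/-- If `M` is supported on the finite set `𝒯`, then the vanishing in `(ε_s M)^+` of a section of
`ε_s M` over `W` can be tested over open subsets that contain `W ∩ (𝒯 ∪ 𝒯 s)`. -/
theorem mem_plusKer_epsilon_of_res (hM : isP b k T M) {𝒯 : Set (AlcoveSpace b k T)}
    (h𝒯 : 𝒯.Finite) (hM𝒯 : IsSupportedOn M 𝒯) (h : U ≤ W)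
    (hU : (W : Set (AlcoveSpace b k T)) ∩ (𝒯 ∪ spaceMul s ⁻¹' 𝒯) ⊆ U)
    {n : ((epsilon b k T s.1).obj M).obj (op W)}
    (hn : res ((epsilon b k T s.1).obj M) h n ∈ plusKer ((epsilon b k T s.1).obj M) U) :
    n ∈ plusKer ((epsilon b k T s.1).obj M) W := by
  refine (mem_plusKer_epsilon_iff hs hk hT hM.2.2.1).2 fun x => ?_
  have hx : sharp s (orbitHull x U) ≤ sharp s (orbitHull x W) := sharp_mono (orbitHull_mono x h)
  obtain ⟨h₁, h₂⟩ := (mem_plusKer_epsilon_iff hs hk hT hM.2.2.1).1 hn x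
  rw [sectionFst_res hs hk hT h n, res_res,
    ← res_res hx (sharp_mono (orbitHull_le x W))] at h₁
  rw [sectionSnd_res hs hk hT h n, res_res,
    ← res_res hx (sharp_mono (orbitHull_le x W))] at h₂
  constructor
  · refine hM.point_smul_eq_zero_of_isSupportedOn hT h𝒯 hM𝒯 hx ?_ h₁
    rintro A ⟨⟨hA, hAx⟩, hA𝒯⟩
    refine (mem_sharp_orbitHull_iff hs hAx).2 (hU ⟨?_, Or.inl hA𝒯⟩)
    exact (mem_sharp_orbitHull_iff hs hAx).1 hA
  · refine hM.point_smul_eq_zero_of_isSupportedOn hT h𝒯 hM𝒯 hx ?_ h₂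
    rintro A ⟨⟨hA, hAx⟩, hA𝒯⟩
    refine (mem_sharp_orbitHull_iff' hs hAx).2 (hU ⟨?_, Or.inr ?_⟩)
    · exact (mem_sharp_orbitHull_iff' hs hAx).1 hA
    · rw [Set.mem_preimage, spaceMul_spaceMul hs]
      exact hA𝒯

theorem isSupportedOn_plus_epsilon (hM : isP b k T M) {𝒯 : Set (AlcoveSpace b k T)}
    (h𝒯 : 𝒯.Finite) (hM𝒯 : IsSupportedOn M 𝒯) :
    IsSupportedOn ((plus b k T).obj ((epsilon b k T s.1).obj M)) (𝒯 ∪ spaceMul s ⁻¹' 𝒯) := by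
  intro U
  refine isIso_of_surjective (plus_isFlabby (epsilon_isFlabby hs hk hT hM.1) _) fun n hn => ?_
  obtain ⟨n, rfl⟩ := Submodule.Quotient.mk_surjective _ n
  exact (Submodule.Quotient.mk_eq_zero _).2 (mem_plusKer_epsilon_of_res hs hk hT hM h𝒯 hM𝒯 _
    subset_lowerClosure ((Submodule.Quotient.mk_eq_zero _).1 hn))

/-- The support condition comes for free from the passage to `(·)^+`; the finite set that carries
`ϑ_s M` is `𝒯 ∪ 𝒯 s` if `𝒯` carries `M`. -/
theorem isP_plus_epsilon (hM : isP b k T M) :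
    isP b k T ((plus b k T).obj ((epsilon b k T s.1).obj M)) := by
  obtain ⟨𝒯, h𝒯, hM𝒯⟩ := hM.2.1.2
  have hflabby := epsilon_isFlabby hs hk hT hM.1
  have hRTF := epsilon_rootTorsionFree hs hk hT hM.2.2.1
  refine ⟨plus_isFlabby hflabby, ⟨?_, 𝒯 ∪ spaceMul s ⁻¹' 𝒯, h𝒯.union ?_,
    isSupportedOn_plus_epsilon hs hk hT hM h𝒯 hM𝒯⟩, plus_rootTorsionFree hT hRTF,
    plus_supportCondition hT hRTF hflabby⟩
  · have := subsingleton_epsilon_bot hs hk hT hM.2.1.1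
    exact (Submodule.Quotient.mk_surjective
      (plusKer ((epsilon b k T s.1).obj M) ⊥)).subsingleton
  · exact h𝒯.preimage (Function.LeftInverse.injective (spaceMul_spaceMul hs)).injOn

/-- Over `s`-invariant open sets the morphism `ε_s M → (ε_s M)^+` is injective. -/
theorem plusKer_epsilon_eq_bot (hM : isP b k T M)
    (hU : IsInvariant s.1 (U : Set (AlcoveSpace b k T))) :
    plusKer ((epsilon b k T s.1).obj M) U = ⊥ := by
  refine (Submodule.eq_bot_iff _).2 fun n hn => ?_
  have h := (mem_plusKer_epsilon_iff hs hk hT hM.2.2.1).1 hn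
  have hmem (A : AlcoveSpace b k T) : A ∈ sharp s U ↔ A ∈ U := by rw [sharp_eq_self hs hU]
  refine eq_zero_of_sectionFst_of_sectionSnd hs hk hT hM.2.2.1 ?_ ?_
  · refine (hM.2.2.1 _).eq_zero_of_point_smul hT fun x => ?_
    refine hM.point_smul_eq_zero_of_inter_subset hT (sharp_mono (orbitHull_le x U)) ?_ (h x).1
    rintro A ⟨hA, hAx⟩
    exact (mem_sharp_orbitHull_iff hs hAx).2 ((hmem A).1 hA)
  · refine (hM.2.2.1 _).eq_zero_of_point_smul hT fun y => ?_
    obtain ⟨x, rfl⟩ : ∃ x, orbitMul s x = y := ⟨_, orbitMul_orbitMul hs y⟩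
    refine hM.point_smul_eq_zero_of_inter_subset hT (sharp_mono (orbitHull_le x U)) ?_ (h x).2
    rintro A ⟨hA, hAx⟩
    exact (mem_sharp_orbitHull_iff' hs hAx).2 (((isInvariant_iff hs).1 hU A).1 ((hmem A).1 hA))

section Universal

variable {F : Psh b k T} {σ : (epsilon b k T s.1).obj M ⟶ F}
  (hσ : ∀ U : Opens (AlcoveSpace b k T), IsInvariant s.1 (U : Set (AlcoveSpace b k T)) →
    IsIso (σ.app (op U)))

omit hk hT hs in
theorem app_res {F' : Psh b k T} (σ : F' ⟶ F) (h : U ≤ W) (n : F'.obj (op W)) :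
    σ.app (op U) (res F' h n) = res F h (σ.app (op W) n) :=
  congrArg (fun g => g.hom n) (σ.naturality (homOfLE h).op)

omit hk hT in
include hσ in
/-- A morphism from `ε_s M` to a flabby presheaf that is an isomorphism over invariant open sets is
surjective. -/
theorem app_surjective (hF : IsFlabby F) : Function.Surjective (σ.app (op U)) := by
  intro m
  obtain ⟨m, rfl⟩ := hF (le_sharp hs U) m
  have := hσ _ (isInvariant_sharp hs U)
  obtain ⟨n, rfl⟩ := ((ConcreteCategory.isIso_iff_bijective (σ.app (op (sharp s U)))).1 this).2 m
  exact ⟨_, app_res σ (le_sharp hs U) n⟩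

include hσ in
/-- A morphism from `ε_s M` to a presheaf in `𝐏` that is an isomorphism over invariant open sets
has the same kernel as `ε_s M → (ε_s M)^+`. Indeed, the section can be tested over the open sets
`(𝒥 ∩ x)_⪯`, and hence over the invariant open sets `((𝒥 ∩ x)_⪯)^♯`. -/
theorem app_eq_zero_iff (hM : isP b k T M) (hF : isP b k T F)
    {n : ((epsilon b k T s.1).obj M).obj (op U)} :
    σ.app (op U) n = 0 ↔ n ∈ plusKer ((epsilon b k T s.1).obj M) U := by
  have key (x : Orbit b) : point k T x • σ.app (op U) n = 0 ↔
      point k T x • res ((epsilon b k T s.1).obj M) (orbitHull_le x U) n = 0 := by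
    have h₁ : IsIso (res ((epsilon b k T s.1).obj M) (le_sharp hs (orbitHull x U))) :=
      isIso_epsilon_res hs hk hT (orbitHull x U)
    have h₂ := hσ _ (isInvariant_sharp hs (orbitHull x U))
    obtain ⟨n', hn'⟩ := ((ConcreteCategory.isIso_iff_bijective
      (res ((epsilon b k T s.1).obj M) (le_sharp hs (orbitHull x U)))).1 h₁).2
      (res ((epsilon b k T s.1).obj M) (orbitHull_le x U) n)
    constructor
    · intro h
      rw [← hn']
      refine point_smul_res_eq_zero _ (eq_zero_of_isIso (σ.app _) ?_)
      rw [map_smul]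
      refine hF.point_smul_eq_zero_of_inter_subset hT (le_sharp hs (orbitHull x U)) ?_ ?_
      · rintro A ⟨hA, hAx⟩
        exact (mem_orbitHull_of_orb_eq hAx).2 ((mem_sharp_orbitHull_iff hs hAx).1 hA)
      · rw [← app_res, hn', app_res]
        exact point_smul_res_eq_zero _ h
    · intro h
      refine hF.point_smul_eq_zero_of_inter_subset hT (orbitHull_le x U) subset_lowerClosure ?_
      rw [← app_res, ← map_smul, h, map_zero]
  refine Iff.trans ?_ ((forall_congr' key).trans
    (mem_plusKer_iff hT (epsilon_rootTorsionFree hs hk hT hM.2.2.1)).symm)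
  refine ⟨fun h x => ?_, (hF.2.2.1 _).eq_zero_of_point_smul hT⟩
  rw [h, smul_zero]

end Universal

end WallCrossing

/-! ### The universal property -/

section UniversalProperty

variable {ι : Type*} [Finite ι] {V N k T : Type u} [AddCommGroup V] [Module ℝ V]
  [AddCommGroup N] [Module ℝ N] {P : RootPairing ι ℝ V N} [P.IsRootSystem] [P.IsCrystallographic]
  [P.IsReduced] {b : P.Base} [TopologicalSpace V] [IsTopologicalAddGroup V] [ContinuousSMul ℝ V]
  [T2Space V] [FiniteDimensional ℝ V] [Field k] [CommRing T] [Algebra (SymAlg P k) T]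

/-- The factorization of a morphism `M → F` over `M → M^+`. -/
def plusDesc {M F : Psh b k T} (σ : M ⟶ F)
    (h : ∀ U (n : M.obj U), n ∈ plusKer M U.unop → σ.app U n = 0) : (plus b k T).obj M ⟶ F where
  app U := ModuleCat.ofHom ((plusKer M U.unop).liftQ (σ.app U).hom (h U))
  naturality U W f := by
    ext m
    obtain ⟨m, rfl⟩ := Submodule.Quotient.mk_surjective _ m
    exact congrArg (fun g => g.hom m) (σ.naturality f)

theorem isIso_plusDesc {M F : Psh b k T} (σ : M ⟶ F) (hσ : ∀ U, Function.Surjective (σ.app U))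
    (h : ∀ U (n : M.obj U), σ.app U n = 0 ↔ n ∈ plusKer M U.unop) :
    IsIso (plusDesc σ fun U n => (h U n).2) := by
  have h' (U) : IsIso ((plusDesc σ fun U n => (h U n).2).app U) := by
    refine isIso_of_surjective (fun m => ?_) fun n hn => ?_
    · obtain ⟨n, rfl⟩ := hσ U m
      exact ⟨Submodule.Quotient.mk n, rfl⟩
    · obtain ⟨n, rfl⟩ := Submodule.Quotient.mk_surjective _ n
      exact (Submodule.Quotient.mk_eq_zero _).2 ((h U n).1 hn)
  exact NatIso.isIso_of_isIso_app _

variable {s : V ≃ᵃ[ℝ] V} {h : ∀ M : CatP b k T, isP b k T ((thetaPsh b k T s).obj M)}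
  {F : CatP b k T ⥤ CatP b k T}

/-- Morphisms from `ϑ_s` are determined by their composition with `ρ_s`. -/
theorem hom_ext_of_rho {e e' : theta b k T s h ⟶ F}
    (he : rho b k T s h ≫ Functor.whiskerRight e (isP b k T).ι =
      rho b k T s h ≫ Functor.whiskerRight e' (isP b k T).ι) : e = e' := by
  ext M : 2
  apply (isP b k T).ι.map_injective
  ext U n
  obtain ⟨n, rfl⟩ := Submodule.Quotient.mk_surjective _ n
  exact congrArg (fun g => ((g.app M).app U).hom n) he

/-- If the natural transformation `σ : ε_s → F` is surjective, and if `σ` and `ρ_s` have the same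
kernels, then `F` is isomorphic to `ϑ_s`, compatibly with `σ` and `ρ_s`. -/
theorem existsUnique_iso_of_surjective (σ : epsilonP b k T s ⟶ F ⋙ (isP b k T).ι)
    (hσ : ∀ M U, Function.Surjective ((σ.app M).app U))
    (hσ' : ∀ M U (n : ((epsilonP b k T s).obj M).obj U),
      (σ.app M).app U n = 0 ↔ n ∈ plusKer ((epsilonP b k T s).obj M) U.unop) :
    ∃! e : theta b k T s h ≅ F,
      rho b k T s h ≫ Functor.whiskerRight e.hom (isP b k T).ι = σ := by
  let β : theta b k T s h ⋙ (isP b k T).ι ⟶ F ⋙ (isP b k T).ι :=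
    { app := fun M => plusDesc (σ.app M) fun U n => (hσ' M U n).2
      naturality := fun M M' f => by
        ext U n
        obtain ⟨n, rfl⟩ := Submodule.Quotient.mk_surjective _ n
        exact congrArg (fun g => (g.app U).hom n) (σ.naturality f) }
  have hβ (M) : IsIso (β.app M) := isIso_plusDesc (σ.app M) (hσ M) (hσ' M)
  have : IsIso β := NatIso.isIso_of_isIso_app _
  let Φ := (isP b k T).fullyFaithfulι.whiskeringRight (CatP b k T)
  let e : theta b k T s h ≅ F := Φ.preimageIso (asIso β)
  have he : Functor.whiskerRight e.hom (isP b k T).ι = β := Φ.map_preimage β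
  have he' : rho b k T s h ≫ Functor.whiskerRight e.hom (isP b k T).ι = σ := by
    rw [he]
    ext M U n
    rfl
  exact ⟨e, he', fun e' h' => Iso.ext (hom_ext_of_rho (h'.trans he'.symm))⟩

end UniversalProperty

end AlcoveSheaves

end

open AlcoveSheaves in
theorem mainTheorem3 {ι : Type*} [Finite ι] {V N k T : Type u}
    [AddCommGroup V] [Module ℝ V] [FiniteDimensional ℝ V]
    [TopologicalSpace V] [IsTopologicalAddGroup V] [ContinuousSMul ℝ V] [T2Space V]
    [AddCommGroup N] [Module ℝ N]
    (P : RootPairing ι ℝ V N) [P.IsRootSystem] [P.IsCrystallographic] [P.IsReduced]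
    [P.IsIrreducible] (b : P.Base)
    [Field k] (hk : GKM b k)
    [CommRing T] [Algebra (SymAlg P k) T] (hT : IsBaseRing b k T)
    (s : V ≃ᵃ[ℝ] V) (hs : IsSimpleAffineReflection b s) :
    (∀ U : Opens (AlcoveSpace b k T), IsOpen (sharpSet s (U : Set (AlcoveSpace b k T)))) ∧
    ∃ h : ∀ M : CatP b k T, isP b k T ((thetaPsh b k T s).obj M),
      IsIsoOnInvariants s (rho b k T s h) ∧
      ∀ (F : CatP b k T ⥤ CatP b k T) (σ : epsilonP b k T s ⟶ F ⋙ (isP b k T).ι),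
        IsIsoOnInvariants s σ →
          ∃! e : theta b k T s h ≅ F,
            rho b k T s h ≫ Functor.whiskerRight e.hom (isP b k T).ι = σ := by
  obtain ⟨s, rfl⟩ : ∃ s' : affineWeylGroup b, s'.1 = s := by
    obtain ⟨i, -, n, rfl, -⟩ := hs
    exact ⟨⟨_, affineReflection_mem b i n⟩, rfl⟩
  refine ⟨isOpen_sharpSet hs, fun M => isP_plus_epsilon hs hk hT.flat M.property, fun M U hU => ?_,
    fun F σ hσ => existsUnique_iso_of_surjective σ
      (fun M U => app_surjective hs (hσ M) (F.obj M).property.1)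
      fun M U n => app_eq_zero_iff hs hk hT.flat (hσ M) M.property (F.obj M).property⟩
  refine isIso_of_surjective (Submodule.Quotient.mk_surjective _) fun n hn => ?_
  exact (Submodule.eq_bot_iff _).1 (plusKer_epsilon_eq_bot hs hk hT.flat M.property hU) n
    ((Submodule.Quotient.mk_eq_zero _).1 hn)
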